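/- **Setting.** Let $\mathbb{K}$ be a field. Costs are counted in the algebraic model (algebraic computation trees over $\mathbb{K}$): each operation $+,-,\times,/$ in $\mathbb{K}$ and each zero test costs one unit; everything else (handling indices, degrees and shifts, loading constants of $\mathbb{K}$) is free. For $\mathbf{s}=(s_1,\dots,s_m)\in\mathbb{Z}^m$, the $\mathbf{s}$-degree of $p=(p_1,\dots,p_m)\in\mathbb{K}[x]^{1\times m}$ is $\max_j(\deg p_j+s_j)$, and its $\mathbf{s}$-pivot is its rightmost entry $p_j$ for which this maximum is reached. For a matrix $P$, $\mathrm{rdeg}_{\mathbf{s}}(P)$ is the list of $\mathbf{s}$-degrees of its rows. A nonsingular $P\in\mathbb{K}[x]^{m\times m}$ is in $\mathbf{s}$-ordered weak Popov form if the $\mathbf{s}$-pivots of its rows are located on the diagonal; it is in $\mathbf{s}$-Popov form if moreover the diagonal entries are monic and each of them has degree larger than the other entries of its column. Given $E=(E_1,\dots,E_d)$ in $\mathbb{K}^{m\times n}$ and pairwise distinct $\alpha=(\alpha_1,\dots,\alpha_d)$ in $\mathbb{K}$, let $$\mathcal{I}_\alpha(E)=\{p\in\mathbb{K}[x]^{1\times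 m}\mid p(\alpha_i)E_i=0\ \text{for}\ 1\le i\le d\}.$$ **Algorithms.** $\text{M-Basis-1}(R,\mathbf{t})$, for $R\in\mathbb{K}^{m\times n}$, returns the $\mathbf{t}$-Popov basis (a matrix $Q_0+xQ_1$ with $Q_0,Q_1\in\mathbb{K}^{m\times m}$) of the module of all $p\in\mathbb{K}[x]^{1\times m}$ with $pR=0\bmod x$. $\text{M-IntBasis}(E,\alpha,\mathbf{s})$: start with $P=I_m$ and $\mathbf{t}=\mathbf{s}$. For $k=1,\dots,d$: compute $R=P(\alpha_k)E_k$; let $Q(x)$ be $\text{M-Basis-1}(R,\mathbf{t})$ with $x$ replaced by $x-\alpha_k$; replace $P$ by $QP$, and then $\mathbf{t}$ by $\mathrm{rdeg}_{\mathbf{s}}(P)$. Return $P$. $\text{PM-IntBasis}(E,\alpha,\mathbf{s})$, with a fixed threshold $T\ge1$: if $d\le T$, return $\text{M-IntBasis}(E,\alpha,\mathbf{s})$. Otherwise let $h=\lceil d/2\rceil$; let $P_1=\text{PM-IntBasis}((E_1,\dots,E_h),(\alpha_1,\dots,\alpha_h),\mathbf{s})$; compute $R_i=P_1(\alpha_i)E_i$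 for $h<i\le d$ and $\mathbf{t}=\mathrm{rdeg}_{\mathbf{s}}(P_1)$; let $P_2=\text{PM-IntBasis}((R_{h+1},\dots,R_d),(\alpha_{h+1},\dots,\alpha_d),\mathbf{t})$; return $P_2P_1$. The building blocks of these algorithms are M-Basis-1, the product of $m\times m$ matrices over $\mathbb{K}[x]$, the evaluation of an $m\times m$ matrix over $\mathbb{K}[x]$ at a list of points, and the product of an $m\times m$ by an $m\times n$ matrix over $\mathbb{K}$. **Proposition.** (Correctness.) For all $m,n,d\ge 0$, all $T\ge1$, all $\mathbf{s}\in\mathbb{Z}^m$, all $E$ and all pairwise distinct $\alpha$ as above, whatever correct implementations of the building blocks are used, PM-IntBasis returns a matrix in $\mathbf{s}$-ordered weak Popov form whose rows form a basis of the $\mathbb{K}[x]$-module $\mathcal{I}_\alpha(E)$. (Cost.) Let $\mathsf{M}:\mathbb{N}\to\mathbb{N}$, $\mathsf{MM}:\mathbb{N}^2\to\mathbb{N}$ and $\omega>2$ be such that polynomials of degree at most $d$ in $\mathbb{K}[x]$ can be multiplied in $\mathsf{M}(d)$ operations, two $n\times n$ matrices over $\mathbb{K}[x]$ of degree at most $d$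 can be multiplied in $\mathsf{MM}(n,d)$ operations, and two $n\times n$ matrices over $\mathbb{K}$ can be multiplied in $O(n^\omega)$ operations. Assume that $d\mapsto\mathsf{M}(d)/d$ and, for each $n$, $d\mapsto\mathsf{MM}(n,d)/d$ are nondecreasing on $d\ge1$, that $\mathsf{MM}(n,d)\in\Omega(n^2\mathsf{M}(d))$ for $d\ge1$, and that $\mathsf{MM}(n,1)\in\Omega(n^\omega)$. Let $$\mathsf{MM}'(m,d)=\sum_{i=0}^{\lfloor\log_2 d\rfloor}2^i\,\mathsf{MM}(m,\lfloor d/2^i\rfloor),\qquad \mathrm{lg}(d)=\max(1,\log_2 d).$$ Then for every $T\ge1$ there are correct implementations of the building blocks with which the cost of PM-IntBasis, for all $m,d\ge1$, $n\ge0$, $\mathbf{s}$, $E$ and $\alpha$ as above, is as follows, where the constants in $O(\cdot)$ do not depend on $m,n,d,\mathbf{s},E,\alpha$. * If $\alpha$ is a geometric progression (there are $a,q\in\mathbb{K}$ with $\alpha_i=a\,q^{i-1}$ for all $i$), the cost is in $O(\mathsf{MM}'(m,d))$ if $n\le m$, and in $O(\mathsf{MM}'(m,d)+m^{\omega-1}\,n\,d\,\mathrm{lg}(d))$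 if $n>m$. * For general pairwise distinct points $\alpha$, the cost is in $O(\mathsf{MM}'(m,d)+m^2\,\mathsf{M}(d)\,\mathrm{lg}(d)^2)$ if $n\le m$, and in $O(\mathsf{MM}'(m,d)+m^{\omega-1}\,n\,d\,\mathrm{lg}(d)+m^2\,\mathsf{M}(d)\,\mathrm{lg}(d)^2)$ if $n>m$. -/

import Mathlib

open Polynomial

namespace PolyMat

/-! ## Shifted degrees, Popov forms, approximant and interpolant modules -/

section Algebra

variable {K : Type*} [Field K]

/-- `deg(p) + s`, with value `⊥` (minus infinity) for `p = 0`. -/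
noncomputable def shiftedDegree (s : ℤ) (p : K[X]) : WithBot ℤ :=
  p.degree.map fun k : ℕ => (k : ℤ) + s

/-- The `s`-degree of a row vector: the maximum of `deg(p_j) + s_j`. -/
noncomputable def rowDegree {m : ℕ} (s : Fin m → ℤ) (p : Fin m → K[X]) : WithBot ℤ :=
  Finset.univ.sup fun j => shiftedDegree (s j) (p j)

/-- The `s`-pivot of `p` is located at `j`: this is the rightmost entry reaching the `s`-degree. -/
def IsPivot {m : ℕ} (s : Fin m → ℤ) (p : Fin m → K[X]) (j : Fin m) : Prop :=
  shiftedDegree (s j) (p j) = rowDegree s p ∧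
    ∀ k, j < k → shiftedDegree (s k) (p k) ≠ rowDegree s p

/-- A nonsingular matrix is in `s`-ordered weak Popov form if the `s`-pivots of its rows
are located on the diagonal. -/
def IsOrderedWeakPopov {m : ℕ} (s : Fin m → ℤ) (P : Matrix (Fin m) (Fin m) K[X]) : Prop :=
  P.det ≠ 0 ∧ ∀ i, IsPivot s (P i) i

/-- `s`-Popov form: `s`-ordered weak Popov, with monic pivots, each of degree larger than
the degrees of the other entries of its column. -/
def IsPopov {m : ℕ} (s : Fin m → ℤ) (P : Matrix (Fin m) (Fin m) K[X]) : Prop :=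
  IsOrderedWeakPopov s P ∧ (∀ i, (P i i).Monic) ∧
    ∀ i j, i ≠ j → (P i j).degree < (P j j).degree

/-- The rows of `P` form a basis of the `K[X]`-module `N`. -/
def IsRowBasis {m : ℕ} (P : Matrix (Fin m) (Fin m) K[X])
    (N : Submodule K[X] (Fin m → K[X])) : Prop :=
  LinearIndependent K[X] (fun i => P i) ∧ Submodule.span K[X] (Set.range fun i => P i) = N

/-- The module of all row vectors `p` with `p F = 0 mod X^d`. -/
def approximantModule {m n : ℕ} (F : Matrix (Fin m) (Fin n) K[X]) (d : ℕ) :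
    Submodule K[X] (Fin m → K[X]) where
  carrier := {p | ∀ j, X ^ d ∣ Matrix.vecMul p F j}
  add_mem' := by
    intro p q hp hq j
    rw [Matrix.add_vecMul]
    exact dvd_add (hp j) (hq j)
  zero_mem' := by
    intro j
    rw [Matrix.zero_vecMul]
    exact dvd_zero _
  smul_mem' := by
    intro c p hp j
    rw [Matrix.smul_vecMul]
    exact Dvd.dvd.mul_left (hp j) c

/-- The module of all row vectors `p` with `p(α_i) E_i = 0` for all `i`. -/
def interpolantModule {m n d : ℕ} (E : Fin d → Matrix (Fin m) (Fin n) K) (α : Fin d → K) :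
    Submodule K[X] (Fin m → K[X]) where
  carrier := {p | ∀ i, Matrix.vecMul (fun j => (p j).eval (α i)) (E i) = 0}
  add_mem' := by
    intro p q hp hq i
    have h : (fun j => ((p + q) j).eval (α i))
        = (fun j => (p j).eval (α i)) + fun j => (q j).eval (α i) := by
      funext j
      simp
    rw [h, Matrix.add_vecMul, hp i, hq i, add_zero]
  zero_mem' := by
    intro i
    have h : (fun j => ((0 : Fin m → K[X]) j).eval (α i)) = 0 := by
      funext j
      simp
    rw [h, Matrix.zero_vecMul]
  smul_mem' := by
    intro c p hp i
    have h : (fun j => ((c • p) j).eval (α i)) = (c.eval (α i)) • fun j => (p j).eval (α i) := by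
      funext j
      simp
    rw [h, Matrix.smul_vecMul, hp i, smul_zero]

end Algebra

/-! ## The algebraic complexity model

A program is an algebraic computation tree over `K`. It handles elements of `K` only through
addresses in a write-once memory: it can load a constant of `K`, apply one of the four field
operations to stored elements (the result is appended to the memory), and branch on whether a
stored element is zero. Each field operation and each zero test costs one unit; everything that
does not touch elements of `K` (indices, degrees, shifts, loading constants) is free. -/

/-- Addresses in memory. -/
abbrev Reg : Type := ℕ

/-- Instructions that append one element of `K` to the memory. -/
inductive Instr (K : Type*) where
  | const (c : K)
  | add (a b : Reg)
  | sub (a b : Reg)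
  | mul (a b : Reg)
  | div (a b : Reg)

/-- Programs with a result of type `A`. After `exec i`, the program goes on with the address of
the new element; after `test a`, it goes on with the truth value of "the element at `a` is 0". -/
inductive Prog (K : Type*) (A : Type) where
  | ret (a : A)
  | exec (i : Instr K) (next : Reg → Prog K A)
  | test (a : Reg) (next : Bool → Prog K A)

/-- The outcome of a run: result, final memory, number of operations. -/
structure Outcome (K : Type*) (A : Type) where
  out : A
  mem : List K
  cost : ℕ

section Model

variable {K : Type*}

/-- The element stored at address `a`. -/
def valueAt [Field K] (mem : List K) (a : Reg) : K := mem.getD a 0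

/-- The element computed by an instruction. -/
def Instr.result [Field K] (mem : List K) : Instr K → K
  | .const c => c
  | .add a b => valueAt mem a + valueAt mem b
  | .sub a b => valueAt mem a - valueAt mem b
  | .mul a b => valueAt mem a * valueAt mem b
  | .div a b => valueAt mem a / valueAt mem b

/-- The unit cost of an instruction; loading a constant is not an operation. -/
def Instr.cost : Instr K → ℕ
  | .const _ => 0
  | _ => 1

/-- Running a program from a given memory. -/
noncomputable def Prog.run [Field K] {A : Type} : Prog K A → List K → Outcome K A
  | .ret a, mem => ⟨a, mem, 0⟩
  | .exec i next, mem =>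
      let r := (next mem.length).run (mem ++ [i.result mem])
      ⟨r.out, r.mem, r.cost + i.cost⟩
  | .test a next, mem =>
      let r := (next (@decide (valueAt mem a = 0) (Classical.dec _))).run mem
      ⟨r.out, r.mem, r.cost + 1⟩

/-- Sequential composition. -/
def Prog.bind {A B : Type} : Prog K A → (A → Prog K B) → Prog K B
  | .ret a, f => f a
  | .exec i next, f => .exec i fun r => (next r).bind f
  | .test a next, f => .test a fun b => (next b).bind f

instance : Monad (Prog K) where
  pure := Prog.ret
  bind := Prog.bind

/-- A single instruction, as a program returning the address of the new element. -/
def Prog.instr (i : Instr K) : Prog K Reg := .exec i .ret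

/-- Run the programs `f 0`, ..., `f (k - 1)` one after the other and collect the results. -/
def Prog.tabulate {A : Type} : (k : ℕ) → (Fin k → Prog K A) → Prog K (Fin k → A)
  | 0, _ => pure Fin.elim0
  | k + 1, f => do
      let a ← f 0
      let g ← Prog.tabulate k fun i => f i.succ
      pure (Fin.cons a g)

end Model

/-! ### Representation of matrices in memory -/

/-- A stored matrix over `K`: the addresses of its entries. -/
abbrev CMat (m n : ℕ) : Type := Matrix (Fin m) (Fin n) Reg

/-- A stored square matrix over `K[X]`: for each entry, the addresses of its coefficients,
of degrees 0, 1, 2, ... -/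
abbrev PMat (m : ℕ) : Type := Matrix (Fin m) (Fin m) (List Reg)

section Storage

variable {K : Type*} [Field K]

/-- All addresses of a stored matrix refer to the memory. -/
def CMat.Valid {m n : ℕ} (mem : List K) (A : CMat m n) : Prop := ∀ i j, A i j < mem.length

/-- The matrix over `K` that is stored. -/
def CMat.value {m n : ℕ} (mem : List K) (A : CMat m n) : Matrix (Fin m) (Fin n) K :=
  Matrix.of fun i j => valueAt mem (A i j)

/-- The polynomial with the given stored coefficients. -/
noncomputable def polyValue (mem : List K) : List Reg → K[X]
  | [] => 0
  | a :: l => C (valueAt mem a) + X * polyValue mem l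

/-- All addresses of a stored polynomial matrix refer to the memory. -/
def PMat.Valid {m : ℕ} (mem : List K) (P : PMat m) : Prop :=
  ∀ i j, ∀ a ∈ P i j, a < mem.length

/-- The matrix over `K[X]` that is stored. -/
noncomputable def PMat.value {m : ℕ} (mem : List K) (P : PMat m) :
    Matrix (Fin m) (Fin m) K[X] :=
  Matrix.of fun i j => polyValue mem (P i j)

end Storage

/-! ### The functions `M`, `MM`, `MM'` and the exponent of matrix multiplication -/

section CostFunctions

variable (K : Type*) [Field K]

/-- For every `d`, polynomials of degree at most `d` can be multiplied in `M d` operations. -/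
def PolyMulCost (M : ℕ → ℕ) : Prop :=
  ∀ d : ℕ, ∃ mul : List Reg → List Reg → Prog K (List Reg),
    ∀ (f g : List Reg) (mem : List K), f.length = d + 1 → g.length = d + 1 →
      (∀ a ∈ f, a < mem.length) → (∀ a ∈ g, a < mem.length) →
      let r := (mul f g).run mem
      (∀ a ∈ r.out, a < r.mem.length) ∧
        polyValue r.mem r.out = polyValue mem f * polyValue mem g ∧ r.cost ≤ M d

/-- For all `n`, `d`, two `n × n` matrices over `K[X]` of degree at most `d` can be multiplied
in `MM n d` operations. -/
def PolyMatMulCost (MM : ℕ → ℕ → ℕ) : Prop :=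
  ∀ n d : ℕ, ∃ mul : PMat n → PMat n → Prog K (PMat n),
    ∀ (A B : PMat n) (mem : List K),
      (∀ i j, (A i j).length = d + 1) → (∀ i j, (B i j).length = d + 1) →
      A.Valid mem → B.Valid mem →
      let r := (mul A B).run mem
      r.out.Valid r.mem ∧ r.out.value r.mem = A.value mem * B.value mem ∧ r.cost ≤ MM n d

/-- Two `n × n` matrices over `K` can be multiplied in `O(n ^ ω)` operations. -/
def MatMulExponent (ω : ℝ) : Prop :=
  ∃ c : ℝ, ∀ n : ℕ, ∃ mul : CMat n n → CMat n n → Prog K (CMat n n),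
    ∀ (A B : CMat n n) (mem : List K), A.Valid mem → B.Valid mem →
      let r := (mul A B).run mem
      r.out.Valid r.mem ∧ r.out.value r.mem = A.value mem * B.value mem ∧
        (r.cost : ℝ) ≤ c * (n : ℝ) ^ ω

/-- The sum over `0 ≤ i ≤ log₂ d` of `2 ^ i * MM(m, d / 2 ^ i)`, with integer parts. -/
def MMSum (MM : ℕ → ℕ → ℕ) (m d : ℕ) : ℕ :=
  ∑ i ∈ Finset.range (Nat.log 2 d + 1), 2 ^ i * MM m (d / 2 ^ i)

/-- `log₂ d`, replaced by `1` where it is smaller (that is, for `d = 1`). -/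
noncomputable def lg (d : ℕ) : ℝ := max 1 (Real.logb 2 d)

end CostFunctions

/-! ## The algorithms -/

/-- The building blocks which the algorithms call: `mBasis1` computes the Popov approximant basis
at order 1, given by its coefficients of degrees 0 and 1; `mulPoly` is the multiplication of
polynomial matrices; `eval` is the evaluation of a polynomial matrix at a list of points; `mulConst`
is the multiplication of matrices over `K`. -/
structure Subroutines (K : Type*) where
  mBasis1 : {m n : ℕ} → CMat m n → (Fin m → ℤ) → Prog K (CMat m m × CMat m m)
  mulPoly : {m : ℕ} → PMat m → PMat m → Prog K (PMat m)
  eval : {m k : ℕ} → PMat m → (Fin k → Reg) → Prog K (Fin k → CMat m m)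
  mulConst : {m n : ℕ} → CMat m m → CMat m n → Prog K (CMat m n)

/-- The building blocks compute what they should. -/
structure Subroutines.Correct {K : Type*} [Field K] (S : Subroutines K) : Prop where
  mBasis1 : ∀ {m n : ℕ} (F : CMat m n) (s : Fin m → ℤ) (mem : List K), F.Valid mem →
    let r := (S.mBasis1 F s).run mem
    let Q : Matrix (Fin m) (Fin m) K[X] :=
      (r.out.1.value r.mem).map C + (X : K[X]) • (r.out.2.value r.mem).map C
    r.out.1.Valid r.mem ∧ r.out.2.Valid r.mem ∧ IsPopov s Q ∧
      IsRowBasis Q (approximantModule ((F.value mem).map C) 1)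
  mulPoly : ∀ {m : ℕ} (A B : PMat m) (mem : List K), A.Valid mem → B.Valid mem →
    let r := (S.mulPoly A B).run mem
    r.out.Valid r.mem ∧ r.out.value r.mem = A.value mem * B.value mem
  eval : ∀ {m k : ℕ} (P : PMat m) (a : Fin k → Reg) (mem : List K), P.Valid mem →
    (∀ i, a i < mem.length) →
    let r := (S.eval P a).run mem
    ∀ i, (r.out i).Valid r.mem ∧
      (r.out i).value r.mem = (P.value mem).map (Polynomial.eval (valueAt mem (a i)))
  mulConst : ∀ {m n : ℕ} (A : CMat m m) (B : CMat m n) (mem : List K),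
    A.Valid mem → B.Valid mem →
    let r := (S.mulConst A B).run mem
    r.out.Valid r.mem ∧ r.out.value r.mem = A.value mem * B.value mem

section Algorithms

variable {K : Type*} [Field K]

/-- The identity matrix. -/
def identityProg (m : ℕ) : Prog K (PMat m) := do
  let one ← Prog.instr (.const 1)
  pure (Matrix.of fun i j => if i = j then [one] else [])

/-- The degree of a stored polynomial, found by testing coefficients. -/
def degreeProg : List Reg → Prog K (WithBot ℕ)
  | [] => pure ⊥
  | a :: l => do
      let e ← degreeProg l
      if e = ⊥ then .test a fun z => pure (if z then ⊥ else 0) else pure (e + 1)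

/-- The list of `s`-degrees of the rows of a stored matrix (without zero row). -/
def rowDegreesProg {m : ℕ} (s : Fin m → ℤ) (P : PMat m) : Prog K (Fin m → ℤ) :=
  Prog.tabulate m fun i => do
    let e ← Prog.tabulate m fun j => degreeProg (P i j)
    pure ((Finset.univ.sup fun j => (e j).map fun k : ℕ => (k : ℤ) + s j).unbotD 0)

/-- From the matrix `Q₀ + X Q₁` to the matrix `Q₀ + (X - a) Q₁`. -/
def translateProg {m : ℕ} (Q : CMat m m × CMat m m) (a : Reg) : Prog K (PMat m) :=
  Prog.tabulate m fun i => Prog.tabulate m fun j => do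
    let b ← Prog.instr (.mul a (Q.2 i j))
    let c ← Prog.instr (.sub (Q.1 i j) b)
    pure [c, Q.2 i j]

/-- The loop of M-IntBasis: `P` is the current basis and `t` the list of `s`-degrees of its rows.
The Popov approximant basis at order 1 of `R = P(α) E` is taken at `X - α`. -/
def mIntLoop (S : Subroutines K) {m n : ℕ} (s : Fin m → ℤ) :
    (d : ℕ) → (Fin d → CMat m n) → (Fin d → Reg) → PMat m → (Fin m → ℤ) → Prog K (PMat m)
  | 0, _, _, P, _ => pure P
  | d + 1, E, α, P, t => do
      let V ← S.eval P fun _ : Fin 1 => α 0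
      let R ← S.mulConst (V 0) (E 0)
      let Q₀ ← S.mBasis1 R t
      let Q ← translateProg Q₀ (α 0)
      let P₁ ← S.mulPoly Q P
      let t₁ ← rowDegreesProg s P₁
      mIntLoop S s d (fun i => E i.succ) (fun i => α i.succ) P₁ t₁

/-- Algorithm M-IntBasis (iterative). -/
def mIntBasis (S : Subroutines K) {m n : ℕ} (d : ℕ) (E : Fin d → CMat m n) (α : Fin d → Reg)
    (s : Fin m → ℤ) : Prog K (PMat m) := do
  let P ← identityProg m
  mIntLoop S s d E α P s

/-- Algorithm PM-IntBasis (divide and conquer), with threshold `T`; here `(d + 1) / 2` and `d / 2`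
are the upper and lower integer parts of half of `d`. -/
def pmIntBasis (S : Subroutines K) (T : ℕ) (hT : 1 ≤ T) {m n : ℕ} (d : ℕ)
    (E : Fin d → CMat m n) (α : Fin d → Reg) (s : Fin m → ℤ) : Prog K (PMat m) :=
  if hd : d ≤ T then mIntBasis S d E α s
  else do
    let P₁ ← pmIntBasis S T hT ((d + 1) / 2)
      (fun i => E ⟨i, by omega⟩) (fun i => α ⟨i, by omega⟩) s
    let β : Fin (d / 2) → Reg := fun i => α ⟨(d + 1) / 2 + i, by omega⟩
    let V ← S.eval P₁ β
    let R ← Prog.tabulate (d / 2) fun i => S.mulConst (V i) (E ⟨(d + 1) / 2 + i, by omega⟩)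
    let t ← rowDegreesProg s P₁
    let P₂ ← pmIntBasis S T hT (d / 2) R β t
    S.mulPoly P₂ P₁
termination_by d
decreasing_by all_goals omega

end Algorithms

end PolyMat

namespace PolyMat

/-! ## Reasoning about runs of programs -/

section Triples

variable {K : Type*} [Field K] {A B : Type}

/-! Correctness rests on the predictable degree property `isPivot_vecMul`: if the rows of P have
their s-pivots on the diagonal and s-degrees t, then qP has for s the degree and pivot position that
q has for t. Hence bases compose: if P is such a basis of N, N'' ⊆ N, and Q is such a basis, for the
shift t, of {q : qP ∈ N''}, then QP is one of N'' (`PivotBasis.mul`). Since (qP)(α_i)E_i =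
q(α_i)(P(α_i)E_i), that second module is again an interpolant module, for the residuals P(α_i)E_i
(`vecMul_mem_interpolantModule`). Both algorithms iterate this composition; the elementary step is
an approximant basis at order one, moved from 0 to a point.

For the cost, the order-one basis is read off a reduced basis of the left kernel of a constant
matrix, computed by halving sets of columns (`elim_triple`). As ω > 2 the widest level dominates, so
a block of about m columns costs O(m^ω) (`elimCost_le`). Evaluation at a geometric progression is
one product of polynomials (`bluestein_triple`); at other points it uses a subproduct tree, Newton
inversion and a descent on windows of power series, with one more logarithm (`multipoint_triple`).

The recursion has one obstacle: M(d)/d and MM(m,d)/d are nondecreasing, but no upper bound on their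
growth is assumed, while ceilings and the extra coefficient of a polynomial of degree d exceed the
floors ⌊d/2^i⌋ of MM'. Two devices deal with it. Products are cut into a fixed number b of blocks of
coefficients, so that a node of size e + 1 is charged at size e (`mulBlocksCost_le`, `nodeCost_le`),
and the sizes d and d + 1 are bounded together by the same dyadic sum (`divideCost_le`). Each level
of the tree also spends about d(n/m + 1)m^ω on constant matrices. For n ≤ m this is absorbed in MM',
because MM(m,1) is at least of order m^ω (`log_mul_one_le_dyadicSum`). Evaluation at geometric
points is absorbed because MM dominates m^2 M; for general points it leaves the term with the
squared logarithm. -/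

theorem Prog.run_bind (p : Prog K A) (f : A → Prog K B) (mem : List K) :
    (p >>= f).run mem =
      ⟨((f (p.run mem).out).run (p.run mem).mem).out,
        ((f (p.run mem).out).run (p.run mem).mem).mem,
        (p.run mem).cost + ((f (p.run mem).out).run (p.run mem).mem).cost⟩ := by
  change (p.bind f).run mem = _
  induction p generalizing mem with
  | ret a => simp [Prog.bind, Prog.run]
  | exec i next ih => simp [Prog.bind, Prog.run, ih]; omega
  | test a next ih => simp [Prog.bind, Prog.run, ih]; omega

/-- Memory is write-once: instructions only append. Facts about stored elements therefore survive
all later computations. -/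
theorem Prog.prefix_run (p : Prog K A) (mem : List K) : mem <+: (p.run mem).mem := by
  induction p generalizing mem with
  | ret a => exact List.prefix_rfl
  | exec i next ih => exact (List.prefix_append _ _).trans (ih _ _)
  | test a next ih => exact ih _ _

/-- Run from `mem`, the program `p` costs at most `c`, and its result and final memory
satisfy `Q`. -/
def Triple (p : Prog K A) (mem : List K) (c : ℕ) (Q : A → List K → Prop) : Prop :=
  (p.run mem).cost ≤ c ∧ Q (p.run mem).out (p.run mem).mem

theorem Triple.mono {p : Prog K A} {mem : List K} {c c' : ℕ} {Q Q' : A → List K → Prop}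
    (h : Triple p mem c Q) (hc : c ≤ c') (hQ : ∀ a mem', mem <+: mem' → Q a mem' → Q' a mem') :
    Triple p mem c' Q' :=
  ⟨h.1.trans hc, hQ _ _ (p.prefix_run mem) h.2⟩

theorem Triple.le {p : Prog K A} {mem : List K} {c c' : ℕ} {Q : A → List K → Prop}
    (h : Triple p mem c Q) (hc : c ≤ c') : Triple p mem c' Q :=
  ⟨h.1.trans hc, h.2⟩

theorem Triple.pure {a : A} {mem : List K} {Q : A → List K → Prop} (h : Q a mem) :
    Triple (Pure.pure a) mem 0 Q :=
  ⟨le_rfl, h⟩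

theorem Triple.bind {p : Prog K A} {f : A → Prog K B} {mem : List K} {c₁ c₂ : ℕ}
    {Q₁ : A → List K → Prop} {Q₂ : B → List K → Prop} (h : Triple p mem c₁ Q₁)
    (h' : ∀ a mem', mem <+: mem' → Q₁ a mem' → Triple (f a) mem' c₂ Q₂) :
    Triple (p >>= f) mem (c₁ + c₂) Q₂ := by
  have := h' _ _ (p.prefix_run mem) h.2
  unfold Triple
  rw [Prog.run_bind]
  exact ⟨Nat.add_le_add h.1 this.1, this.2⟩

/-- Sequential composition followed by a final step which is free of charge. -/
theorem Triple.bind_pure {p : Prog K A} {f : A → B} {mem : List K} {c : ℕ}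
    {Q₁ : A → List K → Prop} {Q₂ : B → List K → Prop} (h : Triple p mem c Q₁)
    (h' : ∀ a mem', mem <+: mem' → Q₁ a mem' → Q₂ (f a) mem') :
    Triple (p >>= fun a => Pure.pure (f a)) mem c Q₂ :=
  (h.bind fun a mem' hm hq => Triple.pure (h' a mem' hm hq)).le (by omega)

/-- A property of results that persists when the memory grows. -/
def Stable (Q : A → List K → Prop) : Prop :=
  ∀ a mem mem', mem <+: mem' → Q a mem → Q a mem'

/-- Result `i` is established in an intermediate memory, while the conclusion speaks of the final
one; stability bridges the two. -/
theorem Triple.tabulate {k : ℕ} {f : Fin k → Prog K A} {mem : List K} {c : ℕ}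
    {Q : Fin k → A → List K → Prop} (hQ : ∀ i, Stable (Q i))
    (h : ∀ i mem', mem <+: mem' → Triple (f i) mem' c (Q i)) :
    Triple (Prog.tabulate k f) mem (k * c) fun g mem' => ∀ i, Q i (g i) mem' := by
  induction k generalizing mem with
  | zero => exact (Triple.pure fun i => i.elim0).le (by omega)
  | succ k ih =>
    refine ((h 0 mem List.prefix_rfl).bind (c₂ := k * c) fun a mem₁ hm₁ ha => ?_).le
      (by rw [Nat.succ_mul]; omega)
    refine ((ih (fun i => hQ i.succ) fun i mem' hm' =>
      h i.succ mem' (hm₁.trans hm')).bind_pure fun g mem₂ hm₂ hg i => ?_)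
    refine Fin.cases ?_ (fun i => ?_) i
    · exact hQ 0 _ _ _ hm₂ ha
    · exact hg i

/-! ### Stored elements -/

/-- The address `a` refers to a stored element with value `v`. -/
def Has (mem : List K) (a : Reg) (v : K) : Prop := mem[a]? = some v

omit [Field K] in
theorem Has.mono {mem mem' : List K} {a : Reg} {v : K} (h : Has mem a v) (hm : mem <+: mem') :
    Has mem' a v := by
  obtain ⟨l, rfl⟩ := hm
  unfold Has at *
  rw [List.getElem?_append_left, h]
  exact (List.getElem?_eq_some_iff.1 h).1

omit [Field K] in
theorem stable_has (v : K) : Stable fun a (mem : List K) => Has mem a v :=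
  fun _ _ _ hm h => h.mono hm

theorem has_iff {mem : List K} {a : Reg} {v : K} :
    Has mem a v ↔ a < mem.length ∧ valueAt mem a = v := by
  unfold Has valueAt
  rw [List.getElem?_eq_some_iff]
  constructor
  · rintro ⟨h, rfl⟩
    exact ⟨h, by simp [h]⟩
  · rintro ⟨h, rfl⟩
    exact ⟨h, by simp [h]⟩

theorem Has.lt {mem : List K} {a : Reg} {v : K} (h : Has mem a v) : a < mem.length :=
  (has_iff.1 h).1

theorem Has.value {mem : List K} {a : Reg} {v : K} (h : Has mem a v) : valueAt mem a = v :=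
  (has_iff.1 h).2

theorem has_valueAt {mem : List K} {a : Reg} (h : a < mem.length) : Has mem a (valueAt mem a) :=
  has_iff.2 ⟨h, rfl⟩

omit [Field K] in
theorem has_append_length (mem : List K) (v : K) : Has (mem ++ [v]) mem.length v := by
  simp [Has]

theorem Triple.instr (i : Instr K) (mem : List K) :
    Triple (Prog.instr i) mem i.cost fun a mem' => Has mem' a (i.result mem) := by
  refine ⟨?_, has_append_length _ _⟩
  simp [Prog.instr, Prog.run]

theorem Triple.const (c : K) (mem : List K) :
    Triple (Prog.instr (.const c)) mem 0 fun a mem' => Has mem' a c :=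
  Triple.instr _ mem

theorem Triple.add {mem : List K} {a b : Reg} {u v : K} (ha : Has mem a u) (hb : Has mem b v) :
    Triple (Prog.instr (.add a b)) mem 1 fun r mem' => Has mem' r (u + v) := by
  have := Triple.instr (.add a b) mem
  simpa only [Instr.result, Instr.cost, ha.value, hb.value] using this

theorem Triple.sub {mem : List K} {a b : Reg} {u v : K} (ha : Has mem a u) (hb : Has mem b v) :
    Triple (Prog.instr (.sub a b)) mem 1 fun r mem' => Has mem' r (u - v) := by
  have := Triple.instr (.sub a b) mem
  simpa only [Instr.result, Instr.cost, ha.value, hb.value] using this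

theorem Triple.mul {mem : List K} {a b : Reg} {u v : K} (ha : Has mem a u) (hb : Has mem b v) :
    Triple (Prog.instr (.mul a b)) mem 1 fun r mem' => Has mem' r (u * v) := by
  have := Triple.instr (.mul a b) mem
  simpa only [Instr.result, Instr.cost, ha.value, hb.value] using this

theorem Triple.div {mem : List K} {a b : Reg} {u v : K} (ha : Has mem a u) (hb : Has mem b v) :
    Triple (Prog.instr (.div a b)) mem 1 fun r mem' => Has mem' r (u / v) := by
  have := Triple.instr (.div a b) mem
  simpa only [Instr.result, Instr.cost, ha.value, hb.value] using this

theorem Triple.test {mem : List K} {a : Reg} {v : K} {f : Bool → Prog K A} {c : ℕ}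
    {Q : A → List K → Prop} (ha : Has mem a v)
    (h : ∀ b : Bool, (b = true ↔ v = 0) → Triple (f b) mem c Q) :
    Triple (Prog.test a f) mem (c + 1) Q := by
  have := h (@decide (valueAt mem a = 0) (Classical.dec _)) (by simp [ha.value])
  exact ⟨Nat.add_le_add_right this.1 1, this.2⟩

/-! ### Stored polynomials -/

/-- The list `l` of addresses refers to the coefficients of `p`. -/
def HasP (mem : List K) (l : List Reg) (p : K[X]) : Prop :=
  (∀ a ∈ l, a < mem.length) ∧ polyValue mem l = p

theorem polyValue_coeff (mem : List K) (l : List Reg) (i : ℕ) :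
    (polyValue mem l).coeff i = (l[i]?.map (valueAt mem)).getD 0 := by
  induction l generalizing i with
  | nil => simp [polyValue]
  | cons a l ih =>
    cases i with
    | zero => simp [polyValue]
    | succ i => simp [polyValue, ih]

theorem HasP.has {mem : List K} {l : List Reg} {p : K[X]} (h : HasP mem l p) {i : ℕ}
    (hi : i < l.length) : Has mem l[i] (p.coeff i) := by
  rw [has_iff, ← h.2, polyValue_coeff]
  exact ⟨h.1 _ (List.getElem_mem hi), by simp [hi]⟩

theorem HasP.coeff_eq_zero {mem : List K} {l : List Reg} {p : K[X]} (h : HasP mem l p) {i : ℕ}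
    (hi : l.length ≤ i) : p.coeff i = 0 := by
  rw [← h.2, polyValue_coeff]
  simp [hi]

theorem HasP.degree_lt {mem : List K} {l : List Reg} {p : K[X]} (h : HasP mem l p) :
    p.degree < l.length :=
  (degree_lt_iff_coeff_zero _ _).2 fun _ hi => h.coeff_eq_zero hi

theorem hasP_of_coeff {mem : List K} {l : List Reg} {p : K[X]}
    (h : ∀ i (hi : i < l.length), Has mem l[i] (p.coeff i))
    (h' : ∀ i, l.length ≤ i → p.coeff i = 0) : HasP mem l p := by
  constructor
  · intro a ha
    obtain ⟨i, hi, rfl⟩ := List.getElem_of_mem ha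
    exact (h i hi).lt
  · ext i
    rw [polyValue_coeff]
    by_cases hi : i < l.length
    · simp [hi, (h i hi).value]
    · simp [hi, h' i (not_lt.1 hi)]

theorem HasP.mono {mem mem' : List K} {l : List Reg} {p : K[X]} (h : HasP mem l p)
    (hm : mem <+: mem') : HasP mem' l p :=
  hasP_of_coeff (fun _ hi => (h.has hi).mono hm) fun _ hi => h.coeff_eq_zero hi

theorem hasP_nil (mem : List K) : HasP mem [] 0 := ⟨by simp, rfl⟩

theorem hasP_cons {mem : List K} {a : Reg} {l : List Reg} {v : K} {p : K[X]} (ha : Has mem a v)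
    (hl : HasP mem l p) : HasP mem (a :: l) (C v + X * p) := by
  constructor
  · simpa using ⟨ha.lt, hl.1⟩
  · simp [polyValue, ha.value, hl.2]

theorem HasP.tail {mem : List K} {a : Reg} {l : List Reg} {p : K[X]} (h : HasP mem (a :: l) p) :
    ∃ v q, Has mem a v ∧ HasP mem l q ∧ p = C v + X * q :=
  ⟨_, _, has_valueAt (h.1 a (by simp)), ⟨fun b hb => h.1 b (by simp [hb]), rfl⟩, h.2.symm⟩

theorem HasP.append {mem : List K} {l l' : List Reg} {p p' : K[X]} (h : HasP mem l p)
    (h' : HasP mem l' p') : HasP mem (l ++ l') (p + X ^ l.length * p') := by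
  induction l generalizing p with
  | nil =>
    obtain rfl : p = 0 := h.2.symm
    simpa using h'
  | cons a l ih =>
    obtain ⟨v, q, hv, hq, rfl⟩ := h.tail
    have := hasP_cons hv (ih hq)
    rw [List.cons_append, List.length_cons]
    convert this using 1
    ring

theorem hasP_replicate {mem : List K} {z : Reg} (hz : Has mem z 0) (n : ℕ) :
    HasP mem (List.replicate n z) 0 :=
  hasP_of_coeff (fun i hi => by simpa using hz) (by simp)

/-- Cutting a list of coefficients. -/
theorem HasP.split {mem : List K} {l : List Reg} {p : K[X]} (h : HasP mem l p) (n : ℕ) :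
    ∃ p₀ p₁, HasP mem (l.take n) p₀ ∧ HasP mem (l.drop n) p₁ ∧ p = p₀ + X ^ n * p₁ := by
  have h0 : HasP mem (l.take n) (polyValue mem (l.take n)) :=
    ⟨fun a ha => h.1 a (List.mem_of_mem_take ha), rfl⟩
  have h1 : HasP mem (l.drop n) (polyValue mem (l.drop n)) :=
    ⟨fun a ha => h.1 a (List.mem_of_mem_drop ha), rfl⟩
  refine ⟨_, _, h0, h1, ?_⟩
  by_cases hn : n ≤ l.length
  · have := (h0.append h1).2
    rw [List.take_append_drop, h.2, List.length_take, min_eq_left hn] at this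
    exact this
  · rw [List.take_of_length_le (by omega), List.drop_of_length_le (by omega)]
    simp [polyValue, h.2]

theorem HasP.take {mem : List K} {l : List Reg} {p : K[X]} (h : HasP mem l p) {n : ℕ}
    (hn : p.degree < n) : HasP mem (l.take n) p :=
  hasP_of_coeff (fun i hi => by simpa using h.has (i := i) (by simp at hi; omega))
    fun i hi => by
      rw [List.length_take] at hi
      rcases min_le_iff.1 hi with hi | hi
      · exact (degree_lt_iff_coeff_zero _ _).1 hn i hi
      · exact h.coeff_eq_zero hi

/-- Completing a list of coefficients with zeros, up to length `n`. -/
def padTo (z : Reg) (n : ℕ) (l : List Reg) : List Reg := l ++ List.replicate (n - l.length) z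

theorem length_padTo {z : Reg} {n : ℕ} {l : List Reg} (h : l.length ≤ n) :
    (padTo z n l).length = n := by
  simp [padTo]; omega

theorem HasP.padTo {mem : List K} {l : List Reg} {p : K[X]} {z : Reg} (h : HasP mem l p)
    (hz : Has mem z 0) (n : ℕ) : HasP mem (padTo z n l) p := by
  simpa [PolyMat.padTo] using h.append (hasP_replicate hz (n - l.length))

/-! ### Stored matrices -/

/-- The stored matrix `A` has value `M`. -/
def HasM {m n : Type} (mem : List K) (A : Matrix m n Reg) (M : Matrix m n K) : Prop :=
  ∀ i j, Has mem (A i j) (M i j)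

omit [Field K] in
theorem HasM.mono {m n : Type} {mem mem' : List K} {A : Matrix m n Reg} {M : Matrix m n K}
    (h : HasM mem A M) (hm : mem <+: mem') : HasM mem' A M :=
  fun i j => (h i j).mono hm

/-- The stored polynomial matrix `A` has value `P`. -/
def HasPM {m : ℕ} (mem : List K) (A : PMat m) (P : Matrix (Fin m) (Fin m) K[X]) : Prop :=
  ∀ i j, HasP mem (A i j) (P i j)

theorem HasPM.mono {m : ℕ} {mem mem' : List K} {A : PMat m} {P : Matrix (Fin m) (Fin m) K[X]}
    (h : HasPM mem A P) (hm : mem <+: mem') : HasPM mem' A P :=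
  fun i j => (h i j).mono hm

theorem hasM_iff {m n : ℕ} {mem : List K} {A : CMat m n} {M : Matrix (Fin m) (Fin n) K} :
    HasM mem A M ↔ A.Valid mem ∧ A.value mem = M := by
  simp only [HasM, has_iff, CMat.Valid, CMat.value, ← Matrix.ext_iff, Matrix.of_apply]
  exact ⟨fun h => ⟨fun i j => (h i j).1, fun i j => (h i j).2⟩, fun h i j => ⟨h.1 i j, h.2 i j⟩⟩

theorem hasPM_iff {m : ℕ} {mem : List K} {A : PMat m} {P : Matrix (Fin m) (Fin m) K[X]} :
    HasPM mem A P ↔ A.Valid mem ∧ A.value mem = P := by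
  simp only [HasPM, HasP, PMat.Valid, PMat.value, ← Matrix.ext_iff, Matrix.of_apply]
  exact ⟨fun h => ⟨fun i j => (h i j).1, fun i j => (h i j).2⟩, fun h i j => ⟨h.1 i j, h.2 i j⟩⟩

theorem CMat.Valid.hasM {m n : ℕ} {mem : List K} {A : CMat m n} (h : A.Valid mem) :
    HasM mem A (A.value mem) := hasM_iff.2 ⟨h, rfl⟩

theorem PMat.Valid.hasPM {m : ℕ} {mem : List K} {A : PMat m} (h : A.Valid mem) :
    HasPM mem A (A.value mem) := hasPM_iff.2 ⟨h, rfl⟩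

/-- All entries of the stored matrix have at most `n` coefficients. -/
def PMat.LengthLe {m : ℕ} (A : PMat m) (n : ℕ) : Prop := ∀ i j, (A i j).length ≤ n

theorem Triple.tabulate₂ {k l : ℕ} {f : Fin k → Fin l → Prog K A} {mem : List K} {c : ℕ}
    {Q : Fin k → Fin l → A → List K → Prop} (hQ : ∀ i j, Stable (Q i j))
    (h : ∀ i j mem', mem <+: mem' → Triple (f i j) mem' c (Q i j)) :
    Triple (Prog.tabulate k fun i => Prog.tabulate l fun j => f i j) mem (k * (l * c))
      fun g mem' => ∀ i j, Q i j (g i j) mem' :=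
  Triple.tabulate (A := Fin l → A) (Q := fun i g mem' => ∀ j, Q i j (g j) mem')
    (fun i _ _ _ hm hq j => hQ i j _ _ _ hm (hq j))
    fun i _ hm => Triple.tabulate (hQ i) fun j _ hm' => h i j _ (hm.trans hm')

end Triples

/-! ## Shifted degrees and pivots -/

section Popov

variable {K : Type*} [Field K] {m : ℕ}

@[simp] theorem shiftedDegree_zero (s : ℤ) : shiftedDegree s (0 : K[X]) = ⊥ := by
  simp [shiftedDegree]

theorem shiftedDegree_of_ne_zero (s : ℤ) {p : K[X]} (hp : p ≠ 0) :
    shiftedDegree s p = ((p.natDegree + s : ℤ) : WithBot ℤ) := by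
  rw [shiftedDegree, degree_eq_natDegree hp]
  rfl

/-- Strict bounds become vanishing of coefficients, a linear condition that passes to sums and
treats the zero polynomial like any other. -/
theorem shiftedDegree_lt_iff {s D : ℤ} {p : K[X]} :
    shiftedDegree s p < (D : WithBot ℤ) ↔ ∀ k : ℕ, D ≤ k + s → p.coeff k = 0 := by
  by_cases hp : p = 0
  · simp [hp, WithBot.bot_lt_coe]
  rw [shiftedDegree_of_ne_zero s hp, WithBot.coe_lt_coe]
  constructor
  · intro h k hk
    exact coeff_eq_zero_of_natDegree_lt (by omega)
  · intro h
    by_contra hlt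
    exact hp (leadingCoeff_eq_zero.1 (h p.natDegree (by omega)))

theorem coe_lt_add_one_iff {a : WithBot ℤ} {D : ℤ} :
    a < ((D + 1 : ℤ) : WithBot ℤ) ↔ a ≤ (D : WithBot ℤ) := by
  induction a with
  | bot => simp [WithBot.bot_lt_coe]
  | coe a => rw [WithBot.coe_lt_coe, WithBot.coe_le_coe]; omega

theorem shiftedDegree_sum_lt {ι : Type*} {S : Finset ι} {f : ι → K[X]} {s D : ℤ}
    (h : ∀ i ∈ S, shiftedDegree s (f i) < (D : WithBot ℤ)) :
    shiftedDegree s (∑ i ∈ S, f i) < (D : WithBot ℤ) := by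
  rw [shiftedDegree_lt_iff]
  intro k hk
  rw [finsetSum_coeff]
  exact Finset.sum_eq_zero fun i hi => shiftedDegree_lt_iff.1 (h i hi) k hk

theorem shiftedDegree_sum_le {ι : Type*} {S : Finset ι} {f : ι → K[X]} {s D : ℤ}
    (h : ∀ i ∈ S, shiftedDegree s (f i) ≤ (D : WithBot ℤ)) :
    shiftedDegree s (∑ i ∈ S, f i) ≤ (D : WithBot ℤ) := by
  rw [← coe_lt_add_one_iff]
  exact shiftedDegree_sum_lt fun i hi => coe_lt_add_one_iff.2 (h i hi)

theorem shiftedDegree_add_eq {p q : K[X]} {s D : ℤ} (hp : shiftedDegree s p = (D : WithBot ℤ))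
    (hq : shiftedDegree s q < (D : WithBot ℤ)) : shiftedDegree s (p + q) = (D : WithBot ℤ) := by
  have hp0 : p ≠ 0 := by
    rintro rfl
    simp at hp
  rw [shiftedDegree_of_ne_zero s hp0, WithBot.coe_inj] at hp
  have hlt : q.degree < p.degree := by
    rw [degree_eq_natDegree hp0, degree_lt_iff_coeff_zero]
    exact fun k hk => shiftedDegree_lt_iff.1 hq k (by omega)
  rw [shiftedDegree, degree_add_eq_left_of_degree_lt hlt, ← shiftedDegree,
    shiftedDegree_of_ne_zero s hp0, hp]

theorem shiftedDegree_mul {s : ℤ} {p q : K[X]} (hp : p ≠ 0) (hq : q ≠ 0) :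
    shiftedDegree s (q * p) = ((q.natDegree + p.natDegree + s : ℤ) : WithBot ℤ) := by
  rw [shiftedDegree_of_ne_zero s (mul_ne_zero hq hp), natDegree_mul hq hp]
  push_cast
  rfl

/-- The degree of `q` is measured with the shift `t` that bounds the shifted degree of `p`, so `t`
cancels: `(D - t) + t = D`. The two variants below record when the bound is strict and when it is
attained. -/
theorem shiftedDegree_mul_le {s t D : ℤ} {p q : K[X]}
    (hq : shiftedDegree t q ≤ (D : WithBot ℤ)) (hp : shiftedDegree s p ≤ (t : WithBot ℤ)) :
    shiftedDegree s (q * p) ≤ (D : WithBot ℤ) := by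
  by_cases hp0 : p = 0
  · simp [hp0]
  by_cases hq0 : q = 0
  · simp [hq0]
  rw [shiftedDegree_mul hp0 hq0]
  rw [shiftedDegree_of_ne_zero _ hp0] at hp
  rw [shiftedDegree_of_ne_zero _ hq0] at hq
  norm_cast at *
  omega

theorem shiftedDegree_mul_lt {s t D : ℤ} {p q : K[X]}
    (hq : shiftedDegree t q ≤ (D : WithBot ℤ)) (hp : shiftedDegree s p ≤ (t : WithBot ℤ))
    (h : shiftedDegree t q < (D : WithBot ℤ) ∨ shiftedDegree s p < (t : WithBot ℤ)) :
    shiftedDegree s (q * p) < (D : WithBot ℤ) := by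
  by_cases hp0 : p = 0
  · simp [hp0, WithBot.bot_lt_coe]
  by_cases hq0 : q = 0
  · simp [hq0, WithBot.bot_lt_coe]
  rw [shiftedDegree_mul hp0 hq0]
  rw [shiftedDegree_of_ne_zero _ hp0] at hp h
  rw [shiftedDegree_of_ne_zero _ hq0] at hq h
  norm_cast at *
  omega

theorem shiftedDegree_mul_eq {s t D : ℤ} {p q : K[X]}
    (hq : shiftedDegree t q = (D : WithBot ℤ)) (hp : shiftedDegree s p = (t : WithBot ℤ)) :
    shiftedDegree s (q * p) = (D : WithBot ℤ) := by
  by_cases hp0 : p = 0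
  · simp [hp0] at hp
  by_cases hq0 : q = 0
  · simp [hq0] at hq
  rw [shiftedDegree_mul hp0 hq0]
  rw [shiftedDegree_of_ne_zero _ hp0] at hp
  rw [shiftedDegree_of_ne_zero _ hq0] at hq
  norm_cast at *
  omega

theorem shiftedDegree_le_rowDegree (s : Fin m → ℤ) (p : Fin m → K[X]) (j : Fin m) :
    shiftedDegree (s j) (p j) ≤ rowDegree s p :=
  Finset.le_sup (f := fun j => shiftedDegree (s j) (p j)) (Finset.mem_univ j)

theorem exists_rowDegree_eq {s : Fin m → ℤ} {p : Fin m → K[X]} (hp : p ≠ 0) :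
    ∃ D : ℤ, rowDegree s p = (D : WithBot ℤ) := by
  obtain ⟨j, hj⟩ := Function.ne_iff.1 hp
  have := shiftedDegree_le_rowDegree s p j
  rw [shiftedDegree_of_ne_zero _ hj] at this
  cases h : rowDegree s p with
  | bot => simp [h] at this
  | coe D => exact ⟨D, rfl⟩

theorem rowDegree_zero (s : Fin m → ℤ) : rowDegree s (0 : Fin m → K[X]) = ⊥ := by
  simp [rowDegree]

theorem exists_isPivot {s : Fin m → ℤ} {p : Fin m → K[X]} (hp : p ≠ 0) : ∃ j, IsPivot s p j := by
  classical
  obtain ⟨j₀, -⟩ := Function.ne_iff.1 hp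
  let S := Finset.univ.filter fun j => shiftedDegree (s j) (p j) = rowDegree s p
  have hS : S.Nonempty := by
    obtain ⟨j, -, hj⟩ := Finset.exists_mem_eq_sup Finset.univ ⟨j₀, Finset.mem_univ _⟩
      fun j => shiftedDegree (s j) (p j)
    exact ⟨j, Finset.mem_filter.2 ⟨Finset.mem_univ _, hj.symm⟩⟩
  refine ⟨S.max' hS, (Finset.mem_filter.1 (S.max'_mem hS)).2, fun k hk hk' => ?_⟩
  exact absurd (S.le_max' k (Finset.mem_filter.2 ⟨Finset.mem_univ _, hk'⟩)) (not_le.2 hk)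

theorem IsPivot.lt {s : Fin m → ℤ} {p : Fin m → K[X]} {j : Fin m} (h : IsPivot s p j) {k : Fin m}
    (hk : j < k) : shiftedDegree (s k) (p k) < rowDegree s p :=
  lt_of_le_of_ne (shiftedDegree_le_rowDegree s p k) (h.2 k hk)

/-- If the pivots of the rows of `P` are on the diagonal, the degree and the pivot of a
combination of these rows are those of the vector of coefficients. -/
theorem isPivot_vecMul {P : Matrix (Fin m) (Fin m) K[X]} {s t : Fin m → ℤ}
    (hpiv : ∀ i, IsPivot s (P i) i) (ht : ∀ i, rowDegree s (P i) = (t i : WithBot ℤ))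
    {q : Fin m → K[X]} {j : Fin m} (hq : IsPivot t q j) {D : ℤ}
    (hD : rowDegree t q = (D : WithBot ℤ)) :
    IsPivot s (Matrix.vecMul q P) j ∧ rowDegree s (Matrix.vecMul q P) = (D : WithBot ℤ) := by
  have hle : ∀ i k, shiftedDegree (s k) (P i k) ≤ (t i : WithBot ℤ) := fun i k =>
    ht i ▸ shiftedDegree_le_rowDegree s (P i) k
  have hqle : ∀ i, shiftedDegree (t i) (q i) ≤ (D : WithBot ℤ) := fun i =>
    hD ▸ shiftedDegree_le_rowDegree t q i
  have hPlt : ∀ i k, i < k → shiftedDegree (s k) (P i k) < (t i : WithBot ℤ) := fun i k hk =>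
    ht i ▸ (hpiv i).lt hk
  have hqlt : ∀ i, j < i → shiftedDegree (t i) (q i) < (D : WithBot ℤ) := fun i hi =>
    hD ▸ hq.lt hi
  have hval : ∀ k, Matrix.vecMul q P k = ∑ i, q i * P i k := fun k => rfl
  -- In column `j` only the term `i = j` reaches degree `D`: for `i < j` the entry `P i j` is to the
  -- right of the pivot of row `i`, and for `i > j` the entry `q i` is to the right of the pivot of
  -- `q`.
  have hdiag : shiftedDegree (s j) (Matrix.vecMul q P j) = (D : WithBot ℤ) := by
    rw [hval, ← Finset.add_sum_erase _ _ (Finset.mem_univ j)]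
    refine shiftedDegree_add_eq (shiftedDegree_mul_eq (hD ▸ hq.1) (ht j ▸ (hpiv j).1)) ?_
    refine shiftedDegree_sum_lt fun i hi => shiftedDegree_mul_lt (hqle i) (hle i j) ?_
    rcases lt_or_gt_of_ne (Finset.ne_of_mem_erase hi) with h | h
    · exact Or.inr (hPlt i j h)
    · exact Or.inl (hqlt i h)
  have hrow : rowDegree s (Matrix.vecMul q P) = (D : WithBot ℤ) := by
    refine le_antisymm (Finset.sup_le fun k _ => ?_) (hdiag ▸ shiftedDegree_le_rowDegree s _ j)
    rw [hval]
    exact shiftedDegree_sum_le fun i _ => shiftedDegree_mul_le (hqle i) (hle i k)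
  refine ⟨⟨hdiag.trans hrow.symm, fun k hk => (ne_of_lt ?_)⟩, hrow⟩
  rw [hrow, hval]
  refine shiftedDegree_sum_lt fun i _ => shiftedDegree_mul_lt (hqle i) (hle i k) ?_
  -- As `k > j`, either `i ≤ j < k` and `P i k` is to the right of the pivot of row `i`, or `i > j`
  -- and `q i` is to the right of the pivot of `q`.
  rcases le_or_gt i j with h | h
  · exact Or.inr (hPlt i k (h.trans_lt hk))
  · exact Or.inl (hqlt i h)

/-- The rows of `P` generate `N`, their `s`-pivots are on the diagonal and their `s`-degrees
are given by `t`. -/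
structure PivotBasis (s t : Fin m → ℤ) (P : Matrix (Fin m) (Fin m) K[X])
    (N : Submodule K[X] (Fin m → K[X])) : Prop where
  pivot : ∀ i, IsPivot s (P i) i
  degree : ∀ i, rowDegree s (P i) = (t i : WithBot ℤ)
  mem_iff : ∀ p, p ∈ N ↔ ∃ q, Matrix.vecMul q P = p

namespace PivotBasis

variable {s t u : Fin m → ℤ} {P Q : Matrix (Fin m) (Fin m) K[X]}
  {N N' N'' : Submodule K[X] (Fin m → K[X])}

/-- A nonzero row in the left kernel would have some integer `t`-degree `D`, and its product with
`P` would have degree `D` rather than `⊥`. -/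
theorem det_ne_zero (h : PivotBasis s t P N) : P.det ≠ 0 := by
  intro hdet
  obtain ⟨q, hq, hqP⟩ := Matrix.exists_vecMul_eq_zero_iff.2 hdet
  obtain ⟨j, hj⟩ := exists_isPivot (s := t) hq
  obtain ⟨D, hD⟩ := exists_rowDegree_eq (s := t) hq
  have := (isPivot_vecMul h.pivot h.degree hj hD).2
  rw [hqP, rowDegree_zero] at this
  exact WithBot.bot_ne_coe this

theorem isOrderedWeakPopov (h : PivotBasis s t P N) : IsOrderedWeakPopov s P :=
  ⟨h.det_ne_zero, h.pivot⟩

theorem isRowBasis (h : PivotBasis s t P N) : IsRowBasis P N := by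
  refine ⟨Matrix.linearIndependent_rows_of_det_ne_zero h.det_ne_zero, ?_⟩
  ext p
  rw [Submodule.mem_span_range_iff_exists_fun, h.mem_iff]
  refine exists_congr fun q => ?_
  rw [Matrix.vecMul_eq_sum]

/-- The degrees `t` of the rows of `P` serve as shift for `Q`, so `isPivot_vecMul` applies to each
row of `Q`. For generation, an element of `N''` lies in `N`, hence is some `q P`, and `hN` puts `q`
in the module generated by `Q`. -/
theorem mul (hP : PivotBasis s t P N) (hQ : PivotBasis t u Q N') (hle : N'' ≤ N)
    (hN : ∀ q, Matrix.vecMul q P ∈ N'' ↔ q ∈ N') : PivotBasis s u (Q * P) N'' := by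
  have hrow : ∀ i, (Q * P) i = Matrix.vecMul (Q i) P := fun i => rfl
  refine ⟨fun i => ?_, fun i => ?_, fun p => ⟨fun hp => ?_, ?_⟩⟩
  · exact (isPivot_vecMul hP.pivot hP.degree (hQ.pivot i) (hQ.degree i)).1
  · exact (isPivot_vecMul hP.pivot hP.degree (hQ.pivot i) (hQ.degree i)).2
  · obtain ⟨q, rfl⟩ := (hP.mem_iff p).1 (hle hp)
    obtain ⟨q', rfl⟩ := (hQ.mem_iff q).1 ((hN q).1 hp)
    exact ⟨q', by rw [Matrix.vecMul_vecMul]⟩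
  · rintro ⟨q, rfl⟩
    rw [← Matrix.vecMul_vecMul]
    exact (hN _).2 ((hQ.mem_iff _).2 ⟨q, rfl⟩)

theorem one (s : Fin m → ℤ) : PivotBasis s s (1 : Matrix (Fin m) (Fin m) K[X]) ⊤ := by
  have hdiag : ∀ i, shiftedDegree (s i) ((1 : Matrix (Fin m) (Fin m) K[X]) i i) = (s i : ℤ) := by
    intro i
    rw [Matrix.one_apply_eq, shiftedDegree_of_ne_zero _ one_ne_zero]
    simp
  have hoff : ∀ i j, i ≠ j →
      shiftedDegree (s j) ((1 : Matrix (Fin m) (Fin m) K[X]) i j) = ⊥ := by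
    intro i j hij
    rw [Matrix.one_apply_ne hij, shiftedDegree_zero]
  have hdeg : ∀ i, rowDegree s ((1 : Matrix (Fin m) (Fin m) K[X]) i) = (s i : ℤ) := by
    intro i
    refine le_antisymm (Finset.sup_le fun j _ => ?_) (hdiag i ▸ shiftedDegree_le_rowDegree s _ i)
    by_cases hij : i = j
    · subst hij
      exact (hdiag i).le
    · exact (hoff i j hij).le.trans bot_le
  refine ⟨fun i => ⟨(hdiag i).trans (hdeg i).symm, fun k hk => ?_⟩, hdeg, fun p => ?_⟩
  · rw [hoff i k hk.ne, hdeg]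
    exact WithBot.bot_ne_coe
  · simp

end PivotBasis

theorem shiftedDegree_taylor (s : ℤ) (a : K) (p : K[X]) :
    shiftedDegree s (taylor a p) = shiftedDegree s p := by
  rw [shiftedDegree, degree_taylor, ← shiftedDegree]

theorem IsRowBasis.mem_iff {P : Matrix (Fin m) (Fin m) K[X]}
    {N : Submodule K[X] (Fin m → K[X])} (h : IsRowBasis P N) (p : Fin m → K[X]) :
    p ∈ N ↔ ∃ q, Matrix.vecMul q P = p := by
  rw [← h.2, Submodule.mem_span_range_iff_exists_fun]
  refine exists_congr fun q => ?_
  rw [Matrix.vecMul_eq_sum]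

theorem mem_approximantModule_one {n : ℕ} {R : Matrix (Fin m) (Fin n) K} {p : Fin m → K[X]} :
    p ∈ approximantModule (R.map C) 1 ↔ Matrix.vecMul (fun j => (p j).eval 0) R = 0 := by
  change (∀ j, X ^ 1 ∣ Matrix.vecMul p (R.map C) j) ↔ _
  rw [funext_iff]
  refine forall_congr' fun j => ?_
  rw [pow_one, X_dvd_iff, coeff_zero_eq_eval_zero]
  simp [Matrix.vecMul, dotProduct, eval_finsetSum]

theorem mem_interpolantModule {n d : ℕ} {E : Fin d → Matrix (Fin m) (Fin n) K} {α : Fin d → K}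
    {p : Fin m → K[X]} : p ∈ interpolantModule E α ↔
      ∀ i, Matrix.vecMul (fun j => (p j).eval (α i)) (E i) = 0 := Iff.rfl

/-- Popov approximant bases at order one, translated to another point. -/
theorem IsPopov.pivotBasis_taylor {n : ℕ} {t : Fin m → ℤ} {Q : Matrix (Fin m) (Fin m) K[X]}
    {R : Matrix (Fin m) (Fin n) K} (hQ : IsPopov t Q)
    (hQR : IsRowBasis Q (approximantModule (R.map C) 1)) (a : K) :
    ∃ u, PivotBasis t u (Q.map (taylor (-a)))
      (interpolantModule (d := 1) (fun _ => R) fun _ => a) := by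
  have hne : ∀ i, Q i ≠ 0 := by
    intro i hi
    exact hQ.1.1 (Matrix.det_eq_zero_of_row_eq_zero i fun j => congrFun hi j)
  choose u hu using fun i => exists_rowDegree_eq (s := t) (hne i)
  have hrow : ∀ i, rowDegree t ((Q.map (taylor (-a))) i) = rowDegree t (Q i) := by
    intro i
    simp only [rowDegree, Matrix.map_apply, shiftedDegree_taylor]
  refine ⟨u, fun i => ?_, fun i => (hrow i).trans (hu i), fun p => ?_⟩
  · have := hQ.1.2 i
    unfold IsPivot at *
    simpa only [hrow, Matrix.map_apply, shiftedDegree_taylor] using this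
  -- The automorphism `X ↦ X + a` turns the condition at `a` into the condition at `0`; it preserves
  -- degrees, hence pivots.
  have hmem : p ∈ interpolantModule (d := 1) (fun _ => R) (fun _ => a) ↔
      (fun j => taylor a (p j)) ∈ approximantModule (R.map C) 1 := by
    rw [mem_approximantModule_one, mem_interpolantModule]
    simp [taylor_eval]
  have htt : ∀ b (f : K[X]), taylor b (taylor (-b) f) = f := fun b f => by
    rw [taylor_taylor]; simp
  have htt' : ∀ b (f : K[X]), taylor (-b) (taylor b f) = f := fun b f => by
    rw [taylor_taylor]; simp
  rw [hmem, hQR.mem_iff]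
  constructor
  · rintro ⟨q, hq⟩
    refine ⟨fun i => taylor (-a) (q i), funext fun j => ?_⟩
    rw [← htt' a (p j), ← congrFun hq j]
    simp [Matrix.vecMul, dotProduct, map_sum, taylor_mul]
  · rintro ⟨q, rfl⟩
    refine ⟨fun i => taylor a (q i), funext fun j => ?_⟩
    simp [Matrix.vecMul, dotProduct, map_sum, taylor_mul, htt]

end Popov

/-! ## Correctness of the algorithms -/

section Correctness

variable {K : Type*} [Field K] {A B : Type}

/-- Run from `mem`, the program `p` has a result and a final memory which satisfy `Q`. -/
def Ensures (p : Prog K A) (mem : List K) (Q : A → List K → Prop) : Prop :=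
  Q (p.run mem).out (p.run mem).mem

theorem Triple.ensures {p : Prog K A} {mem : List K} {c : ℕ} {Q : A → List K → Prop}
    (h : Triple p mem c Q) : Ensures p mem Q := h.2

theorem Ensures.pure {a : A} {mem : List K} {Q : A → List K → Prop} (h : Q a mem) :
    Ensures (Pure.pure a) mem Q := h

theorem Ensures.bind {p : Prog K A} {f : A → Prog K B} {mem : List K}
    {Q₁ : A → List K → Prop} {Q₂ : B → List K → Prop} (h : Ensures p mem Q₁)
    (h' : ∀ a mem', mem <+: mem' → Q₁ a mem' → Ensures (f a) mem' Q₂) :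
    Ensures (p >>= f) mem Q₂ := by
  have := h' _ _ (p.prefix_run mem) h
  unfold Ensures
  rw [Prog.run_bind]
  exact this

theorem Ensures.mono {p : Prog K A} {mem : List K} {Q Q' : A → List K → Prop}
    (h : Ensures p mem Q) (hQ : ∀ a mem', mem <+: mem' → Q a mem' → Q' a mem') :
    Ensures p mem Q' := hQ _ _ (p.prefix_run mem) h

theorem Ensures.tabulate {k : ℕ} {f : Fin k → Prog K A} {mem : List K}
    {Q : Fin k → A → List K → Prop} (hQ : ∀ i, Stable (Q i))
    (h : ∀ i mem', mem <+: mem' → Ensures (f i) mem' (Q i)) :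
    Ensures (Prog.tabulate k f) mem fun g mem' => ∀ i, Q i (g i) mem' := by
  induction k generalizing mem with
  | zero => exact Ensures.pure fun i => i.elim0
  | succ k ih =>
    refine (h 0 mem List.prefix_rfl).bind fun a mem₁ hm₁ ha => ?_
    refine (ih (fun i => hQ i.succ) fun i mem' hm' =>
      h i.succ mem' (hm₁.trans hm')).bind fun g mem₂ hm₂ hg => Ensures.pure fun i => ?_
    refine Fin.cases ?_ (fun i => ?_) i
    · exact hQ 0 _ _ _ hm₂ ha
    · exact hg i

theorem identityProg_triple (m : ℕ) (mem : List K) :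
    Triple (identityProg m) mem 0 fun P mem' => HasPM mem' P 1 ∧ P.LengthLe 1 := by
  refine (Triple.const 1 mem).bind_pure fun a mem' _ ha => ⟨fun i j => ?_, fun i j => ?_⟩
  · by_cases hij : i = j
    · have := hasP_cons ha (hasP_nil mem')
      subst hij
      simpa using this
    · simpa [hij] using hasP_nil mem'
  · by_cases hij : i = j <;> simp [hij]

/-- Coefficients are tested from the top down until a nonzero one is met; zeros stored above the
leading coefficient are harmless. -/
theorem degreeProg_triple {mem : List K} {l : List Reg} {p : K[X]} (h : HasP mem l p) :
    Triple (degreeProg l) mem l.length fun e _ => e = p.degree := by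
  induction l generalizing p with
  | nil =>
    obtain rfl : p = 0 := h.2.symm
    exact Triple.pure (by simp)
  | cons a l ih =>
    obtain ⟨v, q, hv, hq, rfl⟩ := h.tail
    refine (ih hq).bind fun e mem' hm he => ?_
    subst he
    by_cases hq0 : q = 0
    · simp only [hq0, degree_zero, if_true, mul_zero, add_zero]
      refine Triple.test (c := 0) (hv.mono hm) fun b hb => Triple.pure ?_
      by_cases hv0 : v = 0
      · simp [hb.2 hv0, hv0]
      · have : b = false := by
          rw [← Bool.not_eq_true, hb]
          exact hv0
        simp [this, degree_C hv0]
    · rw [if_neg (by simpa using hq0)]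
      refine (Triple.pure ?_).le (Nat.zero_le _)
      have hX : (X * q).degree = q.degree + 1 := by rw [degree_mul, degree_X, add_comm]
      conv_rhs => rw [add_comm, degree_add_C (by
        rw [hX, degree_eq_natDegree hq0]
        norm_cast
        omega)]
      exact hX.symm

theorem rowDegreesProg_triple {m n : ℕ} (s : Fin m → ℤ) {A : PMat m} {mem : List K}
    {P : Matrix (Fin m) (Fin m) K[X]} (h : HasPM mem A P) (hn : A.LengthLe n) :
    Triple (rowDegreesProg s A) mem (m * (m * n)) fun t _ =>
      ∀ i, t i = (rowDegree s (P i)).unbotD 0 := by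
  refine Triple.tabulate (Q := fun i e _ => e = (rowDegree s (P i)).unbotD 0)
    (fun i _ _ _ _ h => h) fun i mem₁ hm₁ => ?_
  refine (Triple.tabulate (Q := fun j e _ => e = (P i j).degree) (fun j _ _ _ _ h => h)
    fun j mem₂ hm₂ => (degreeProg_triple ((h i j).mono (hm₁.trans hm₂))).le (hn i j)).bind_pure ?_
  intro e mem' _ he
  simp only [rowDegree, shiftedDegree, he]

theorem translateProg_triple {m : ℕ} {Q : CMat m m × CMat m m} {a : Reg} {mem : List K}
    {Q₀ Q₁ : Matrix (Fin m) (Fin m) K} {x : K} (h₀ : HasM mem Q.1 Q₀) (h₁ : HasM mem Q.2 Q₁)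
    (ha : Has mem a x) :
    Triple (translateProg Q a) mem (m * (m * 2)) fun P mem' =>
      HasPM mem' P ((Q₀.map C + (X : K[X]) • Q₁.map C).map (taylor (-x))) ∧ P.LengthLe 2 := by
  have := Triple.tabulate₂ (k := m) (l := m) (mem := mem) (c := 2)
    (f := fun i j => do
      let b ← Prog.instr (.mul a (Q.2 i j))
      let c ← Prog.instr (.sub (Q.1 i j) b)
      pure [c, Q.2 i j])
    (Q := fun i j l mem' =>
      HasP mem' l ((Q₀.map C + (X : K[X]) • Q₁.map C).map (taylor (-x)) i j) ∧ l.length = 2)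
    (fun i j _ _ _ hm h => ⟨h.1.mono hm, h.2⟩) ?_
  · refine this.mono le_rfl fun P mem' _ h => ⟨fun i j => (h i j).1, fun i j => (h i j).2.le⟩
  · intro i j mem₁ hm₁
    refine (Triple.mul (ha.mono hm₁) ((h₁ i j).mono hm₁)).bind (c₂ := 1) fun b mem₂ hm₂ hb => ?_
    refine (Triple.sub ((h₀ i j).mono (hm₁.trans hm₂)) hb).bind_pure fun c mem₃ hm₃ hc => ⟨?_, rfl⟩
    -- `taylor (-x)` substitutes `X - x`, so the entry is `(Q₀ - x Q₁) + X Q₁`.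
    have := hasP_cons hc (hasP_cons ((h₁ i j).mono (hm₁.trans (hm₂.trans hm₃))) (hasP_nil _))
    convert this using 1
    simp [taylor_mul]
    ring

theorem Subroutines.Correct.ensures_mBasis1 {S : Subroutines K} (hS : S.Correct) {m n : ℕ}
    {F : CMat m n} {R : Matrix (Fin m) (Fin n) K} (s : Fin m → ℤ) {mem : List K}
    (hF : HasM mem F R) :
    Ensures (S.mBasis1 F s) mem fun Q mem' => ∃ Q₀ Q₁, HasM mem' Q.1 Q₀ ∧ HasM mem' Q.2 Q₁ ∧
      IsPopov s (Q₀.map C + (X : K[X]) • Q₁.map C) ∧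
      IsRowBasis (Q₀.map C + (X : K[X]) • Q₁.map C) (approximantModule (R.map C) 1) := by
  obtain ⟨hv, rfl⟩ := hasM_iff.1 hF
  obtain ⟨h1, h2, h3, h4⟩ := hS.mBasis1 F s mem hv
  exact ⟨_, _, h1.hasM, h2.hasM, h3, h4⟩

theorem Subroutines.Correct.ensures_mulPoly {S : Subroutines K} (hS : S.Correct) {m : ℕ}
    {A B : PMat m} {P Q : Matrix (Fin m) (Fin m) K[X]} {mem : List K}
    (hA : HasPM mem A P) (hB : HasPM mem B Q) :
    Ensures (S.mulPoly A B) mem fun R mem' => HasPM mem' R (P * Q) := by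
  obtain ⟨hv, rfl⟩ := hasPM_iff.1 hA
  obtain ⟨hv', rfl⟩ := hasPM_iff.1 hB
  exact hasPM_iff.2 (hS.mulPoly A B mem hv hv')

theorem Subroutines.Correct.ensures_mulConst {S : Subroutines K} (hS : S.Correct) {m n : ℕ}
    {A : CMat m m} {B : CMat m n} {P : Matrix (Fin m) (Fin m) K} {Q : Matrix (Fin m) (Fin n) K}
    {mem : List K} (hA : HasM mem A P) (hB : HasM mem B Q) :
    Ensures (S.mulConst A B) mem fun R mem' => HasM mem' R (P * Q) := by
  obtain ⟨hv, rfl⟩ := hasM_iff.1 hA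
  obtain ⟨hv', rfl⟩ := hasM_iff.1 hB
  exact hasM_iff.2 (hS.mulConst A B mem hv hv')

theorem Subroutines.Correct.ensures_eval {S : Subroutines K} (hS : S.Correct) {m k : ℕ}
    {A : PMat m} {P : Matrix (Fin m) (Fin m) K[X]} {a : Fin k → Reg} {x : Fin k → K}
    {mem : List K} (hA : HasPM mem A P) (ha : ∀ i, Has mem (a i) (x i)) :
    Ensures (S.eval A a) mem fun V mem' => ∀ i, HasM mem' (V i) (P.map (Polynomial.eval (x i))) := by
  obtain ⟨hv, rfl⟩ := hasPM_iff.1 hA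
  intro i
  have := hS.eval A a mem hv (fun i => (ha i).lt) i
  rw [(ha i).value] at this
  exact hasM_iff.2 this

/-- Because `(q P)(x i) E i = q(x i) (P(x i) E i)`: conditions on `q P` are interpolation conditions
on `q` for the residuals. -/
theorem vecMul_mem_interpolantModule {m n d : ℕ} {E : Fin d → Matrix (Fin m) (Fin n) K}
    {x : Fin d → K} {q : Fin m → K[X]} {P : Matrix (Fin m) (Fin m) K[X]} :
    Matrix.vecMul q P ∈ interpolantModule E x ↔
      q ∈ interpolantModule (fun i => P.map (eval (x i)) * E i) x := by
  simp only [mem_interpolantModule, ← Matrix.vecMul_vecMul]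
  refine forall_congr' fun i => ?_
  have : (fun j => (Matrix.vecMul q P j).eval (x i)) =
      Matrix.vecMul (fun j => (q j).eval (x i)) (P.map (eval (x i))) := by
    funext j
    simp [Matrix.vecMul, dotProduct, eval_finsetSum]
  rw [this]

/-- The rows of a pivot basis have integer degrees, so the default value `0` of `rowDegreesProg`
never occurs and the program computes the right shift. -/
theorem PivotBasis.unbotD_rowDegree {m : ℕ} {s t t' : Fin m → ℤ}
    {P : Matrix (Fin m) (Fin m) K[X]} {N : Submodule K[X] (Fin m → K[X])}
    (h : PivotBasis s t P N) (ht' : ∀ i, t' i = (rowDegree s (P i)).unbotD 0) : t' = t := by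
  funext i
  rw [ht', h.degree]
  rfl

/-- `rowDegreesProg_triple` asks for a bound on lengths that only enters its cost; for correctness
any bound will do. -/
theorem PMat.exists_lengthLe {m : ℕ} (A : PMat m) : ∃ n, A.LengthLe n :=
  ⟨∑ i, ∑ j, (A i j).length, fun i j =>
    (Finset.single_le_sum (f := fun j => (A i j).length) (fun _ _ => Nat.zero_le _)
      (Finset.mem_univ j)).trans
    (Finset.single_le_sum (f := fun i => ∑ j, (A i j).length) (fun _ _ => Nat.zero_le _)
      (Finset.mem_univ i))⟩

theorem mIntLoop_correct {S : Subroutines K} (hS : S.Correct) {m n : ℕ} {s : Fin m → ℤ} {d : ℕ}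
    {E : Fin d → CMat m n} {Ev : Fin d → Matrix (Fin m) (Fin n) K} {α : Fin d → Reg}
    {x : Fin d → K} {A : PMat m} {P : Matrix (Fin m) (Fin m) K[X]} {t : Fin m → ℤ}
    {N : Submodule K[X] (Fin m → K[X])} {mem : List K}
    (hE : ∀ i, HasM mem (E i) (Ev i)) (hα : ∀ i, Has mem (α i) (x i)) (hA : HasPM mem A P)
    (hP : PivotBasis s t P N) :
    Ensures (mIntLoop S s d E α A t) mem fun R mem' =>
      ∃ P' u, HasPM mem' R P' ∧ PivotBasis s u P' (N ⊓ interpolantModule Ev x) := by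
  induction d generalizing mem A P t N with
  | zero =>
    refine Ensures.pure ⟨P, t, hA, ?_⟩
    have : interpolantModule Ev x = ⊤ := eq_top_iff.2 fun p _ i => i.elim0
    rwa [this, inf_top_eq]
  | succ d ih =>
    refine (hS.ensures_eval (x := fun _ => x 0) hA fun _ => hα 0).bind fun V m₁ h₁ hV => ?_
    refine (hS.ensures_mulConst (hV 0) ((hE 0).mono h₁)).bind fun R m₂ h₂ hR => ?_
    refine (hS.ensures_mBasis1 t hR).bind fun Q₀ m₃ h₃ hQ₀ => ?_
    obtain ⟨B₀, B₁, hB₀, hB₁, hpop, hbas⟩ := hQ₀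
    have h₁₃ := h₁.trans (h₂.trans h₃)
    refine (translateProg_triple hB₀ hB₁ ((hα 0).mono h₁₃)).ensures.bind fun Q m₄ h₄ hQ => ?_
    have h₁₄ := h₁₃.trans h₄
    refine (hS.ensures_mulPoly hQ.1 (hA.mono h₁₄)).bind fun A' m₅ h₅ hA' => ?_
    have h₁₅ := h₁₄.trans h₅
    obtain ⟨ℓ, hℓ⟩ := A'.exists_lengthLe
    refine (rowDegreesProg_triple s hA' hℓ).ensures.bind fun t' m₆ h₆ ht' => ?_
    have h₁₆ := h₁₅.trans h₆
    obtain ⟨u, hu⟩ := hpop.pivotBasis_taylor hbas (x 0)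
    -- Every `q P` is already in `N`, so the only condition left on `q` is the one at `x 0` for the
    -- residual.
    have hmul := hP.mul (N'' := N ⊓ interpolantModule (d := 1) (fun _ => Ev 0) fun _ => x 0) hu
      inf_le_left fun q => by
        rw [Submodule.mem_inf, vecMul_mem_interpolantModule]
        exact and_iff_right ((hP.mem_iff _).2 ⟨q, rfl⟩)
    rw [hmul.unbotD_rowDegree ht']
    refine (ih (fun i => (hE i.succ).mono h₁₆) (fun i => (hα i.succ).mono h₁₆) (hA'.mono h₆)
      hmul).mono ?_
    rintro W m₇ - ⟨P', u', hW, hP'⟩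
    refine ⟨P', u', hW, ?_⟩
    convert hP' using 1
    ext p
    simp only [Submodule.mem_inf, mem_interpolantModule, Fin.forall_fin_succ, and_assoc]
    simp

theorem pmIntBasis_correct {S : Subroutines K} (hS : S.Correct) {T : ℕ} (hT : 1 ≤ T) {m n : ℕ}
    {d : ℕ} {s : Fin m → ℤ} {E : Fin d → CMat m n} {Ev : Fin d → Matrix (Fin m) (Fin n) K}
    {α : Fin d → Reg} {x : Fin d → K} {mem : List K}
    (hE : ∀ i, HasM mem (E i) (Ev i)) (hα : ∀ i, Has mem (α i) (x i)) :
    Ensures (pmIntBasis S T hT d E α s) mem fun R mem' =>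
      ∃ P u, HasPM mem' R P ∧ PivotBasis s u P (interpolantModule Ev x) := by
  induction d using Nat.strong_induction_on generalizing s mem with
  | _ d ih =>
  rw [pmIntBasis]
  split_ifs with hd
  · refine (identityProg_triple m mem).ensures.bind fun A m₁ h₁ hA => ?_
    refine (mIntLoop_correct hS (fun i => (hE i).mono h₁) (fun i => (hα i).mono h₁) hA.1
      (PivotBasis.one s)).mono ?_
    rintro R m₂ - ⟨P, u, hR, hP⟩
    exact ⟨P, u, hR, by simpa using hP⟩
  · refine (ih _ (by omega) (fun i => hE ⟨i, by omega⟩) fun i => hα ⟨i, by omega⟩).bind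
      fun A₁ m₁ h₁ hA₁ => ?_
    obtain ⟨P₁, u₁, hA₁, hP₁⟩ := hA₁
    refine (hS.ensures_eval (x := fun i : Fin (d / 2) => x ⟨(d + 1) / 2 + i, by omega⟩) hA₁
      fun i => (hα ⟨(d + 1) / 2 + i, by omega⟩).mono h₁).bind fun V m₂ h₂ hV => ?_
    have h₁₂ := h₁.trans h₂
    refine (Ensures.tabulate (Q := fun (i : Fin (d / 2)) R mem' =>
        HasM mem' R (P₁.map (eval (x ⟨(d + 1) / 2 + i, by omega⟩)) *
          Ev ⟨(d + 1) / 2 + i, by omega⟩))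
      (fun i _ _ _ hm h => h.mono hm) fun i mem' hm =>
        hS.ensures_mulConst ((hV i).mono hm) ((hE _).mono (h₁₂.trans hm))).bind
      fun R m₃ h₃ hR => ?_
    obtain ⟨ℓ, hℓ⟩ := A₁.exists_lengthLe
    refine (rowDegreesProg_triple s (hA₁.mono (h₂.trans h₃)) hℓ).ensures.bind
      fun t m₄ h₄ ht => ?_
    have h₁₄ := h₁₂.trans (h₃.trans h₄)
    rw [hP₁.unbotD_rowDegree ht]
    refine (ih _ (by omega) (fun i => (hR i).mono h₄) fun i => (hα _).mono h₁₄).bind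
      fun A₂ m₅ h₅ hA₂ => ?_
    obtain ⟨P₂, u₂, hA₂, hP₂⟩ := hA₂
    refine (hS.ensures_mulPoly hA₂ (hA₁.mono (h₂.trans (h₃.trans (h₄.trans h₅))))).mono ?_
    intro W m₆ _ hW
    have hsplit : ∀ p, p ∈ interpolantModule Ev x ↔
        p ∈ interpolantModule (fun i : Fin ((d + 1) / 2) => Ev ⟨i, by omega⟩)
          (fun i => x ⟨i, by omega⟩) ∧
        p ∈ interpolantModule (fun i : Fin (d / 2) => Ev ⟨(d + 1) / 2 + i, by omega⟩)
          (fun i => x ⟨(d + 1) / 2 + i, by omega⟩) := by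
      intro p
      simp only [mem_interpolantModule]
      refine ⟨fun h => ⟨fun i => h _, fun i => h _⟩, fun h i => ?_⟩
      by_cases hi : (i : ℕ) < (d + 1) / 2
      · exact h.1 ⟨i, hi⟩
      · have := h.2 ⟨i - (d + 1) / 2, by omega⟩
        have hi' : (⟨(d + 1) / 2 + (i - (d + 1) / 2), by omega⟩ : Fin d) = i :=
          Fin.ext (by simp; omega)
        simpa only [hi'] using this
    -- `P₂` is a basis for the residuals of the second half, with the degrees of `P₁` as shift, so
    -- the product carries the conditions of both halves.
    refine ⟨P₂ * P₁, u₂, hW, hP₁.mul hP₂ (fun p hp => ((hsplit p).1 hp).1) fun q => ?_⟩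
    rw [hsplit, ← vecMul_mem_interpolantModule]
    exact and_iff_right ((hP₁.mem_iff _).2 ⟨q, rfl⟩)

end Correctness

/-! ## Rectangular matrix multiplication -/

section MatMul

variable {K : Type*} [Field K] {A : Type}

/-- Run the programs `f i`, one for each element of a finite type. -/
noncomputable def tabulateType {ι : Type} [Fintype ι] (f : ι → Prog K A) : Prog K (ι → A) := do
  let g ← Prog.tabulate (Fintype.card ι) fun i => f ((Fintype.equivFin ι).symm i)
  pure fun i => g (Fintype.equivFin ι i)

theorem Triple.tabulateType {ι : Type} [Fintype ι] {f : ι → Prog K A} {mem : List K} {c : ℕ}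
    {Q : ι → A → List K → Prop} (hQ : ∀ i, Stable (Q i))
    (h : ∀ i mem', mem <+: mem' → Triple (f i) mem' c (Q i)) :
    Triple (tabulateType f) mem (Fintype.card ι * c) fun g mem' => ∀ i, Q i (g i) mem' := by
  refine (Triple.tabulate (Q := fun i => Q ((Fintype.equivFin ι).symm i)) (fun i => hQ _)
    fun i mem' hm => h _ _ hm).bind_pure fun g mem' _ hg i => ?_
  have := hg (Fintype.equivFin ι i)
  simpa using this

/-- The difference of two stored matrices. -/
noncomputable def subMat {ρ κ : Type} [Fintype ρ] [Fintype κ] (A B : Matrix ρ κ Reg) :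
    Prog K (Matrix ρ κ Reg) :=
  tabulateType fun i => tabulateType fun j => Prog.instr (.sub (A i j) (B i j))

theorem subMat_triple {ρ κ : Type} [Fintype ρ] [Fintype κ] {A B : Matrix ρ κ Reg}
    {M N : Matrix ρ κ K} {mem : List K} (hA : HasM mem A M) (hB : HasM mem B N) :
    Triple (subMat A B) mem (Fintype.card ρ * Fintype.card κ) fun R mem' =>
      HasM mem' R (M - N) := by
  refine (Triple.tabulateType (A := κ → Reg) (c := Fintype.card κ * 1)
    (Q := fun i r mem' => ∀ j, Has mem' (r j) ((M - N) i j))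
    (fun i _ _ _ hm h j => (h j).mono hm) fun i mem₁ h₁ => ?_).le (by simp)
  exact Triple.tabulateType (fun j => stable_has _) fun j mem₂ h₂ =>
    Triple.sub ((hA i j).mono (h₁.trans h₂)) ((hB i j).mono (h₁.trans h₂))

/-- The programs `mul a` multiply `a × a` matrices in `Ω a` operations. -/
def IsSquareMul (mul : ∀ a, CMat a a → CMat a a → Prog K (CMat a a)) (Ω : ℕ → ℕ) : Prop :=
  ∀ (a : ℕ) (A B : CMat a a) (M N : Matrix (Fin a) (Fin a) K) (mem : List K),
    HasM mem A M → HasM mem B N → Triple (mul a A B) mem (Ω a) fun R mem' => HasM mem' R (M * N)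

/-- The square block number `(b, c)` of a matrix, completed with `z`. -/
noncomputable def squareBlock {ρ κ : Type} {α : Type*} [Fintype ρ] [Fintype κ] (z : α) (M : Matrix ρ κ α)
    (a b c : ℕ) : Matrix (Fin a) (Fin a) α :=
  Matrix.of fun i j => if h : b * a + i < Fintype.card ρ ∧ c * a + j < Fintype.card κ then
    M ((Fintype.equivFin ρ).symm ⟨_, h.1⟩) ((Fintype.equivFin κ).symm ⟨_, h.2⟩) else z

/-- Product of rectangular matrices, by square blocks. -/
noncomputable def mulRect (mul : ∀ a, CMat a a → CMat a a → Prog K (CMat a a))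
    {ρ ι κ : Type} [Fintype ρ] [Fintype ι] [Fintype κ] (A : Matrix ρ ι Reg) (B : Matrix ι κ Reg) :
    Prog K (Matrix ρ κ Reg) := do
  let z ← Prog.instr (.const 0)
  let a := Fintype.card ι
  let V ← Prog.tabulate (Fintype.card ρ / a + 1) fun b =>
    Prog.tabulate (Fintype.card κ / a + 1) fun c =>
      mul a (squareBlock z A a b 0) (squareBlock z B a 0 c)
  pure <| Matrix.of fun i j => if h : 0 < a then
    V ⟨Fintype.equivFin ρ i / a, Nat.lt_succ_of_le (Nat.div_le_div_right (Fin.isLt _).le)⟩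
      ⟨Fintype.equivFin κ j / a, Nat.lt_succ_of_le (Nat.div_le_div_right (Fin.isLt _).le)⟩
      ⟨Fintype.equivFin ρ i % a, Nat.mod_lt _ h⟩ ⟨Fintype.equivFin κ j % a, Nat.mod_lt _ h⟩ else z

/-- Cost of the product by square blocks. -/
def mulRectCost (Ω : ℕ → ℕ) (ρ ι κ : ℕ) : ℕ := (ρ / ι + 1) * ((κ / ι + 1) * Ω ι)

theorem HasM.squareBlock {ρ κ : Type} [Fintype ρ] [Fintype κ] {mem : List K} {z : Reg}
    {A : Matrix ρ κ Reg} {M : Matrix ρ κ K} (h : HasM mem A M) (hz : Has mem z 0) (a b c : ℕ) :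
    HasM mem (squareBlock z A a b c) (squareBlock 0 M a b c) := by
  intro i j
  simp only [PolyMat.squareBlock, Matrix.of_apply]
  split_ifs
  · exact h _ _
  · exact hz

/-- Blocks have the inner dimension as side, so each block of the result is one square product,
without sums over blocks. Positions of the result beyond its last row or column are never read. -/
theorem mulRect_triple {mul : ∀ a, CMat a a → CMat a a → Prog K (CMat a a)} {Ω : ℕ → ℕ}
    (hmul : IsSquareMul mul Ω) {ρ ι κ : Type} [Fintype ρ] [Fintype ι] [Fintype κ]
    {A : Matrix ρ ι Reg} {B : Matrix ι κ Reg} {M : Matrix ρ ι K} {N : Matrix ι κ K} {mem : List K}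
    (hA : HasM mem A M) (hB : HasM mem B N) :
    Triple (mulRect mul A B) mem
      (mulRectCost Ω (Fintype.card ρ) (Fintype.card ι) (Fintype.card κ))
      fun R mem' => HasM mem' R (M * N) := by
  refine ((Triple.const 0 mem).bind fun z m₁ h₁ hz => ?_).le (Nat.zero_add _).le
  refine (Triple.tabulate₂ (Q := fun b c R mem' => HasM mem' R
      (squareBlock 0 M (Fintype.card ι) b 0 * squareBlock 0 N (Fintype.card ι) 0 c))
    (fun b c _ _ _ hm h => h.mono hm) fun b c m₂ h₂ =>
    hmul _ _ _ _ _ _ (((hA.mono h₁).squareBlock hz _ _ _).mono h₂)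
      (((hB.mono h₁).squareBlock hz _ _ _).mono h₂)).bind_pure ?_
  intro V m₃ h₃ hV i j
  simp only [Matrix.of_apply]
  split_ifs with ha
  · refine (hV _ _ _ _).trans (congrArg some ?_)
    rw [Matrix.mul_apply, Matrix.mul_apply, ← (Fintype.equivFin ι).symm.sum_comp]
    refine Finset.sum_congr rfl fun l _ => ?_
    have hρ := Nat.div_add_mod' (Fintype.equivFin ρ i : ℕ) (Fintype.card ι)
    have hκ := Nat.div_add_mod' (Fintype.equivFin κ j : ℕ) (Fintype.card ι)
    simp only [squareBlock, Matrix.of_apply, zero_mul, zero_add, hρ, hκ, Fin.is_lt, true_and,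
      and_true, dite_true, Fin.eta, Equiv.symm_apply_apply]
  -- Inner dimension zero: the product is an empty sum, and the stored zero is the answer.
  · have : IsEmpty ι := Fintype.card_eq_zero_iff.1 (by omega)
    have h0 : (M * N) i j = 0 := by simp [Matrix.mul_apply]
    rw [h0]
    exact hz.mono h₃

end MatMul

/-! ## Reduced bases of left kernels -/

section Kernel

variable {K : Type*} [Field K] {m : ℕ}

/-- The order on rows: by shift, then by position. -/
def RowLt (t : Fin m → ℤ) (j i : Fin m) : Prop := t j < t i ∨ (t j = t i ∧ j < i)

theorem RowLt.trans {t : Fin m → ℤ} {i j k : Fin m} (h : RowLt t i j) (h' : RowLt t j k) :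
    RowLt t i k := by
  unfold RowLt at *
  omega

theorem exists_rowLt_least (t : Fin m → ℤ) {p : Fin m → Prop} (h : ∃ i, p i) :
    ∃ j, p j ∧ ∀ i, p i → i ≠ j → RowLt t j i := by
  classical
  obtain ⟨i₀, hi₀⟩ := h
  obtain ⟨j, hj, hmin⟩ := Finset.exists_min_image (Finset.univ.filter p)
    (fun i => toLex (t i, i)) ⟨i₀, by simpa using hi₀⟩
  refine ⟨j, by simpa using hj, fun i hi hij => ?_⟩
  have := hmin i (by simpa using hi)
  rw [Prod.Lex.toLex_le_toLex] at this
  rcases this with h | ⟨h, h'⟩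
  · exact Or.inl h
  · exact Or.inr ⟨h, lt_of_le_of_ne h' hij.symm⟩

/-- The nonzero rows of `Z` form the reduced basis of the space `W`; the row number `i` is zero
if `i ∈ S`, and otherwise it has its leading entry, equal to 1, at position `i`. -/
structure ReducedKernel (t : Fin m → ℤ) (W : Set (Fin m → K)) (Z : Matrix (Fin m) (Fin m) K)
    (S : Set (Fin m)) : Prop where
  zero : ∀ i ∈ S, ∀ j, Z i j = 0
  one : ∀ i, i ∉ S → Z i i = 1
  lt : ∀ i j, j ≠ i → Z i j ≠ 0 → j ∈ S ∧ RowLt t j i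
  mem : ∀ v, Matrix.vecMul v Z ∈ W
  fix : ∀ v ∈ W, Matrix.vecMul v Z = v

theorem ReducedKernel.univ (t : Fin m → ℤ) :
    ReducedKernel t Set.univ (1 : Matrix (Fin m) (Fin m) K) ∅ where
  zero := by simp
  one := by simp
  lt i j hij h := absurd (Matrix.one_apply_ne hij.symm) h
  mem := by simp
  fix := by simp

/-- A vector of `W` satisfies `v = v Z₁`, so `v R = 0` means that `v` is in the left kernel of the
residual `Z₁ R`. What needs an argument is that the reduced shape survives the product. -/
theorem ReducedKernel.comp {t : Fin m → ℤ} {W : Set (Fin m → K)} {κ : Type*}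
    {R : Matrix (Fin m) κ K} {Z₁ Z₂ : Matrix (Fin m) (Fin m) K} {S₁ S₂ : Set (Fin m)}
    (h₁ : ReducedKernel t W Z₁ S₁)
    (h₂ : ReducedKernel t {v | Matrix.vecMul v (Z₁ * R) = 0} Z₂ S₂) :
    ReducedKernel t (W ∩ {v | Matrix.vecMul v R = 0}) (Z₂ * Z₁) (S₁ ∪ S₂) := by
  -- A zero row of `Z₁` stays zero in `Z₁ R`, so the unit vector `e_i` is in the second kernel and
  -- is fixed by `Z₂`.
  have hrow : ∀ i ∈ S₁, ∀ j, Z₂ i j = (1 : Matrix (Fin m) (Fin m) K) i j := by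
    intro i hi j
    have := h₂.fix (Pi.single i 1) (by
      simp only [Set.mem_ofPred_eq, ← Matrix.vecMul_vecMul, Matrix.single_one_vecMul]
      have : Z₁.row i = 0 := funext (h₁.zero i hi)
      rw [this, Matrix.zero_vecMul])
    rw [Matrix.single_one_vecMul] at this
    rw [show Z₂ i j = Z₂.row i j from rfl, this, Matrix.one_apply, Pi.single_apply]
    simp only [eq_comm]
  have hdisj : ∀ i ∈ S₂, i ∉ S₁ := by
    intro i hi hi'
    have := hrow i hi' i
    rw [h₂.zero i hi i, Matrix.one_apply_eq] at this
    exact zero_ne_one this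
  -- Supports: the row `i` must be in neither set, and the intermediate index is `i` itself or a row
  -- of `S₂` that precedes it.
  have hterm : ∀ i j k, Z₂ i j * Z₁ j k ≠ 0 → i ∉ S₁ ∧ i ∉ S₂ ∧
      (j = i ∨ (j ∈ S₂ ∧ RowLt t j i)) := by
    intro i j k h
    obtain ⟨ha, hb⟩ := mul_ne_zero_iff.1 h
    refine ⟨fun hi => ?_, fun hi => ha (h₂.zero i hi j), ?_⟩
    · rw [hrow i hi j] at ha
      obtain rfl : i = j := by
        by_contra hij
        exact ha (Matrix.one_apply_ne hij)
      exact hb (h₁.zero i hi k)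
    · by_cases hij : j = i
      · exact Or.inl hij
      · exact Or.inr (h₂.lt i j hij ha)
  refine ⟨?_, ?_, ?_, ?_, ?_⟩
  · intro i hi j
    rw [Matrix.mul_apply]
    refine Finset.sum_eq_zero fun l _ => ?_
    by_contra h
    have := hterm i l j h
    exact hi.elim this.1 this.2.1
  · intro i hi
    rw [Set.mem_union, not_or] at hi
    rw [Matrix.mul_apply, Finset.sum_eq_single i, h₂.one i hi.2, h₁.one i hi.1, one_mul]
    · intro l _ hl
      by_contra h
      rcases (hterm i l i h).2.2 with h' | h'
      · exact hl h'
      · exact hi.1 (h₁.lt l i (Ne.symm hl) (mul_ne_zero_iff.1 h).2).1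
    · simp
  · intro i j hij h
    rw [Matrix.mul_apply] at h
    obtain ⟨l, -, hl⟩ := Finset.exists_ne_zero_of_sum_ne_zero h
    have hl' := (mul_ne_zero_iff.1 hl).2
    rcases (hterm i l j hl).2.2 with rfl | h'
    · exact ⟨Or.inl (h₁.lt l j hij hl').1, (h₁.lt l j hij hl').2⟩
    · by_cases hjl : j = l
      · subst hjl
        exact ⟨Or.inr h'.1, h'.2⟩
      · exact ⟨Or.inl (h₁.lt l j hjl hl').1, (h₁.lt l j hjl hl').2.trans h'.2⟩
  · intro v
    rw [← Matrix.vecMul_vecMul]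
    refine ⟨h₁.mem _, ?_⟩
    have := h₂.mem v
    rw [Set.mem_ofPred_eq, ← Matrix.vecMul_vecMul] at this
    exact this
  · rintro v ⟨hv, hvR⟩
    rw [← Matrix.vecMul_vecMul, h₂.fix v, h₁.fix v hv]
    rw [Set.mem_ofPred_eq, ← Matrix.vecMul_vecMul, h₁.fix v hv]
    exact hvR

theorem isPivot_of_forall {s : Fin m → ℤ} {p : Fin m → K[X]} {i : Fin m} {D : ℤ}
    (hi : shiftedDegree (s i) (p i) = (D : WithBot ℤ))
    (hle : ∀ j, shiftedDegree (s j) (p j) ≤ (D : WithBot ℤ))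
    (hlt : ∀ j, i < j → shiftedDegree (s j) (p j) < (D : WithBot ℤ)) :
    IsPivot s p i ∧ rowDegree s p = (D : WithBot ℤ) := by
  have hrow : rowDegree s p = (D : WithBot ℤ) :=
    le_antisymm (Finset.sup_le fun j _ => hle j) (hi ▸ shiftedDegree_le_rowDegree s p i)
  exact ⟨⟨hi.trans hrow.symm, fun j hj => hrow ▸ (hlt j hj).ne⟩, hrow⟩

open Classical in
/-- From the reduced basis of a left kernel to the Popov approximant basis at order one. -/
theorem ReducedKernel.isPopov {t : Fin m → ℤ} {n : ℕ} {R : Matrix (Fin m) (Fin n) K}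
    {Z : Matrix (Fin m) (Fin m) K} {S : Set (Fin m)}
    (h : ReducedKernel t {v | Matrix.vecMul v R = 0} Z S) {D : Matrix (Fin m) (Fin m) K}
    (hD : D = Matrix.diagonal fun i => if i ∈ S then 1 else 0) :
    IsPopov t (Z.map C + (X : K[X]) • D.map C) ∧
      IsRowBasis (Z.map C + (X : K[X]) • D.map C) (approximantModule (R.map C) 1) := by
  set Q := Z.map C + (X : K[X]) • D.map C with hQ
  have hoff : ∀ i j, j ≠ i → Q i j = C (Z i j) := by
    intro i j hij
    simp [hQ, hD, Matrix.diagonal_apply_ne' _ hij]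
  have hS : ∀ i ∈ S, Q i i = X := by
    intro i hi
    simp [hQ, hD, hi, h.zero i hi]
  have hS' : ∀ i, i ∉ S → Q i i = 1 := by
    intro i hi
    simp [hQ, hD, hi, h.one i hi]
  have hlt : ∀ i j, j ≠ i → Q i j ≠ 0 → i ∉ S ∧ j ∈ S ∧ RowLt t j i ∧ Q i j = C (Z i j) := by
    intro i j hij hne
    rw [hoff i j hij] at hne ⊢
    have hz : Z i j ≠ 0 := fun h0 => hne (by simp [h0])
    exact ⟨fun hi => hz (h.zero i hi j), (h.lt i j hij hz).1, (h.lt i j hij hz).2, rfl⟩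
  have hdiag : ∀ i, ∃ e : ℤ, 0 ≤ e ∧ shiftedDegree (t i) (Q i i) = ((t i + e : ℤ) : WithBot ℤ) := by
    intro i
    by_cases hi : i ∈ S
    · exact ⟨1, zero_le_one, by rw [hS i hi, shiftedDegree_of_ne_zero _ X_ne_zero]; simp [add_comm]⟩
    · exact ⟨0, le_rfl, by rw [hS' i hi, shiftedDegree_of_ne_zero _ one_ne_zero]; simp⟩
  choose e he hdiag using hdiag
  have hpiv : ∀ i, IsPivot t (Q i) i ∧ rowDegree t (Q i) = ((t i + e i : ℤ) : WithBot ℤ) := by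
    intro i
    -- A nonzero off-diagonal entry is a constant at a position `j` preceding `i`: its shift is
    -- smaller, or equal with `j` to the left. This is what makes the diagonal entry the pivot.
    have hcomp : ∀ j, j ≠ i → Q i j ≠ 0 → RowLt t j i ∧
        shiftedDegree (t j) (Q i j) = (t j : WithBot ℤ) := by
      intro j hij hne
      obtain ⟨-, -, h3, h4⟩ := hlt i j hij hne
      refine ⟨h3, ?_⟩
      rw [shiftedDegree_of_ne_zero _ hne, h4]
      simp
    refine isPivot_of_forall (hdiag i) (fun j => ?_) fun j hj => ?_
    · by_cases hij : j = i
      · rw [hij, hdiag i]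
      by_cases hne : Q i j = 0
      · simp [hne]
      · rw [(hcomp j hij hne).2, WithBot.coe_le_coe]
        have := (hcomp j hij hne).1
        have := he i
        unfold RowLt at *
        omega
    · by_cases hne : Q i j = 0
      · simp [hne, WithBot.bot_lt_coe]
      · rw [(hcomp j hj.ne' hne).2, WithBot.coe_lt_coe]
        have := (hcomp j hj.ne' hne).1
        have := he i
        unfold RowLt at *
        omega
  have hvec : ∀ (q : Fin m → K[X]) j, Matrix.vecMul q Q j =
      Matrix.vecMul q (Z.map C) j + X * (if j ∈ S then q j else 0) := by
    intro q j
    rw [hQ, Matrix.vecMul_add, Matrix.vecMul_smul, Pi.add_apply, Pi.smul_apply, smul_eq_mul]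
    congr 2
    rw [hD, Matrix.diagonal_map (by simp), Matrix.vecMul_diagonal]
    split_ifs <;> simp
  have heval : ∀ (q : Fin m → K[X]) j, (Matrix.vecMul q (Z.map C) j).eval 0 =
      Matrix.vecMul (fun i => (q i).eval 0) Z j := by
    intro q j
    simp [Matrix.vecMul, dotProduct, eval_finsetSum]
  have hbasis : PivotBasis t (fun i => t i + e i) Q (approximantModule (R.map C) 1) := by
    refine ⟨fun i => (hpiv i).1, fun i => (hpiv i).2, fun p => ?_⟩
    rw [mem_approximantModule_one]
    constructor
    · intro hp
      have hfix := h.fix _ hp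
      -- Here `q Q = q Z + X q D`. The rows of `Z` in `S` vanish, so the coefficients of `q` in `S`
      -- do not affect `q Z` and can be used to correct `p - p Z`, which is divisible by `X` because
      -- `p(0) Z = p(0)`.
      refine ⟨fun j => if j ∈ S then divX (p j - Matrix.vecMul p (Z.map C) j) else p j, ?_⟩
      funext j
      have hsame : Matrix.vecMul (fun j => if j ∈ S then
          divX (p j - Matrix.vecMul p (Z.map C) j) else p j) (Z.map C) j =
          Matrix.vecMul p (Z.map C) j := by
        change ∑ i, (if i ∈ S then divX (p i - Matrix.vecMul p (Z.map C) i) else p i) *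
          (Z.map C) i j = ∑ i, p i * (Z.map C) i j
        refine Finset.sum_congr rfl fun i _ => ?_
        by_cases hi : i ∈ S
        · simp [h.zero i hi j]
        · simp [hi]
      rw [hvec, hsame]
      by_cases hj : j ∈ S
      · simp only [hj, if_true]
        have hz : (p j - Matrix.vecMul p (Z.map C) j).coeff 0 = 0 := by
          rw [coeff_zero_eq_eval_zero, eval_sub, heval, hfix, sub_self]
        have := X_mul_divX_add (p j - Matrix.vecMul p (Z.map C) j)
        rw [hz, map_zero, add_zero] at this
        rw [this]
        ring
      · simp only [hj, if_false, mul_zero, add_zero]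
        -- Outside `S` the column `j` of `Z` is a unit vector.
        change ∑ i, p i * (Z.map C) i j = p j
        rw [Finset.sum_eq_single j]
        · simp [h.one j hj]
        · intro i _ hij
          have : Z i j = 0 := by
            by_contra hne
            exact hj (h.lt i j hij.symm hne).1
          simp [this]
        · simp
    · rintro ⟨q, rfl⟩
      have : (fun j => (Matrix.vecMul q Q j).eval 0) =
          Matrix.vecMul (fun i => (q i).eval 0) Z := by
        funext j
        rw [hvec, eval_add, heval, eval_mul, eval_X, zero_mul, add_zero]
      rw [this]
      exact h.mem _
  refine ⟨⟨hbasis.isOrderedWeakPopov, fun i => ?_, fun i j hij => ?_⟩, hbasis.isRowBasis⟩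
  · by_cases hi : i ∈ S
    · rw [hS i hi]
      exact monic_X
    · rw [hS' i hi]
      exact monic_one
  · by_cases hne : Q i j = 0
    · rw [hne, degree_zero, bot_lt_iff_ne_bot, Ne, degree_eq_bot]
      by_cases hj : j ∈ S
      · rw [hS j hj]
        exact X_ne_zero
      · rw [hS' j hj]
        exact one_ne_zero
    · obtain ⟨-, hj, -, hC⟩ := hlt i j (Ne.symm hij) hne
      rw [hS j hj, hC, degree_X]
      exact degree_C_le.trans_lt (by norm_num)

end Kernel

/-! ## Computation of reduced left kernels by fast elimination -/

/-- An index type with `2 ^ k` elements. -/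
def Cols : ℕ → Type
  | 0 => Unit
  | k + 1 => Cols k ⊕ Cols k

instance Cols.fintype : ∀ k, Fintype (Cols k)
  | 0 => inferInstanceAs (Fintype Unit)
  | k + 1 => letI := Cols.fintype k; inferInstanceAs (Fintype (Cols k ⊕ Cols k))

theorem card_cols (k : ℕ) : Fintype.card (Cols k) = 2 ^ k := by
  induction k with
  | zero => rfl
  | succ k ih =>
    have : Fintype.card (Cols (k + 1)) = Fintype.card (Cols k ⊕ Cols k) := rfl
    rw [this, Fintype.card_sum, ih, pow_succ]
    ring

section Elimination

variable {K : Type*} [Field K] {m : ℕ}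

/-- The selection matrix of a partial map. -/
def selMat (K : Type*) [Field K] {γ : Type} (σ : γ → Option (Fin m)) : Matrix γ (Fin m) K :=
  Matrix.of fun c j => if σ c = some j then 1 else 0

/-- Selection of rows of a stored matrix. -/
def selRows {γ κ : Type} (z : Reg) (σ : γ → Option (Fin m)) (A : Matrix (Fin m) κ Reg) :
    Matrix γ κ Reg :=
  Matrix.of fun c j => match σ c with
    | some i => A i j
    | none => z

theorem HasM.selRows {γ κ : Type} {z : Reg} (σ : γ → Option (Fin m)) {A : Matrix (Fin m) κ Reg}
    {M : Matrix (Fin m) κ K} {mem : List K} (hA : HasM mem A M) (hz : Has mem z 0) :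
    HasM mem (selRows z σ A) (selMat K σ * M) := by
  intro c j
  rw [Matrix.mul_apply]
  cases h : σ c with
  | none => simpa [PolyMat.selRows, selMat, h] using hz
  | some i => simpa [PolyMat.selRows, selMat, h] using hA i j

open Classical in
/-- Elimination of `2 ^ k` columns: in the result `(σ, C)`, the matrix `1 - C * selMat σ` gives the
reduced basis of the left kernel. -/
noncomputable def elim (mul : ∀ a, CMat a a → CMat a a → Prog K (CMat a a)) (t : Fin m → ℤ) :
    (k : ℕ) → Matrix (Fin m) (Cols k) Reg →
      Prog K ((Cols k → Option (Fin m)) × Matrix (Fin m) (Cols k) Reg)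
  | 0, A => do
      let b ← Prog.tabulate m fun i => Prog.test (A i ()) pure
      if h : ∃ j, b j = false ∧ ∀ i, b i = false → i ≠ j → RowLt t j i then do
        let v ← Prog.tabulate m fun i => Prog.instr (.div (A i ()) (A h.choose ()))
        pure (fun _ => some h.choose, Matrix.of fun i _ => v i)
      else do
        let z ← Prog.instr (.const 0)
        pure (fun _ => none, Matrix.of fun _ _ => z)
  | k + 1, A => do
      let A₁ : Matrix (Fin m) (Cols k) Reg := Matrix.of fun i c => A i (Sum.inl c)
      let A₂ : Matrix (Fin m) (Cols k) Reg := Matrix.of fun i c => A i (Sum.inr c)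
      let z ← Prog.instr (.const 0)
      let r₁ ← elim mul t k A₁
      let P ← mulRect mul r₁.2 (selRows z r₁.1 A₂)
      let B ← subMat A₂ P
      let r₂ ← elim mul t k B
      let P' ← mulRect mul r₂.2 (selRows z r₂.1 r₁.2)
      let C ← subMat r₁.2 P'
      pure (fun c : Cols k ⊕ Cols k => Sum.elim r₁.1 r₂.1 c,
        Matrix.of fun i (c : Cols k ⊕ Cols k) => Sum.elim (C i) (r₂.2 i) c)

/-- Cost of the elimination of `2 ^ k` columns. -/
def elimCost (Ω : ℕ → ℕ) (m : ℕ) : ℕ → ℕ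
  | 0 => 2 * m
  | k + 1 => 2 * elimCost Ω m k + 2 * mulRectCost Ω m (2 ^ k) (2 ^ k) + 2 * (m * 2 ^ k)

/-- Specification of the elimination. -/
def ElimSpec {γ : Type} [Fintype γ] (t : Fin m → ℤ) (R : Matrix (Fin m) γ K)
    (r : (γ → Option (Fin m)) × Matrix (Fin m) γ Reg) (mem : List K) : Prop :=
  ∃ N, HasM mem r.2 N ∧ ReducedKernel t {v | Matrix.vecMul v R = 0} (1 - N * selMat K r.1)
    {i | ∃ c, r.1 c = some i}

/-- The pivot is the `RowLt`-least row with a nonzero entry, so that all rows modified by the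
elimination come after it, as the reduced shape demands. If the column is zero, the kernel is
everything. -/
theorem elim_zero_triple {Ω : ℕ → ℕ} (mul : ∀ a, CMat a a → CMat a a → Prog K (CMat a a)) (t : Fin m → ℤ)
    {A : Matrix (Fin m) (Cols 0) Reg} {R : Matrix (Fin m) (Cols 0) K} {mem : List K}
    (hA : HasM mem A R) : Triple (elim mul t 0 A) mem (elimCost Ω m 0) (ElimSpec t R) := by
  have hvec : ∀ v c, Matrix.vecMul v R c = ∑ i, v i * R i () := fun v c => rfl
  unfold elim
  refine ((Triple.tabulate (c := 1) (Q := fun i b _ => (b = true ↔ R i () = 0))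
    (fun i _ _ _ _ h => h) fun i m₁ h₁ => Triple.test ((hA i ()).mono h₁) fun b hb =>
      Triple.pure hb).bind (c₂ := m * 1) fun b m₁ h₁ hb => ?_).le (by simp [elimCost]; omega)
  have hb' : ∀ i, b i = false ↔ R i () ≠ 0 := fun i => by
    rw [← Bool.not_eq_true, hb]
  split_ifs with h
  · obtain ⟨hj, hmin⟩ := h.choose_spec
    generalize h.choose = j at hj hmin
    rw [hb'] at hj
    refine (Triple.tabulate (Q := fun i r mem' => Has mem' r (R i () / R j ()))
      (fun i => stable_has _) fun i m₂ h₂ => Triple.div ((hA i ()).mono (h₁.trans h₂))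
        ((hA j ()).mono (h₁.trans h₂))).bind_pure fun v m₂ h₂ hv => ?_
    let N : Matrix (Fin m) (Cols 0) K := Matrix.of fun i _ => R i () / R j ()
    let σ : Cols 0 → Option (Fin m) := fun _ => some j
    refine ⟨N, fun i _ => hv i, ?_⟩
    change ReducedKernel t _ (1 - N * selMat K σ) {i | ∃ c, σ c = some i}
    have hN : ∀ i l, (N * selMat K σ) i l = if j = l then R i () / R j () else 0 := by
      intro i l
      change ∑ c : Unit, R i () / R j () * (if some j = some l then 1 else 0) = _
      simp
    have hS : {i | ∃ c, σ c = some i} = {j} := by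
      ext i
      constructor
      · rintro ⟨_, h⟩
        simpa [σ] using h.symm
      · rintro rfl
        exact ⟨(), rfl⟩
    have hv : ∀ v, Matrix.vecMul v (1 - N * selMat K σ) = v - Pi.single j ((∑ i, v i * R i ()) / R j ()) := by
      intro v
      rw [Matrix.vecMul_sub, Matrix.vecMul_one]
      congr 1
      funext l
      change ∑ i, v i * (N * selMat K σ) i l = _
      simp only [hN, Pi.single_apply, Finset.sum_div, eq_comm (a := j)]
      split_ifs
      · exact Finset.sum_congr rfl fun i _ => by rw [mul_div_assoc]
      · simp
    rw [hS]
    refine ⟨?_, ?_, ?_, ?_, ?_⟩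
    · rintro i rfl l
      rw [Matrix.sub_apply, hN, div_self hj, Matrix.one_apply, sub_self]
    · intro i hi
      rw [Matrix.sub_apply, hN, if_neg (fun h => hi h.symm), Matrix.one_apply_eq, sub_zero]
    · intro i l hil h0
      rw [Matrix.sub_apply, hN, Matrix.one_apply_ne hil.symm, zero_sub, neg_ne_zero] at h0
      have hjl : j = l := by
        by_contra hjl
        simp [hjl] at h0
      subst hjl
      rw [if_pos rfl] at h0
      exact ⟨rfl, hmin i ((hb' i).2 fun h => h0 (by rw [h, zero_div])) hil.symm⟩
    · intro v
      rw [hv]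
      funext c
      rw [hvec]
      simp only [Pi.sub_apply, sub_mul, Finset.sum_sub_distrib, Pi.single_apply, ite_mul, zero_mul,
        Finset.sum_ite_eq', Finset.mem_univ, if_true]
      rw [div_mul_cancel₀ _ hj, sub_self]
      rfl
    · intro v hvR
      have : ∑ i, v i * R i () = 0 := (hvec v ()).symm.trans (congrFun hvR ())
      rw [hv, this]
      simp
  · refine ((Triple.const 0 m₁).bind_pure fun z m₂ h₂ hz => ?_).le (Nat.zero_le _)
    have hR : R = 0 := by
      ext i c
      by_contra hne
      obtain ⟨j, hj⟩ := exists_rowLt_least t (p := fun i => b i = false) ⟨i, (hb' i).2 hne⟩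
      exact h ⟨j, hj⟩
    refine ⟨0, fun _ _ => hz, ?_⟩
    have hS : {i : Fin m | ∃ _ : Cols 0, (none : Option (Fin m)) = some i} = ∅ := by
      ext i
      simp
    simp only [hS, hR, Matrix.zero_mul, sub_zero, Matrix.vecMul_zero]
    have := ReducedKernel.univ (K := K) t
    convert this
    simp

/-- The left half gives `Z₁ = 1 - N₁ σ₁`, and the residual `Z₁ R₂` gives `Z₂ = 1 - N₂ σ₂`. Then `Z₂
Z₁ = 1 - (N₁ - N₂ σ₂ N₁) σ₁ - N₂ σ₂` has the same shape for all the columns. Storing the thin factor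
`N` keeps every product of size `m × 2 ^ k` by `2 ^ k × 2 ^ k`, and multiplying by `σ` on the left
is a free selection of rows. -/
theorem elim_triple {mul : ∀ a, CMat a a → CMat a a → Prog K (CMat a a)} {Ω : ℕ → ℕ}
    (hmul : IsSquareMul mul Ω) (t : Fin m → ℤ) (k : ℕ)
    {A : Matrix (Fin m) (Cols k) Reg} {R : Matrix (Fin m) (Cols k) K} {mem : List K}
    (hA : HasM mem A R) : Triple (elim mul t k A) mem (elimCost Ω m k) (ElimSpec t R) := by
  induction k generalizing mem with
  | zero => exact elim_zero_triple mul t hA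
  | succ k ih =>
    let R₁ : Matrix (Fin m) (Cols k) K := Matrix.of fun i c => R i (Sum.inl c)
    let R₂ : Matrix (Fin m) (Cols k) K := Matrix.of fun i c => R i (Sum.inr c)
    have hA₁ : HasM mem (Matrix.of fun i (c : Cols k) => A i (Sum.inl c)) R₁ :=
      fun i c => hA i (Sum.inl c)
    have hA₂ : HasM mem (Matrix.of fun i (c : Cols k) => A i (Sum.inr c)) R₂ :=
      fun i c => hA i (Sum.inr c)
    have hcost : 0 + (elimCost Ω m k + (mulRectCost Ω m (2 ^ k) (2 ^ k) + (m * 2 ^ k +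
        (elimCost Ω m k + (mulRectCost Ω m (2 ^ k) (2 ^ k) + m * 2 ^ k))))) ≤
        elimCost Ω m (k + 1) := by
      rw [elimCost]
      omega
    unfold elim
    refine ((Triple.const 0 mem).bind fun z m₁ h₁ hz => ?_).le hcost
    refine (ih (hA₁.mono h₁)).bind fun r₁ m₂ h₂ hr₁ => ?_
    obtain ⟨N₁, hN₁, hZ₁⟩ := hr₁
    have h₁₂ := h₁.trans h₂
    have hm₁ := mulRect_triple hmul hN₁ ((hA₂.mono h₁₂).selRows r₁.1 (hz.mono h₂))
    simp only [Fintype.card_fin, card_cols] at hm₁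
    refine hm₁.bind fun P m₃ h₃ hP => ?_
    have hs₁ := subMat_triple (hA₂.mono (h₁₂.trans h₃)) hP
    simp only [Fintype.card_fin, card_cols] at hs₁
    refine hs₁.bind fun B m₄ h₄ hB => ?_
    refine (ih hB).bind fun r₂ m₅ h₅ hr₂ => ?_
    obtain ⟨N₂, hN₂, hZ₂⟩ := hr₂
    have h₃₅ := h₃.trans (h₄.trans h₅)
    have hm₂ := mulRect_triple hmul hN₂ ((hN₁.mono h₃₅).selRows r₂.1 (hz.mono (h₂.trans h₃₅)))
    simp only [Fintype.card_fin, card_cols] at hm₂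
    refine hm₂.bind fun P' m₆ h₆ hP' => ?_
    have hs₂ := subMat_triple (hN₁.mono (h₃₅.trans h₆)) hP'
    simp only [Fintype.card_fin, card_cols] at hs₂
    refine hs₂.bind_pure fun C m₇ h₇ hC => ?_
    refine ⟨Matrix.of fun i (c : Cols k ⊕ Cols k) =>
      Sum.elim ((N₁ - N₂ * (selMat K r₂.1 * N₁)) i) (N₂ i) c, ?_, ?_⟩
    · rintro i (c | c)
      · exact hC i c
      · exact (hN₂.mono (h₆.trans h₇)) i c
    rw [show R₂ - N₁ * (selMat K r₁.1 * R₂) = (1 - N₁ * selMat K r₁.1) * R₂ by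
      rw [Matrix.sub_mul, Matrix.one_mul, Matrix.mul_assoc]] at hZ₂
    have := hZ₁.comp hZ₂
    convert this using 1
    · ext v
      rw [Set.mem_inter_iff]
      simp only [Set.mem_ofPred_eq, funext_iff]
      exact Sum.forall
    · rw [Matrix.sub_mul, Matrix.mul_sub, Matrix.mul_sub, Matrix.one_mul, Matrix.mul_one,
        Matrix.one_mul]
      have : (Matrix.of fun i (c : Cols k ⊕ Cols k) =>
          Sum.elim ((N₁ - N₂ * (selMat K r₂.1 * N₁)) i) (N₂ i) c) *
          selMat K (fun c : Cols k ⊕ Cols k => Sum.elim r₁.1 r₂.1 c) =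
          (N₁ - N₂ * (selMat K r₂.1 * N₁)) * selMat K r₁.1 + N₂ * selMat K r₂.1 := by
        ext i j
        simp only [Matrix.mul_apply, Matrix.add_apply, Fintype.sum_sum_type]
        rfl
      refine (congrArg (fun M => 1 - M) this).trans ?_
      rw [Matrix.sub_mul]
      simp only [Matrix.mul_assoc]
      abel
    · ext i
      exact Sum.exists

/-- Processing blocks of columns one after the other, from the reduced left kernel `Z` of the
previous blocks. -/
noncomputable def kernelLoop (mul : ∀ a, CMat a a → CMat a a → Prog K (CMat a a)) (t : Fin m → ℤ)
    (k : ℕ) : (b : ℕ) → (Fin b → Matrix (Fin m) (Cols k) Reg) → CMat m m → Set (Fin m) →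
      Prog K (CMat m m × Set (Fin m))
  | 0, _, Z, S => pure (Z, S)
  | b + 1, F, Z, S => do
      let z ← Prog.instr (.const 0)
      let R ← mulRect mul Z (F 0)
      let r ← elim mul t k R
      let P ← mulRect mul r.2 (selRows z r.1 Z)
      let Z' ← subMat Z P
      kernelLoop mul t k b (fun i => F i.succ) Z' (S ∪ {i | ∃ c, r.1 c = some i})

/-- Cost of processing one block of columns. -/
def kernelStepCost (Ω : ℕ → ℕ) (m k : ℕ) : ℕ :=
  mulRectCost Ω m m (2 ^ k) + elimCost Ω m k + mulRectCost Ω m (2 ^ k) m + m * m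

theorem kernelLoop_triple {mul : ∀ a, CMat a a → CMat a a → Prog K (CMat a a)} {Ω : ℕ → ℕ}
    (hmul : IsSquareMul mul Ω) (t : Fin m → ℤ) (k b : ℕ) {F : Fin b → Matrix (Fin m) (Cols k) Reg}
    {R : Fin b → Matrix (Fin m) (Cols k) K} {Z : CMat m m} {M : Matrix (Fin m) (Fin m) K}
    {S : Set (Fin m)} {W : Set (Fin m → K)} {mem : List K} (hF : ∀ i, HasM mem (F i) (R i))
    (hZ : HasM mem Z M) (hM : ReducedKernel t W M S) :
    Triple (kernelLoop mul t k b F Z S) mem (b * kernelStepCost Ω m k) fun r mem' =>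
      ∃ M', HasM mem' r.1 M' ∧
        ReducedKernel t (W ∩ {v | ∀ i, Matrix.vecMul v (R i) = 0}) M' r.2 := by
  induction b generalizing Z M S W mem with
  | zero => exact (Triple.pure ⟨M, hZ, by simpa using hM⟩).le (Nat.zero_le _)
  | succ b ih =>
    have hcost : 0 + (mulRectCost Ω m m (2 ^ k) + (elimCost Ω m k + (mulRectCost Ω m (2 ^ k) m +
        (m * m + b * kernelStepCost Ω m k)))) ≤ (b + 1) * kernelStepCost Ω m k := by
      rw [Nat.succ_mul, kernelStepCost]
      omega
    refine ((Triple.const 0 mem).bind fun z m₁ h₁ hz => ?_).le hcost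
    have hm₁ := mulRect_triple hmul (hZ.mono h₁) ((hF 0).mono h₁)
    simp only [Fintype.card_fin, card_cols] at hm₁
    refine hm₁.bind fun B m₂ h₂ hB => ?_
    refine (elim_triple hmul t k hB).bind fun r m₃ h₃ hr => ?_
    obtain ⟨N, hN, hZ'⟩ := hr
    have h₁₃ := h₁.trans (h₂.trans h₃)
    have hm₂ := mulRect_triple hmul hN ((hZ.mono h₁₃).selRows r.1 (hz.mono (h₂.trans h₃)))
    simp only [Fintype.card_fin, card_cols] at hm₂
    refine hm₂.bind fun P m₄ h₄ hP => ?_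
    have h₁₄ := h₁₃.trans h₄
    have hs := subMat_triple (hZ.mono h₁₄) hP
    simp only [Fintype.card_fin] at hs
    refine hs.bind fun Z' m₅ h₅ hZ' => ?_
    -- `selMat` only selects rows, so the update of the kernel matrix to `(1 - N σ) M` takes one
    -- product with inner dimension `2 ^ k` and one subtraction.
    rw [show M - N * (selMat K r.1 * M) = (1 - N * selMat K r.1) * M by
      rw [Matrix.sub_mul, Matrix.one_mul, Matrix.mul_assoc]] at hZ'
    refine (ih (fun i => (hF i.succ).mono (h₁₄.trans h₅)) hZ' (hM.comp ‹_›)).mono le_rfl ?_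
    rintro q m₆ - ⟨M', hM', hW⟩
    refine ⟨M', hM', ?_⟩
    convert hW using 1
    ext v
    simp only [Set.mem_inter_iff, Set.mem_ofPred_eq, Fin.forall_fin_succ, and_assoc]

open Classical in
/-- Popov approximant basis at order one. -/
noncomputable def mBasis1Prog (mul : ∀ a, CMat a a → CMat a a → Prog K (CMat a a)) {n : ℕ}
    (F : CMat m n) (t : Fin m → ℤ) : Prog K (CMat m m × CMat m m) := do
  let z ← Prog.instr (.const 0)
  let o ← Prog.instr (.const 1)
  let k := Nat.clog 2 m
  let r ← kernelLoop mul t k (n / 2 ^ k + 1)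
    (fun b => Matrix.of fun i c => if h : (b : ℕ) * 2 ^ k + (Fintype.equivFin (Cols k) c : ℕ) < n then
      F i ⟨_, h⟩ else z) (Matrix.of fun i j => if i = j then o else z) ∅
  pure (r.1, Matrix.of fun i j => if i = j ∧ i ∈ r.2 then o else z)

theorem mBasis1Prog_triple {mul : ∀ a, CMat a a → CMat a a → Prog K (CMat a a)} {Ω : ℕ → ℕ}
    (hmul : IsSquareMul mul Ω) {n : ℕ} {F : CMat m n} {R : Matrix (Fin m) (Fin n) K}
    (t : Fin m → ℤ) {mem : List K} (hF : HasM mem F R) :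
    Triple (mBasis1Prog mul F t) mem
      ((n / 2 ^ Nat.clog 2 m + 1) * kernelStepCost Ω m (Nat.clog 2 m)) fun Q mem' =>
      ∃ Q₀ Q₁, HasM mem' Q.1 Q₀ ∧ HasM mem' Q.2 Q₁ ∧
        IsPopov t (Q₀.map C + (X : K[X]) • Q₁.map C) ∧
        IsRowBasis (Q₀.map C + (X : K[X]) • Q₁.map C) (approximantModule (R.map C) 1) := by
  classical
  refine ((Triple.const 0 mem).bind fun z m₁ h₁ hz => ?_).le (Nat.zero_add _).le
  refine ((Triple.const 1 m₁).bind fun o m₂ h₂ ho => ?_).le (Nat.zero_add _).le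
  set k := Nat.clog 2 m with hk
  have hz' := hz.mono h₂
  refine (kernelLoop_triple hmul t k (n / 2 ^ k + 1) (mem := m₂)
    (R := fun b => Matrix.of fun i c => if h : (b : ℕ) * 2 ^ k + (Fintype.equivFin (Cols k) c : ℕ) < n then
      R i ⟨_, h⟩ else 0) (M := 1) ?_ ?_ (ReducedKernel.univ t)).bind_pure ?_
  · intro b i c
    simp only [Matrix.of_apply]
    split_ifs
    · exact hF.mono (h₁.trans h₂) _ _
    · exact hz'
  · intro i j
    simp only [Matrix.of_apply, Matrix.one_apply]
    split_ifs
    · exact ho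
    · exact hz'
  · rintro r m₃ h₃ ⟨M, hM, hW⟩
    -- The zero columns that fill the last block impose no condition, and column `j` of `R` is at
    -- position `j % 2 ^ k` of block `j / 2 ^ k`.
    have hset : Set.univ ∩ {v | ∀ b : Fin (n / 2 ^ k + 1), Matrix.vecMul v
        (Matrix.of fun i c => if h : (b : ℕ) * 2 ^ k + (Fintype.equivFin (Cols k) c : ℕ) < n then
          R i ⟨_, h⟩ else 0) = 0} = {v | Matrix.vecMul v R = 0} := by
      rw [Set.univ_inter]
      ext v
      simp only [Set.mem_ofPred_eq]
      constructor
      · intro h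
        funext j
        have hlt : (j : ℕ) % 2 ^ k < Fintype.card (Cols k) := by
          rw [card_cols]
          exact Nat.mod_lt _ (by positivity)
        have := congrFun (h ⟨j / 2 ^ k, Nat.lt_succ_of_le (Nat.div_le_div_right j.2.le)⟩)
          ((Fintype.equivFin (Cols k)).symm ⟨_, hlt⟩)
        simpa [Matrix.vecMul, dotProduct, Nat.div_add_mod'] using this
      · intro h b
        funext c
        by_cases hc : (b : ℕ) * 2 ^ k + (Fintype.equivFin (Cols k) c : ℕ) < n
        · simpa [Matrix.vecMul, dotProduct, hc] using congrFun h ⟨_, hc⟩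
        · simp [Matrix.vecMul, dotProduct, hc]
    rw [hset] at hW
    refine ⟨M, Matrix.diagonal fun i => if i ∈ r.2 then 1 else 0, hM, fun i j => ?_, ?_⟩
    · simp only [Matrix.of_apply, Matrix.diagonal_apply, ite_and]
      split_ifs
      · exact ho.mono h₃
      · exact hz'.mono h₃
      · exact hz'.mono h₃
    · have := hW.isPopov rfl
      convert this

end Elimination

/-! ## Multiplication of polynomial matrices by blocks of coefficients -/

section Blocks

variable {K : Type*} [Field K] {n : ℕ}

/-- Sum of stored polynomials. -/
def addLists : List Reg → List Reg → Prog K (List Reg)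
  | [], g => pure g
  | f, [] => pure f
  | a :: f, b :: g => do
      let c ← Prog.instr (.add a b)
      let r ← addLists f g
      pure (c :: r)

theorem addLists_triple {f g : List Reg} {p q : K[X]} {mem : List K} (hf : HasP mem f p)
    (hg : HasP mem g q) : Triple (addLists f g) mem (min f.length g.length) fun r mem' =>
      HasP mem' r (p + q) ∧ r.length = max f.length g.length := by
  induction f generalizing g p q mem with
  | nil =>
    obtain rfl : p = 0 := hf.2.symm
    unfold addLists
    exact (Triple.pure (by simpa using hg)).le (Nat.zero_le _)
  | cons a f ih =>
    cases g with
    | nil =>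
      obtain rfl : q = 0 := hg.2.symm
      unfold addLists
      exact (Triple.pure (by simpa using hf)).le (Nat.zero_le _)
    | cons b g =>
      obtain ⟨u, p, hu, hp, rfl⟩ := hf.tail
      obtain ⟨v, q, hv, hq, rfl⟩ := hg.tail
      unfold addLists
      refine ((Triple.add hu hv).bind fun c m₁ h₁ hc => (ih (hp.mono h₁) (hq.mono h₁)).bind_pure
        (Q₂ := fun r mem' => HasP mem' r (C u + X * p + (C v + X * q)) ∧
          r.length = max (a :: f).length (b :: g).length)
        fun r m₂ h₂ hr => ⟨?_, ?_⟩).le ?_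
      · have := hasP_cons (hc.mono h₂) hr.1
        convert this using 1
        rw [C_add]
        ring
      · simp [hr.2]
      · simp only [List.length_cons]
        omega

/-- Sum of stored polynomial matrices. -/
def addMat (A B : PMat n) : Prog K (PMat n) :=
  Prog.tabulate n fun i => Prog.tabulate n fun j => addLists (A i j) (B i j)

theorem addMat_triple {A B : PMat n} {P Q : Matrix (Fin n) (Fin n) K[X]} {mem : List K}
    {a b : ℕ} (hA : HasPM mem A P) (hB : HasPM mem B Q) (ha : A.LengthLe a) (hb : B.LengthLe b) :
    Triple (addMat A B) mem (n * (n * a)) fun R mem' =>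
      HasPM mem' R (P + Q) ∧ R.LengthLe (max a b) := by
  refine (Triple.tabulate₂ (c := a) (Q := fun i j r mem' => HasP mem' r ((P + Q) i j) ∧
    r.length ≤ max a b) (fun i j _ _ _ hm h => ⟨h.1.mono hm, h.2⟩) fun i j m₁ h₁ => ?_).mono le_rfl
    fun R m _ hR => ⟨fun i j => (hR i j).1, fun i j => (hR i j).2⟩
  refine (addLists_triple ((hA i j).mono h₁) ((hB i j).mono h₁)).mono
    ((min_le_left _ _).trans (ha i j)) fun r m₂ _ hr => ⟨hr.1, ?_⟩
  rw [hr.2]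
  exact max_le_max (ha i j) (hb i j)

/-- Computation of a linear function of `A`, by cutting `A` into `b` blocks of `κ` coefficients. -/
def linearByBlocks (κ : ℕ) (f : PMat n → Prog K (PMat n)) : ℕ → PMat n → Prog K (PMat n)
  | 0, _ => pure (Matrix.of fun _ _ => [])
  | b + 1, A => do
      let z ← Prog.instr (.const 0)
      let c ← f (Matrix.of fun i j => padTo z κ ((A i j).take κ))
      let r ← linearByBlocks κ f b (Matrix.of fun i j => (A i j).drop κ)
      addMat c (Matrix.of fun i j => List.replicate κ z ++ r i j)

/-- `P = P₀ + X ^ κ P₁` gives `φ P = φ P₀ + X ^ κ φ P₁`. Adding lists costs the shorter length, so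
each addition is bounded by the length `ℓ` of one image, and the total is linear in the number of
blocks. -/
theorem linearByBlocks_triple {κ c ℓ : ℕ} {f : PMat n → Prog K (PMat n)}
    (φ : Matrix (Fin n) (Fin n) K[X] →ₗ[K[X]] Matrix (Fin n) (Fin n) K[X]) (b : ℕ) {A : PMat n}
    {P : Matrix (Fin n) (Fin n) K[X]} {mem : List K} (hA : HasPM mem A P)
    (hlen : A.LengthLe (b * κ))
    (hf : ∀ (mem' : List K), mem <+: mem' → ∀ A P, HasPM mem' A P →
      (∀ i j, (A i j).length = κ) →
      Triple (f A) mem' c fun R mem'' => HasPM mem'' R (φ P) ∧ R.LengthLe ℓ) :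
    Triple (linearByBlocks κ f b A) mem (b * (c + n * (n * ℓ))) fun R mem' =>
      HasPM mem' R (φ P) ∧ R.LengthLe (b * κ + ℓ) := by
  induction b generalizing A P mem with
  | zero =>
    have hP : P = 0 := by
      refine Matrix.ext fun i j => ?_
      have h0 : A i j = [] := List.length_eq_zero_iff.1 (by have := hlen i j; omega)
      have := hA i j
      rw [h0] at this
      exact this.2.symm
    refine (Triple.pure ⟨fun i j => ?_, fun i j => by simp⟩).le (Nat.zero_le _)
    rw [hP, map_zero]
    exact hasP_nil _
  | succ b ih =>
    choose P₀ P₁ h₀ h₁ hP using fun i j => (hA i j).split κ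
    have hPe : P = Matrix.of P₀ + (X ^ κ : K[X]) • Matrix.of P₁ := by
      exact Matrix.ext hP
    have hcost : 0 + (c + (b * (c + n * (n * ℓ)) + n * (n * ℓ))) ≤
        (b + 1) * (c + n * (n * ℓ)) := by
      rw [Nat.succ_mul]
      omega
    refine ((Triple.const 0 mem).bind fun z m₁ hm₁ hz => ?_).le hcost
    refine (hf m₁ hm₁ _ (Matrix.of P₀) (fun i j => ((h₀ i j).mono hm₁).padTo hz κ)
      fun i j => length_padTo (List.length_take_le _ _)).bind fun C m₂ hm₂ hC => ?_
    refine (ih (P := Matrix.of P₁) (fun i j => (h₁ i j).mono (hm₁.trans hm₂)) (fun i j => ?_)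
      fun m' hm' => hf m' (hm₁.trans (hm₂.trans hm'))).bind fun r m₃ hm₃ hr => ?_
    · have := hlen i j
      rw [Nat.succ_mul] at this
      simp only [List.length_drop]
      omega
    · refine (addMat_triple (Q := (X ^ κ : K[X]) • φ (Matrix.of P₁)) (b := κ + (b * κ + ℓ))
        (fun i j => (hC.1 i j).mono hm₃) (fun i j => ?_) hC.2 fun i j => ?_).mono le_rfl ?_
      · have := (hasP_replicate ((hz.mono hm₂).mono hm₃) κ).append (hr.1 i j)
        simpa using this
      · have := hr.2 i j
        simp only [Matrix.of_apply, List.length_append, List.length_replicate]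
        omega
      · intro R m₄ _ hR
        rw [hPe, map_add, map_smul]
        refine ⟨hR.1, fun i j => (hR.2 i j).trans ?_⟩
        rw [Nat.succ_mul]
        omega

/-- The programs `mul k` multiply matrices of degree at most `k` in `F k` operations. -/
def IsPolyMul (mul : ℕ → PMat n → PMat n → Prog K (PMat n)) (F : ℕ → ℕ) : Prop :=
  ∀ (k : ℕ) (A B : PMat n) (P Q : Matrix (Fin n) (Fin n) K[X]) (mem : List K), HasPM mem A P →
    HasPM mem B Q → (∀ i j, (A i j).length = k + 1) → (∀ i j, (B i j).length = k + 1) →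
    Triple (mul k A B) mem (F k) fun R mem' => HasPM mem' R (P * Q)

/-- The largest number of coefficients of an entry. -/
def PMat.maxLength (A : PMat n) : ℕ := Finset.univ.sup fun i => Finset.univ.sup fun j =>
  (A i j).length

theorem PMat.lengthLe_maxLength (A : PMat n) : A.LengthLe A.maxLength := fun i j =>
  (Finset.le_sup (f := fun j => (A i j).length) (Finset.mem_univ j)).trans
    (Finset.le_sup (f := fun i => Finset.univ.sup fun j => (A i j).length) (Finset.mem_univ i))

theorem PMat.maxLength_le {A : PMat n} {ℓ : ℕ} (h : A.LengthLe ℓ) : A.maxLength ≤ ℓ :=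
  Finset.sup_le fun i _ => Finset.sup_le fun j _ => h i j

/-- The degree of the blocks used to multiply matrices with `ℓ` coefficients. -/
def blockDegree (b ℓ : ℕ) : ℕ := max 1 (ℓ / b)

/-- Multiplication of polynomial matrices cut into `b` blocks of coefficients. -/
def mulBlocks (mul : ℕ → PMat n → PMat n → Prog K (PMat n)) (b : ℕ) (A B : PMat n) :
    Prog K (PMat n) := do
  let k := blockDegree b (max A.maxLength B.maxLength)
  let R ← linearByBlocks (k + 1) (fun A' => linearByBlocks (k + 1) (fun B' => do
    let R ← mul k A' B'
    pure (Matrix.of fun i j => (R i j).take (2 * (k + 1)))) b B) b A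
  pure (Matrix.of fun i j => (R i j).take (A.maxLength + B.maxLength - 1))

/-- Cost of the multiplication by blocks of matrices with at most `ℓ` coefficients. -/
def mulBlocksCost (n b : ℕ) (F : ℕ → ℕ) (ℓ : ℕ) : ℕ :=
  let k := blockDegree b ℓ
  b * (b * (F k + n * (n * (2 * (k + 1)))) + n * (n * (b * (k + 1) + 2 * (k + 1))))

/-- Multiplication programs may return lists with superfluous zeros on top; this bound justifies
truncating them. In the case `a = b = 0`, where the subtraction is truncated, the product is zero.
-/
theorem degree_mul_apply_lt {P Q : Matrix (Fin n) (Fin n) K[X]} {a b : ℕ}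
    (hP : ∀ i j, (P i j).degree < a) (hQ : ∀ i j, (Q i j).degree < b) (i j : Fin n) :
    ((P * Q) i j).degree < (a + b - 1 : ℕ) := by
  rw [Matrix.mul_apply, ← mem_degreeLT]
  refine Submodule.sum_mem _ fun l _ => ?_
  rw [mem_degreeLT]
  have h1 := hP i l
  have h2 := hQ l j
  by_cases hp : P i l = 0
  · simp only [hp, zero_mul, degree_zero]
    exact WithBot.bot_lt_coe _
  by_cases hq : Q l j = 0
  · simp only [hq, mul_zero, degree_zero]
    exact WithBot.bot_lt_coe _
  rw [degree_mul]
  rw [degree_eq_natDegree hp] at h1 ⊢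
  rw [degree_eq_natDegree hq] at h2 ⊢
  norm_cast at *
  omega

/-- The product is linear in `A`, and for each block of `A` linear in `B`, whence two nested uses of
`linearByBlocks_triple` and `b ^ 2` products of blocks. The purpose is to multiply long polynomials
at the price of a smaller degree, up to a constant, since no upper bound on the growth of the cost
is available. -/
theorem mulBlocks_triple {mul : ℕ → PMat n → PMat n → Prog K (PMat n)} {F : ℕ → ℕ}
    (hmul : IsPolyMul mul F) {b : ℕ} (hb : 1 ≤ b) {A B : PMat n}
    {P Q : Matrix (Fin n) (Fin n) K[X]} {mem : List K} (hA : HasPM mem A P)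
    (hB : HasPM mem B Q) :
    Triple (mulBlocks mul b A B) mem (mulBlocksCost n b F (max A.maxLength B.maxLength))
      fun R mem' => HasPM mem' R (P * Q) ∧ R.LengthLe (A.maxLength + B.maxLength - 1) := by
  -- The blocks cover all coefficients because `ℓ < b (⌊ℓ / b⌋ + 1)`.
  have hlen : ∀ ℓ, ℓ ≤ b * (blockDegree b ℓ + 1) := by
    intro ℓ
    have h1 := Nat.lt_mul_div_succ ℓ (show 0 < b by omega)
    have h2 : b * (ℓ / b + 1) ≤ b * (blockDegree b ℓ + 1) :=
      Nat.mul_le_mul_left _ (Nat.succ_le_succ (le_max_right _ _))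
    omega
  have hlt : ∀ {A : PMat n} {P : Matrix (Fin n) (Fin n) K[X]} {ℓ : ℕ} {mem : List K},
      HasPM mem A P → A.LengthLe ℓ → ∀ i j, (P i j).degree < ℓ := fun hA hℓ i j =>
    (hA i j).degree_lt.trans_le (by exact_mod_cast hℓ i j)
  set ℓ := max A.maxLength B.maxLength with hℓ
  set k := blockDegree b ℓ with hk
  refine (linearByBlocks_triple (LinearMap.mulRight K[X] Q) b hA
    (fun i j => (A.lengthLe_maxLength i j).trans ((le_max_left _ _).trans (hlen ℓ)))
    (c := b * (F k + n * (n * (2 * (k + 1))))) (ℓ := b * (k + 1) + 2 * (k + 1))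
    fun m₁ h₁ A' P' hA' hlA' => ?_).bind_pure fun R m h hR => ?_
  · refine linearByBlocks_triple (LinearMap.mulLeft K[X] P') b (hB.mono h₁)
      (fun i j => (B.lengthLe_maxLength i j).trans ((le_max_right _ _).trans (hlen ℓ)))
      fun m₂ h₂ B' Q' hB' hlB' => ?_
    refine (hmul k A' B' P' Q' m₂ (hA'.mono h₂) hB' hlA' hlB').bind_pure fun R m₃ _ hR =>
      ⟨fun i j => ?_, fun i j => List.length_take_le _ _⟩
    refine (hR i j).take ((degree_mul_apply_lt (hlt hA' fun i j => (hlA' i j).le)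
      (hlt hB' fun i j => (hlB' i j).le) i j).trans_le ?_)
    exact_mod_cast (show k + 1 + (k + 1) - 1 ≤ 2 * (k + 1) by omega)
  · refine ⟨fun i j => ?_, fun i j => List.length_take_le _ _⟩
    exact (hR.1 i j).take (degree_mul_apply_lt (hlt hA A.lengthLe_maxLength)
      (hlt hB B.lengthLe_maxLength) i j)

/-- The programs `mul k` multiply polynomials of degree at most `k` in `F k` operations. -/
def IsListMul (mul : ℕ → List Reg → List Reg → Prog K (List Reg)) (F : ℕ → ℕ) : Prop :=
  ∀ (k : ℕ) (f g : List Reg) (p q : K[X]) (mem : List K), HasP mem f p → HasP mem g q →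
    f.length = k + 1 → g.length = k + 1 →
    Triple (mul k f g) mem (F k) fun r mem' => HasP mem' r (p * q)

/-- Multiplication of polynomials cut into `b` blocks of coefficients. -/
def mulLists (mul : ℕ → List Reg → List Reg → Prog K (List Reg)) (b : ℕ) (f g : List Reg) :
    Prog K (List Reg) := do
  let R ← mulBlocks (n := 1) (fun k A B => do
    let r ← mul k (A 0 0) (B 0 0)
    pure (Matrix.of fun _ _ => r)) b (Matrix.of fun _ _ => f) (Matrix.of fun _ _ => g)
  pure (R 0 0)

theorem mulLists_triple {mul : ℕ → List Reg → List Reg → Prog K (List Reg)} {F : ℕ → ℕ}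
    (hmul : IsListMul mul F) {b : ℕ} (hb : 1 ≤ b) {f g : List Reg} {p q : K[X]} {mem : List K}
    (hf : HasP mem f p) (hg : HasP mem g q) :
    Triple (mulLists mul b f g) mem (mulBlocksCost 1 b F (max f.length g.length))
      fun r mem' => HasP mem' r (p * q) ∧ r.length ≤ f.length + g.length - 1 := by
  have hmul' : IsPolyMul (n := 1) (K := K) (fun k A B => do
      let r ← mul k (A 0 0) (B 0 0)
      pure (Matrix.of fun _ _ => r)) F := by
    intro k A B P Q mem hA hB hA' hB'
    refine (hmul k _ _ _ _ mem (hA 0 0) (hB 0 0) (hA' 0 0) (hB' 0 0)).bind_pure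
      fun r m _ hr i j => ?_
    rw [Subsingleton.elim i 0, Subsingleton.elim j 0]
    simpa [Matrix.mul_apply] using hr
  have hmax : ∀ f : List Reg, PMat.maxLength (n := 1) (Matrix.of fun _ _ => f) = f.length := by
    intro f
    simp [PMat.maxLength]
  have := mulBlocks_triple hmul' hb (A := Matrix.of fun _ _ => f) (B := Matrix.of fun _ _ => g)
    (P := Matrix.of fun _ _ => p) (Q := Matrix.of fun _ _ => q) (mem := mem)
    (fun _ _ => hf) fun _ _ => hg
  rw [hmax, hmax] at this
  refine this.bind_pure fun R m _ hR => ⟨?_, hR.2 0 0⟩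
  have := hR.1 0 0
  simpa [Matrix.mul_apply] using this

end Blocks

/-! ## Evaluation at points in geometric progression -/

section Lists

variable {K : Type*} [Field K]

/-- The list `l` of addresses refers to the first terms of the sequence `v`. -/
def HasL (mem : List K) (l : List Reg) (v : ℕ → K) : Prop :=
  ∀ i (hi : i < l.length), Has mem l[i] (v i)

omit [Field K] in
theorem HasL.mono {mem mem' : List K} {l : List Reg} {v : ℕ → K} (h : HasL mem l v)
    (hm : mem <+: mem') : HasL mem' l v := fun i hi => (h i hi).mono hm

theorem HasP.hasL {mem : List K} {l : List Reg} {p : K[X]} (h : HasP mem l p) :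
    HasL mem l p.coeff := fun _ hi => h.has hi

omit [Field K] in
theorem hasL_cons {mem : List K} {a : Reg} {l : List Reg} {v : ℕ → K} (ha : Has mem a (v 0))
    (hl : HasL mem l fun i => v (i + 1)) : HasL mem (a :: l) v := by
  intro i hi
  cases i with
  | zero => exact ha
  | succ i => exact hl i (by simpa using hi)

omit [Field K] in
theorem HasL.head {mem : List K} {a : Reg} {l : List Reg} {v : ℕ → K} (h : HasL mem (a :: l) v) :
    Has mem a (v 0) := h 0 (by simp)

omit [Field K] in
theorem HasL.tail {mem : List K} {a : Reg} {l : List Reg} {v : ℕ → K} (h : HasL mem (a :: l) v) :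
    HasL mem l fun i => v (i + 1) := fun i hi => h (i + 1) (by simpa using hi)

omit [Field K] in
theorem HasL.reverse {mem : List K} {l : List Reg} {v : ℕ → K} (h : HasL mem l v) :
    HasL mem l.reverse fun i => v (l.length - 1 - i) := by
  intro i hi
  rw [List.getElem_reverse]
  exact h _ _

/-- The polynomial with coefficients `v 0`, ..., `v (n - 1)`. -/
noncomputable def polyOfSeq (v : ℕ → K) (n : ℕ) : K[X] := ∑ i ∈ Finset.range n, C (v i) * X ^ i

theorem polyOfSeq_coeff (v : ℕ → K) (n i : ℕ) :
    (polyOfSeq v n).coeff i = if i < n then v i else 0 := by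
  simp [polyOfSeq, finsetSum_coeff, coeff_C_mul, coeff_X_pow]

theorem HasL.hasP {mem : List K} {l : List Reg} {v : ℕ → K} (h : HasL mem l v) :
    HasP mem l (polyOfSeq v l.length) :=
  hasP_of_coeff (fun i hi => by rw [polyOfSeq_coeff, if_pos hi]; exact h i hi)
    fun i hi => by rw [polyOfSeq_coeff, if_neg (not_lt.2 hi)]

theorem HasP.getD {mem : List K} {l : List Reg} {p : K[X]} {z : Reg} (h : HasP mem l p)
    (hz : Has mem z 0) (i : ℕ) : Has mem (l.getD i z) (p.coeff i) := by
  by_cases hi : i < l.length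
  · simpa [hi] using h.has hi
  · rw [h.coeff_eq_zero (not_lt.1 hi)]
    simpa [hi] using hz

omit [Field K] in
theorem HasL.getD {mem : List K} {l : List Reg} {v : ℕ → K} {z : Reg} (h : HasL mem l v)
    {i : ℕ} (hi : i < l.length) : Has mem (l.getD i z) (v i) := by
  simpa [hi] using h i hi

/-- The coefficients number `o`, ..., `o + n - 1`. -/
def window (z : Reg) (o n : ℕ) (l : List Reg) : List Reg :=
  (List.range n).map fun i => l.getD (o + i) z

theorem length_window (z : Reg) (o n : ℕ) (l : List Reg) : (window z o n l).length = n := by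
  simp [window]

theorem HasP.window {mem : List K} {l : List Reg} {p : K[X]} {z : Reg} (h : HasP mem l p)
    (hz : Has mem z 0) (o n : ℕ) : HasL mem (window z o n l) fun i => p.coeff (o + i) := by
  intro i hi
  simp only [PolyMat.window, List.getElem_map, List.getElem_range]
  exact h.getD hz _

/-- Horner's rule. -/
def hornerProg : List Reg → Reg → Prog K Reg
  | [], _ => Prog.instr (.const 0)
  | a :: l, x => do
      let r ← hornerProg l x
      let u ← Prog.instr (.mul x r)
      Prog.instr (.add a u)

theorem hornerProg_triple {l : List Reg} {p : K[X]} {x : Reg} {v : K} {mem : List K}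
    (hl : HasP mem l p) (hx : Has mem x v) :
    Triple (hornerProg l x) mem (2 * l.length) fun r mem' => Has mem' r (p.eval v) := by
  induction l generalizing p with
  | nil =>
    obtain rfl : p = 0 := hl.2.symm
    rw [eval_zero]
    exact Triple.const (0 : K) mem
  | cons a l ih =>
    obtain ⟨u, p, hu, hp, rfl⟩ := hl.tail
    refine ((ih hp).bind fun r m₁ h₁ hr => (Triple.mul (hx.mono h₁) hr).bind
      fun y m₂ h₂ hy => ((Triple.add (hu.mono (h₁.trans h₂)) hy))).mono
      (by rw [List.length_cons]; omega) fun w m _ hw => ?_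
    simpa using hw

/-- Product of sequences. -/
def mulPointwise : List Reg → List Reg → Prog K (List Reg)
  | [], _ => pure []
  | _, [] => pure []
  | a :: f, b :: g => do
      let c ← Prog.instr (.mul a b)
      let r ← mulPointwise f g
      pure (c :: r)

theorem mulPointwise_triple {f g : List Reg} {u v : ℕ → K} {mem : List K} (hf : HasL mem f u)
    (hg : HasL mem g v) (hlen : f.length = g.length) :
    Triple (mulPointwise f g) mem f.length fun r mem' =>
      HasL mem' r (fun i => u i * v i) ∧ r.length = f.length := by
  induction f generalizing g u v mem with
  | nil =>
    unfold mulPointwise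
    exact Triple.pure ⟨fun i hi => absurd hi (by simp), rfl⟩
  | cons a f ih =>
    cases g with
    | nil => simp at hlen
    | cons b g =>
      unfold mulPointwise
      refine ((Triple.mul hf.head hg.head).bind fun c m₁ h₁ hc =>
        (ih (hf.tail.mono h₁) (hg.tail.mono h₁) (by simpa using hlen)).bind_pure
          (Q₂ := fun r mem' => HasL mem' r (fun i => u i * v i) ∧ r.length = (a :: f).length)
          fun r m₂ h₂ hr => ⟨?_, by simp [hr.2]⟩).le (by rw [List.length_cons]; omega)
      exact hasL_cons (hc.mono h₂) hr.1

/-- The first terms of a sequence `v, v w, v w² q, v w³ q³, ...` of quadratic exponents. -/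
def quadSeq : ℕ → Reg → Reg → Reg → Prog K (List Reg)
  | 0, _, _, _ => pure []
  | n + 1, v, w, q => do
      let v' ← Prog.instr (.mul v w)
      let w' ← Prog.instr (.mul w q)
      let r ← quadSeq n v' w' q
      pure (v :: r)

theorem quadSeq_triple (n : ℕ) {v w q : Reg} {a b c : K} {mem : List K} (hv : Has mem v a)
    (hw : Has mem w b) (hq : Has mem q c) :
    Triple (quadSeq n v w q) mem (2 * n) fun r mem' =>
      HasL mem' r (fun i => a * b ^ i * c ^ (i.choose 2)) ∧ r.length = n := by
  induction n generalizing v w a b mem with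
  | zero => exact Triple.pure ⟨fun i hi => absurd hi (by simp), rfl⟩
  | succ n ih =>
    refine ((Triple.mul hv hw).bind fun v' m₁ h₁ hv' =>
      (Triple.mul (hw.mono h₁) (hq.mono h₁)).bind fun w' m₂ h₂ hw' =>
      (ih (hv'.mono h₂) hw' (hq.mono (h₁.trans h₂))).bind_pure
        (Q₂ := fun r mem' => HasL mem' r (fun i => a * b ^ i * c ^ (i.choose 2)) ∧
          r.length = n + 1) fun r m₃ h₃ hr => ⟨hasL_cons ?_ ?_, by simp [hr.2]⟩).le (by omega)
    · simpa using hv.mono (h₁.trans (h₂.trans h₃))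
    -- The tail starts at `a b` with ratio `b c`, in accordance with `(i + 1).choose 2 = i +
    -- i.choose 2`.
    · convert hr.1 using 2 with i
      rw [Nat.choose_succ_succ' i 1, Nat.choose_one_right]
      ring

/-- Multiplication of polynomials with at most `N ≤ L` coefficients in `κ N` operations. -/
def IsLinearMul (pm : List Reg → List Reg → Prog K (List Reg)) (κ L : ℕ) : Prop :=
  ∀ (N : ℕ) (f g : List Reg) (p q : K[X]) (mem : List K), 1 ≤ N → N ≤ L → HasP mem f p →
    HasP mem g q → f.length ≤ N → g.length ≤ N →
    Triple (pm f g) mem (κ * N) fun r mem' => HasP mem' r (p * q) ∧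
      r.length ≤ f.length + g.length - 1

/-- Evaluation at `a`, `a q`, ..., `a q ^ (k - 1)`, by one product of polynomials. -/
def bluestein (pm : List Reg → List Reg → Prog K (List Reg)) (k : ℕ) (f : List Reg) (a q : Reg) :
    Prog K (Fin k → Reg) := do
  let z ← Prog.instr (.const 0)
  let o ← Prog.instr (.const 1)
  let q' ← Prog.instr (.div o q)
  let u ← quadSeq f.length o a q'
  let w ← quadSeq (f.length + k) o o q
  let v ← quadSeq k o o q'
  let c ← mulPointwise f u
  let r ← pm c.reverse w
  Prog.tabulate k fun i => Prog.instr (.mul (r.getD (f.length - 1 + i) z) (v.getD i z))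

/-- Writing `i j` through binomial coefficients turns a sum with weights `q ^ (i j)` into a product
of polynomials; half squares would require a square root of `q`. -/
theorem choose_two_add (i j : ℕ) : (i + j).choose 2 = i.choose 2 + j.choose 2 + i * j := by
  induction j with
  | zero => simp
  | succ j ih =>
    rw [← add_assoc, Nat.choose_succ_succ' (i + j) 1, Nat.choose_succ_succ' j 1, ih,
      Nat.choose_one_right, Nat.choose_one_right]
    ring

/-- With `c i = i.choose 2`, `p(a q ^ i)` is `q ^ (-c i)` times the sum over `j` of `p_j a ^ j q ^
(-c j) q ^ c (i + j)`. Reversing the factor that depends on `j` alone makes this sum the coefficient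
of degree `L - 1 + i` of a product. -/
theorem sum_coeff_mul_quadratic {p : K[X]} {L k i : ℕ} (hp : p.degree < L) (hi : i < k) {a q : K}
    (hq : q ≠ 0) :
    (polyOfSeq (fun j => p.coeff (L - 1 - j) *
        (1 * a ^ (L - 1 - j) * (1 / q) ^ ((L - 1 - j).choose 2))) L *
      polyOfSeq (fun j => 1 * 1 ^ j * q ^ (j.choose 2)) (L + k)).coeff (L - 1 + i) *
      (1 * 1 ^ i * (1 / q) ^ (i.choose 2)) = p.eval (a * q ^ i) := by
  rcases Nat.eq_zero_or_pos L with rfl | hL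
  · obtain rfl : p = 0 := by
      rw [← degree_eq_bot]
      exact Nat.WithBot.lt_zero_iff.1 hp
    simp [polyOfSeq]
  have hsum : (polyOfSeq (fun j => p.coeff (L - 1 - j) *
        (1 * a ^ (L - 1 - j) * (1 / q) ^ ((L - 1 - j).choose 2))) L *
      polyOfSeq (fun j => 1 * 1 ^ j * q ^ (j.choose 2)) (L + k)).coeff (L - 1 + i) =
      ∑ j ∈ Finset.range L, p.coeff j * (a ^ j * (1 / q) ^ (j.choose 2)) *
        q ^ ((i + j).choose 2) := by
    rw [coeff_mul, Finset.Nat.sum_antidiagonal_eq_sum_range_succ_mk]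
    rw [← Finset.sum_range_reflect (fun j => p.coeff j * (a ^ j * (1 / q) ^ (j.choose 2)) *
        q ^ ((i + j).choose 2))]
    symm
    refine (Finset.sum_congr rfl fun x hx => ?_).trans
      (Finset.sum_subset (s₁ := Finset.range L) (fun x hx => ?_) fun x _ hx => ?_)
    · rw [Finset.mem_range] at hx
      simp only [polyOfSeq_coeff]
      rw [if_pos hx, if_pos (by omega), show L - 1 + i - x = i + (L - 1 - x) by omega, one_mul,
        one_pow, one_mul, one_mul]
    · rw [Finset.mem_range] at *
      omega
    · rw [Finset.mem_range] at hx
      simp [polyOfSeq_coeff, hx]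
  have hdeg : p.natDegree < L := by
    by_cases h0 : p = 0
    · simpa [h0] using hL
    · exact (natDegree_lt_iff_degree_lt h0).2 hp
  rw [hsum, Finset.sum_mul, eval_eq_sum_range' hdeg]
  refine Finset.sum_congr rfl fun j _ => ?_
  rw [choose_two_add, pow_add, pow_add, mul_pow, ← pow_mul]
  simp only [one_div, inv_pow, one_pow]
  field_simp

theorem bluestein_triple {pm : List Reg → List Reg → Prog K (List Reg)} {κ L : ℕ}
    (hpm : IsLinearMul pm κ L) {k : ℕ} {f : List Reg} {p : K[X]} {a q : Reg} {x y : K}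
    {mem : List K} (hL : f.length + k ≤ L) (hk : 1 ≤ k) (hf : HasP mem f p) (ha : Has mem a x)
    (hq : Has mem q y) (hy : y ≠ 0) :
    Triple (bluestein pm k f a q) mem ((κ + 8) * (f.length + k)) fun r mem' =>
      ∀ i : Fin k, Has mem' (r i) (p.eval (x * y ^ (i : ℕ))) := by
  have hcost : 0 + (0 + (1 + (2 * f.length + (2 * (f.length + k) + (2 * k + (f.length +
      (κ * (f.length + k) + k * 1))))))) ≤ (κ + 8) * (f.length + k) := by
    rw [add_mul]
    omega
  refine ((Triple.const 0 mem).bind fun z m₁ h₁ hz => ?_).le hcost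
  refine (Triple.const 1 m₁).bind fun o m₂ h₂ ho => ?_
  have h₁₂ := h₁.trans h₂
  refine (Triple.div ho (hq.mono h₁₂)).bind fun q' m₃ h₃ hq' => ?_
  have h₁₃ := h₁₂.trans h₃
  refine (quadSeq_triple f.length (ho.mono h₃) (ha.mono h₁₃) hq').bind fun u m₄ h₄ hu => ?_
  have h₁₄ := h₁₃.trans h₄
  have ho₄ := ho.mono (h₃.trans h₄)
  refine (quadSeq_triple (f.length + k) ho₄ ho₄ (hq.mono h₁₄)).bind fun w m₅ h₅ hw => ?_
  have ho₅ := ho₄.mono h₅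
  refine (quadSeq_triple k ho₅ ho₅ (hq'.mono (h₄.trans h₅))).bind fun v m₆ h₆ hv => ?_
  have h₁₆ := h₁₄.trans (h₅.trans h₆)
  refine (mulPointwise_triple (hf.hasL.mono h₁₆) (hu.1.mono (h₅.trans h₆)) hu.2.symm).bind
    fun c m₇ h₇ hc => ?_
  refine (hpm (f.length + k) _ _ _ _ m₇ (by omega) hL hc.1.reverse.hasP
    (hw.1.hasP.mono (h₆.trans h₇)) (by simp [hc.2]) hw.2.le).bind fun r m₈ h₈ hr => ?_
  refine Triple.tabulate (Q := fun i r mem' => Has mem' r (p.eval (x * y ^ (i : ℕ))))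
    (fun i => stable_has _) fun i m₉ h₉ => ?_
  have hr' := (hr.1.getD (hz.mono (h₂.trans (h₃.trans (h₄.trans (h₅.trans (h₆.trans
    (h₇.trans h₈))))))) (f.length - 1 + i)).mono h₉
  have hv' := (hv.1.getD (z := z) (i := i) (by omega)).mono (h₇.trans (h₈.trans h₉))
  have := Triple.mul hr' hv'
  rw [List.length_reverse, hc.2, hw.2, sum_coeff_mul_quadratic hf.degree_lt i.2 hy] at this
  exact this

end Lists

/-! ## Evaluation at arbitrary points -/

section Multipoint

variable {K : Type*} [Field K]

/-- Opposite of a stored polynomial. -/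
def negLists : List Reg → Reg → Prog K (List Reg)
  | [], _ => pure []
  | a :: f, z => do
      let c ← Prog.instr (.sub z a)
      let r ← negLists f z
      pure (c :: r)

theorem negLists_triple {f : List Reg} {p : K[X]} {z : Reg} {mem : List K} (hf : HasP mem f p)
    (hz : Has mem z 0) : Triple (negLists f z) mem f.length fun r mem' =>
      HasP mem' r (-p) ∧ r.length = f.length := by
  induction f generalizing p mem with
  | nil =>
    obtain rfl : p = 0 := hf.2.symm
    exact Triple.pure ⟨by simpa using hasP_nil mem, rfl⟩
  | cons a f ih =>
    obtain ⟨u, p, hu, hp, rfl⟩ := hf.tail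
    refine ((Triple.sub hz hu).bind fun c m₁ h₁ hc => (ih (hp.mono h₁) (hz.mono h₁)).bind_pure
      (Q₂ := fun r mem' => HasP mem' r (-(C u + X * p)) ∧ r.length = (a :: f).length)
      fun r m₂ h₂ hr => ⟨?_, by simp [hr.2]⟩).le (by rw [List.length_cons]; omega)
    have := hasP_cons (hc.mono h₂) hr.1
    convert this using 1
    rw [zero_sub, C_neg]
    ring

/-- Inverse of a power series with constant term 1, up to precision `2 ^ s`, by Newton iteration. -/
def invSeries (pm : List Reg → List Reg → Prog K (List Reg)) (g : List Reg) :
    ℕ → Prog K (List Reg)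
  | 0 => do
      let o ← Prog.instr (.const 1)
      pure [o]
  | s + 1 => do
      let h ← invSeries pm g s
      let p ← pm (g.take (2 ^ (s + 1))) h
      let z ← Prog.instr (.const 0)
      let two ← Prog.instr (.const 2)
      let e ← negLists (p.take (2 ^ (s + 1))) z
      let e' ← addLists [two] e
      let r ← pm h e'
      pure (r.take (2 ^ (s + 1)))

/-- If `G H = 1 + x a`, then `G H (2 - G H) = 1 - x² a²`: the precision doubles. `G₀`, `P₀`, `H'`
are the truncations modulo `x²` made by the program, and `G₁`, `P₁`, `H₁` account for the discarded
parts. -/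
theorem newton_step {R : Type*} [CommRing R] {x G G₀ G₁ H P₀ P₁ H' H₁ a : R}
    (ha : G * H - 1 = x * a) (hG : G = G₀ + x * x * G₁) (hP : G₀ * H = P₀ + x * x * P₁)
    (hH : H * (2 + -P₀) = H' + x * x * H₁) :
    G * H' - 1 = x * x * (G * H * (G₁ * H + P₁) - G * H₁ - a ^ 2) := by
  have h1 : P₀ = G * H - x * x * (G₁ * H + P₁) := by
    linear_combination (-1 : R) * hP - H * hG
  have h2 : H' = H * (2 + -P₀) - x * x * H₁ := by linear_combination (-1 : R) * hH
  rw [h2, h1]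
  linear_combination (-(G * H - 1) - x * a) * ha

/-- The costs of the iterations grow geometrically, so the total is linear in the final precision.
-/
theorem invSeries_triple {pm : List Reg → List Reg → Prog K (List Reg)} {κ L : ℕ}
    (hpm : IsLinearMul pm κ L) {g : List Reg} {G : K[X]} {mem : List K} (hg : HasP mem g G)
    (hG : G.coeff 0 = 1) (s : ℕ) (hs : 2 ^ s ≤ L) :
    Triple (invSeries pm g s) mem ((4 * κ + 4) * 2 ^ s) fun r mem' => ∃ H, HasP mem' r H ∧
      r.length ≤ 2 ^ s ∧ (X : K[X]) ^ 2 ^ s ∣ G * H - 1 := by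
  induction s with
  | zero =>
    refine ((Triple.const 1 mem).bind_pure fun o m₁ h₁ ho => ⟨1, ?_, by simp, ?_⟩).le
      (Nat.zero_le _)
    · simpa using hasP_cons ho (hasP_nil m₁)
    · rw [pow_zero, pow_one, mul_one, X_dvd_iff, coeff_sub, hG]
      simp
  | succ s ih =>
    have hpow : 2 ^ (s + 1) = 2 ^ s + 2 ^ s := by rw [pow_succ]; omega
    have hpos : 1 ≤ 2 ^ s := Nat.one_le_two_pow
    have hcost : (4 * κ + 4) * 2 ^ s + (κ * 2 ^ (s + 1) + (0 + (0 + (2 ^ (s + 1) + (1 +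
        κ * 2 ^ (s + 1)))))) ≤ (4 * κ + 4) * 2 ^ (s + 1) := by
      rw [hpow]
      ring_nf
      omega
    refine ((ih (by omega)).bind fun h m₁ h₁ hh => ?_).le hcost
    obtain ⟨H, hH, hlen, a, ha⟩ := hh
    obtain ⟨G₀, G₁, hG₀, -, hGe⟩ := (hg.mono h₁).split (2 ^ (s + 1))
    refine (hpm (2 ^ (s + 1)) _ _ _ _ m₁ (by omega) hs hG₀ hH (List.length_take_le _ _)
      (by omega)).bind fun p m₂ h₂ hp => ?_
    obtain ⟨P₀, P₁, hP₀, -, hPe⟩ := hp.1.split (2 ^ (s + 1))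
    refine (Triple.const 0 m₂).bind fun z m₃ h₃ hz => ?_
    refine (Triple.const 2 m₃).bind fun two m₄ h₄ htwo => ?_
    refine ((negLists_triple (hP₀.mono (h₃.trans h₄)) (hz.mono h₄)).le
      (List.length_take_le _ _)).bind fun e m₅ h₅ he => ?_
    refine ((addLists_triple (hasP_cons (htwo.mono h₅) (hasP_nil _)) he.1).le
      (min_le_left _ _)).bind fun e' m₆ h₆ he' => ?_
    have hle : e'.length ≤ 2 ^ (s + 1) := by
      rw [he'.2, he.2]
      exact max_le (by simp; omega) (List.length_take_le _ _)
    refine (hpm (2 ^ (s + 1)) _ _ _ _ m₆ (by omega) hs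
      (hH.mono (h₂.trans (h₃.trans (h₄.trans (h₅.trans h₆))))) he'.1 (by omega) hle).bind_pure
      fun r m₇ h₇ hr => ?_
    obtain ⟨H', H₁, hH', -, hHe⟩ := hr.1.split (2 ^ (s + 1))
    refine ⟨H', hH', List.length_take_le _ _, ?_⟩
    have hX : (X : K[X]) ^ 2 ^ (s + 1) = X ^ 2 ^ s * X ^ 2 ^ s := by rw [← pow_add, hpow]
    rw [hX] at hGe hPe hHe ⊢
    refine ⟨_, newton_step ha hGe hPe (H₁ := H₁) ?_⟩
    rw [← hHe, map_ofNat, mul_zero, add_zero]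

/-- Binary trees of stored polynomials. -/
def STree : ℕ → Type
  | 0 => List Reg
  | s + 1 => List Reg × STree s × STree s

/-- The polynomial at the root. -/
def STree.root : (s : ℕ) → STree s → List Reg
  | 0, g => g
  | _ + 1, g => g.1

/-- The product of `1 - x i * X` for `i < 2 ^ s`. -/
noncomputable def prodPoly (s : ℕ) (x : ℕ → K) : K[X] :=
  ∏ i ∈ Finset.range (2 ^ s), (1 - C (x i) * X)

theorem prodPoly_succ (s : ℕ) (x : ℕ → K) :
    prodPoly (s + 1) x = prodPoly s x * prodPoly s fun i => x (2 ^ s + i) := by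
  rw [prodPoly, pow_succ, mul_two, Finset.prod_range_add]
  rfl

theorem prodPoly_coeff_zero (s : ℕ) (x : ℕ → K) : (prodPoly s x).coeff 0 = 1 := by
  rw [coeff_zero_eq_eval_zero, prodPoly, eval_prod]
  simp

/-- The subproduct tree of the points `x i` is stored. -/
def STree.Has (mem : List K) : (s : ℕ) → STree s → (ℕ → K) → Prop
  | 0, g, x => HasP mem g (prodPoly 0 x) ∧ g.length ≤ 2
  | s + 1, g, x => (HasP mem g.1 (prodPoly (s + 1) x) ∧ g.1.length ≤ 2 ^ (s + 1) + 1) ∧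
      STree.Has mem s g.2.1 x ∧ STree.Has mem s g.2.2 fun i => x (2 ^ s + i)

theorem STree.Has.root {mem : List K} : ∀ {s : ℕ} {g : STree s} {x : ℕ → K}, STree.Has mem s g x →
    HasP mem (STree.root s g) (prodPoly s x) ∧ (STree.root s g).length ≤ 2 ^ s + 1
  | 0, _, _, h => h
  | _ + 1, _, _, h => h.1

theorem STree.Has.mono {mem mem' : List K} (hm : mem <+: mem') : ∀ {s : ℕ} {g : STree s}
    {x : ℕ → K}, STree.Has mem s g x → STree.Has mem' s g x
  | 0, _, _, h => ⟨h.1.mono hm, h.2⟩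
  | _ + 1, _, _, h => ⟨⟨h.1.1.mono hm, h.1.2⟩, h.2.1.mono hm, h.2.2.mono hm⟩

/-- Construction of the subproduct tree. -/
def buildTree (pm : List Reg → List Reg → Prog K (List Reg)) :
    (s : ℕ) → (ℕ → Reg) → Prog K (STree s)
  | 0, a => do
      let z ← Prog.instr (.const 0)
      let o ← Prog.instr (.const 1)
      let c ← Prog.instr (.sub z (a 0))
      pure ([o, c] : List Reg)
  | s + 1, a => do
      let l ← buildTree pm s a
      let r ← buildTree pm s fun i => a (2 ^ s + i)
      let g ← pm (STree.root s l) (STree.root s r)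
      pure ((g, l, r) : List Reg × STree s × STree s)

theorem buildTree_triple {pm : List Reg → List Reg → Prog K (List Reg)} {κ L : ℕ}
    (hpm : IsLinearMul pm κ L) (s : ℕ) {a : ℕ → Reg} {x : ℕ → K} {mem : List K}
    (hs : 2 ^ s ≤ L) (ha : ∀ i, Has mem (a i) (x i)) :
    Triple (buildTree pm s a) mem ((2 * κ + 1) * ((s + 1) * 2 ^ s)) fun g mem' =>
      STree.Has mem' s g x := by
  induction s generalizing a x mem with
  | zero =>
    refine ((Triple.const 0 mem).bind fun z m₁ h₁ hz => (Triple.const 1 m₁).bind fun o m₂ h₂ ho =>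
      (Triple.sub (hz.mono h₂) ((ha 0).mono (h₁.trans h₂))).bind_pure
      (Q₂ := fun g mem' => STree.Has mem' 0 g x) fun c m₃ h₃ hc => ⟨?_, le_rfl⟩).le (by simp)
    have := hasP_cons (ho.mono h₃) (hasP_cons hc (hasP_nil m₃))
    convert this using 1
    simp [prodPoly]
    ring
  | succ s ih =>
    have hpow : 2 ^ (s + 1) = 2 ^ s + 2 ^ s := by rw [pow_succ]; omega
    have hpos : 1 ≤ 2 ^ s := Nat.one_le_two_pow
    have hcost : (2 * κ + 1) * ((s + 1) * 2 ^ s) + ((2 * κ + 1) * ((s + 1) * 2 ^ s) +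
        κ * 2 ^ (s + 1)) ≤ (2 * κ + 1) * ((s + 1 + 1) * 2 ^ (s + 1)) := by
      rw [hpow]
      nlinarith [Nat.zero_le (κ * 2 ^ s), Nat.zero_le (2 ^ s)]
    refine ((ih (by omega) ha).bind fun l m₁ h₁ hl => ?_).le hcost
    refine (ih (by omega) fun i => (ha (2 ^ s + i)).mono h₁).bind fun r m₂ h₂ hr => ?_
    refine (hpm (2 ^ (s + 1)) _ _ _ _ m₂ (by omega) hs (hl.mono h₂).root.1 hr.root.1
      (by have := hl.root.2; omega) (by have := hr.root.2; omega)).bind_pure fun g m₃ h₃ hg => ?_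
    refine ⟨⟨?_, ?_⟩, hl.mono (h₂.trans h₃), hr.mono h₃⟩
    · rw [prodPoly_succ]
      exact hg.1
    · have := hg.2
      have := hl.root.2
      have := hr.root.2
      change g.length ≤ _
      omega

/-- Descent along the subproduct tree: from the quotient of a polynomial by the root, as a power
series, to the quotients by the leaves. -/
def descend (pm : List Reg → List Reg → Prog K (List Reg)) :
    (s : ℕ) → STree s → List Reg → Prog K (ℕ → Reg)
  | 0, _, w => do
      let z ← Prog.instr (.const 0)
      pure fun _ => w.getD 0 z
  | s + 1, g, w => do
      let z ← Prog.instr (.const 0)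
      let p ← pm (STree.root s g.2.2) w
      let l ← descend pm s g.2.1 (window z (2 ^ s) (2 ^ s) p)
      let q ← pm (STree.root s g.2.1) w
      let r ← descend pm s g.2.2 (window z (2 ^ s) (2 ^ s) q)
      pure fun i => if i < 2 ^ s then l i else r (i - 2 ^ s)

/-- Middle product: for `t ≥ M`, the coefficient `t` of `P W` involves only coefficients of `W` of
index between `t - M` and `t`, all inside the known window. -/
theorem coeff_mul_window {P W : K[X]} {Φ : PowerSeries K} {o M n t : ℕ}
    (hP : P.degree < (M + 1 : ℕ)) (hW : ∀ i < n, W.coeff i = PowerSeries.coeff (o + i) Φ)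
    (hM : M ≤ t) (ht : t < n) :
    (P * W).coeff t = PowerSeries.coeff (o + t) (Φ * (P : PowerSeries K)) := by
  rw [mul_comm Φ, coeff_mul, PowerSeries.coeff_mul,
    Finset.Nat.sum_antidiagonal_eq_sum_range_succ_mk,
    Finset.Nat.sum_antidiagonal_eq_sum_range_succ_mk]
  refine (Finset.sum_congr rfl fun i hi => ?_).trans
    (Finset.sum_subset (s₁ := Finset.range (t + 1)) (fun i hi => ?_) fun i _ hi => ?_)
  · rw [Finset.mem_range] at hi
    rw [hW _ (by omega), Polynomial.coeff_coe, show o + (t - i) = o + t - i by omega]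
  · rw [Finset.mem_range] at *
    omega
  · rw [Finset.mem_range] at hi
    rw [Polynomial.coeff_coe, (degree_lt_iff_coeff_zero _ _).1 hP i (by omega), zero_mul]

/-- The hypothesis is the recurrence `Φ_n = F_n + α Φ_(n-1)`, which is Horner's rule: if `F` is a
reversed polynomial with `n + 1` coefficients, the result is its value at `α`. -/
theorem coeff_of_mul_one_sub {Φ : PowerSeries K} {F : K[X]} {α : K}
    (h : Φ * ((1 - C α * X : K[X]) : PowerSeries K) = F) (n : ℕ) :
    PowerSeries.coeff n Φ = ∑ j ∈ Finset.range (n + 1), F.coeff j * α ^ (n - j) := by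
  have hc : ∀ n, PowerSeries.coeff n Φ = F.coeff n + α * (if n = 0 then 0 else
      PowerSeries.coeff (n - 1) Φ) := by
    intro n
    have := congrArg (PowerSeries.coeff n) h
    rw [Polynomial.coeff_coe] at this
    rw [← this]
    push_cast
    rw [mul_sub, mul_one, map_sub, mul_left_comm, PowerSeries.coeff_C_mul]
    cases n with
    | zero => simp
    | succ n => simp [PowerSeries.coeff_succ_mul_X]
  induction n with
  | zero =>
    rw [hc]
    simp
  | succ n ih =>
    rw [hc, if_neg (Nat.succ_ne_zero n), Nat.add_sub_cancel, ih, Finset.sum_range_succ _ (n + 1),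
      Nat.sub_self, pow_zero, mul_one, add_comm, Finset.mul_sum]
    congr 1
    refine Finset.sum_congr rfl fun j hj => ?_
    rw [Finset.mem_range] at hj
    rw [show n + 1 - j = n - j + 1 by omega, pow_succ]
    ring

/-- At a node with product `G`, the list `w` holds the `2 ^ s` coefficients of `F / G` that end at
index `N - 1`. Multiplying by the product of the sibling removes its factors from the denominator
and loses the lower half of the window, leaving what the child needs. At a leaf one coefficient
remains, given by `coeff_of_mul_one_sub`. -/
theorem descend_triple {pm : List Reg → List Reg → Prog K (List Reg)} {κ L : ℕ}
    (hpm : IsLinearMul pm κ L) (s : ℕ) {g : STree s} {x : ℕ → K} {w : List Reg} {mem : List K}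
    {Φ : PowerSeries K} {F : K[X]} {N : ℕ} (hs : 2 ^ s ≤ L) (hN : 2 ^ s ≤ N)
    (hg : STree.Has mem s g x) (hΦ : Φ * (prodPoly s x : PowerSeries K) = F)
    (hw : HasL mem w fun i => PowerSeries.coeff (N - 2 ^ s + i) Φ) (hlen : w.length = 2 ^ s) :
    Triple (descend pm s g w) mem (2 * κ * (s * 2 ^ s)) fun r mem' =>
      ∀ i < 2 ^ s, Has mem' (r i) (∑ j ∈ Finset.range N, F.coeff j * x i ^ (N - 1 - j)) := by
  induction s generalizing x w mem Φ with
  | zero =>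
    refine ((Triple.const 0 mem).bind_pure fun z m₁ h₁ _ i hi => ?_).le (Nat.zero_le _)
    have h0 : i = 0 := by simpa using hi
    have := hw.getD (z := z) (i := 0) (by omega)
    rw [pow_zero, add_zero, coeff_of_mul_one_sub (α := x 0) (F := F) (by
      rw [← hΦ]
      simp [prodPoly])] at this
    rw [h0]
    rw [pow_zero] at hN
    rw [Nat.sub_add_cancel hN] at this
    exact this.mono h₁
  | succ s ih =>
    have hpow : 2 ^ (s + 1) = 2 ^ s + 2 ^ s := by rw [pow_succ]; omega
    have hpos : 1 ≤ 2 ^ s := Nat.one_le_two_pow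
    have hcost : 0 + (κ * 2 ^ (s + 1) + (2 * κ * (s * 2 ^ s) + (κ * 2 ^ (s + 1) +
        2 * κ * (s * 2 ^ s)))) ≤ 2 * κ * ((s + 1) * 2 ^ (s + 1)) := by
      rw [hpow]
      ring_nf
      omega
    obtain ⟨-, hl, hr⟩ := hg
    rw [prodPoly_succ, Polynomial.coe_mul] at hΦ
    have hwin : ∀ {P : K[X]} {p : List Reg} {z : Reg} {m : List K}, P.degree < (2 ^ s + 1 : ℕ) →
        HasP m p (P * polyOfSeq (fun i => PowerSeries.coeff (N - 2 ^ (s + 1) + i) Φ) w.length) →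
        Has m z 0 → HasL m (window z (2 ^ s) (2 ^ s) p)
          fun i => PowerSeries.coeff (N - 2 ^ s + i) (Φ * (P : PowerSeries K)) := by
      intro P p z m hP hp hz i hi
      have := hp.window hz (2 ^ s) (2 ^ s) i hi
      rw [length_window] at hi
      beta_reduce at this ⊢
      rw [coeff_mul_window hP (o := N - 2 ^ (s + 1)) (n := w.length) (Φ := Φ)
        (fun i hi => by rw [polyOfSeq_coeff, if_pos hi]) (by omega) (by omega)] at this
      rwa [show N - 2 ^ (s + 1) + (2 ^ s + i) = N - 2 ^ s + i by omega] at this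
    have hdeg : ∀ {g : STree s} {m : List K} {x : ℕ → K}, STree.Has m s g x →
        (prodPoly s x).degree < (2 ^ s + 1 : ℕ) := fun hg =>
      hg.root.1.degree_lt.trans_le (by exact_mod_cast hg.root.2)
    refine ((Triple.const 0 mem).bind fun z m₁ h₁ hz => ?_).le hcost
    refine (hpm (2 ^ (s + 1)) _ _ _ _ m₁ (by omega) hs (hr.mono h₁).root.1 (hw.mono h₁).hasP
      (by have := hr.root.2; omega) hlen.le).bind fun p m₂ h₂ hp => ?_
    refine (ih (Φ := Φ * (prodPoly s (fun i => x (2 ^ s + i)) : PowerSeries K)) (by omega)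
      (by omega) (hl.mono (h₁.trans h₂)) (by rw [← hΦ]; ring)
      (hwin (hdeg hr) hp.1 (hz.mono h₂)) (length_window _ _ _ _)).bind fun l m₃ h₃ hl' => ?_
    have h₁₃ := h₁.trans (h₂.trans h₃)
    refine (hpm (2 ^ (s + 1)) _ _ _ _ m₃ (by omega) hs (hl.mono h₁₃).root.1 (hw.mono h₁₃).hasP
      (by have := hl.root.2; omega) hlen.le).bind fun q m₄ h₄ hq => ?_
    refine (ih (Φ := Φ * (prodPoly s x : PowerSeries K)) (by omega)
      (by omega) (hr.mono (h₁₃.trans h₄)) (by rw [← hΦ]; ring)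
      (hwin (hdeg hl) hq.1 (hz.mono (h₂.trans (h₃.trans h₄)))) (length_window _ _ _ _)).bind_pure
      fun r m₅ h₅ hr' i hi => ?_
    by_cases hi' : i < 2 ^ s
    · rw [if_pos hi']
      exact (hl' i hi').mono (h₄.trans h₅)
    · rw [if_neg hi']
      have := hr' (i - 2 ^ s) (by omega)
      rwa [show 2 ^ s + (i - 2 ^ s) = i by omega] at this

/-- Evaluation at arbitrary points; both the polynomial and the list of points are completed
to length `2 ^ s`. -/
def multipoint (pm : List Reg → List Reg → Prog K (List Reg)) (s k : ℕ) (f : List Reg)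
    (a : Fin k → Reg) : Prog K (Fin k → Reg) := do
  let z ← Prog.instr (.const 0)
  let g ← buildTree pm s fun i => if h : i < k then a ⟨i, h⟩ else z
  let h ← invSeries pm (STree.root s g) s
  let p ← pm (padTo z (2 ^ s) f).reverse h
  let r ← descend pm s g (window z 0 (2 ^ s) p)
  pure fun i => r i

/-- The truncated inverse differs from the inverse power series by a multiple of `X ^ N`. -/
theorem coeff_mul_inv_eq {F G H : K[X]} {N : ℕ} (hG : G.coeff 0 = 1)
    (hH : (X : K[X]) ^ N ∣ G * H - 1) {t : ℕ} (ht : t < N) :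
    (F * H).coeff t =
      PowerSeries.coeff t ((F : PowerSeries K) * (G : PowerSeries K)⁻¹) := by
  have hG' : PowerSeries.constantCoeff (G : PowerSeries K) ≠ 0 := by
    rw [← PowerSeries.coeff_zero_eq_constantCoeff_apply, Polynomial.coeff_coe, hG]
    exact one_ne_zero
  obtain ⟨a, ha⟩ := hH
  have hinv : ((F * H : K[X]) : PowerSeries K) = (F : PowerSeries K) * (G : PowerSeries K)⁻¹ +
      (PowerSeries.X : PowerSeries K) ^ N * ((F : PowerSeries K) * (G : PowerSeries K)⁻¹ * (a : PowerSeries K)) := by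
    have h1 : (G : PowerSeries K) * (H : PowerSeries K) =
        1 + PowerSeries.X ^ N * (a : PowerSeries K) := by
      have := congrArg (fun p : K[X] => (p : PowerSeries K)) (sub_eq_iff_eq_add'.1 ha)
      simpa using this
    have h2 := PowerSeries.mul_inv_cancel _ hG'
    rw [Polynomial.coe_mul]
    linear_combination (F : PowerSeries K) * (G : PowerSeries K)⁻¹ * h1 -
      (F : PowerSeries K) * (H : PowerSeries K) * h2
  rw [← Polynomial.coeff_coe, hinv, map_add, PowerSeries.coeff_X_pow_mul', if_neg (by omega),
    add_zero]

theorem multipoint_triple {pm : List Reg → List Reg → Prog K (List Reg)} {κ L : ℕ}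
    (hpm : IsLinearMul pm κ L) {s k : ℕ} {f : List Reg} {a : Fin k → Reg} {p : K[X]} {x : Fin k → K}
    {mem : List K} (hs : 2 ^ s ≤ L) (hf : HasP mem f p) (ha : ∀ i, Has mem (a i) (x i))
    (hlen : f.length ≤ 2 ^ s) (hk : k ≤ 2 ^ s) :
    Triple (multipoint pm s k f a) mem ((9 * κ + 5) * ((s + 1) * 2 ^ s)) fun r mem' =>
      ∀ i, Has mem' (r i) (p.eval (x i)) := by
  have hcost : 0 + ((2 * κ + 1) * ((s + 1) * 2 ^ s) + ((4 * κ + 4) * 2 ^ s + (κ * 2 ^ s +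
      2 * κ * (s * 2 ^ s)))) ≤ (9 * κ + 5) * ((s + 1) * 2 ^ s) := by
    have h1 : 0 ≤ κ * (s * 2 ^ s) := Nat.zero_le _
    have h2 : 0 ≤ κ * 2 ^ s := Nat.zero_le _
    have h3 : 0 ≤ s * 2 ^ s := Nat.zero_le _
    nlinarith
  have hpos : 1 ≤ 2 ^ s := Nat.one_le_two_pow
  -- Missing points are replaced by `0` to make the tree complete; their values are dropped.
  let y : ℕ → K := fun i => if h : i < k then x ⟨i, h⟩ else 0
  refine ((Triple.const 0 mem).bind fun z m₁ h₁ hz => ?_).le hcost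
  refine (buildTree_triple hpm s (x := y) hs fun i => ?_).bind fun g m₂ h₂ hg => ?_
  · by_cases hi : i < k
    · simpa [hi, y] using (ha ⟨i, hi⟩).mono h₁
    · simpa [hi, y] using hz
  refine (invSeries_triple hpm hg.root.1 (prodPoly_coeff_zero s y) s hs).bind fun h m₃ h₃ hh => ?_
  obtain ⟨H, hH, hHlen, hdvd⟩ := hh
  have hpad : (padTo z (2 ^ s) f).length = 2 ^ s := length_padTo hlen
  have hrev := ((hf.mono h₁).padTo hz (2 ^ s)).hasL.reverse.hasP
  rw [List.length_reverse, hpad] at hrev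
  -- `F` is `p` reversed at length `2 ^ s`, so the sums delivered by the descent are values of `p`.
  set F := polyOfSeq (fun i => p.coeff (2 ^ s - 1 - i)) (2 ^ s) with hF
  refine (hpm (2 ^ s) _ _ _ _ m₃ hpos hs (hrev.mono (h₂.trans h₃)) hH (by simp [hpad])
    hHlen).bind fun w m₄ h₄ hw => ?_
  have h₂₄ := h₂.trans (h₃.trans h₄)
  refine (descend_triple hpm s (Φ := (F : PowerSeries K) * (prodPoly s y : PowerSeries K)⁻¹)
    (F := F) (N := 2 ^ s) hs le_rfl (hg.mono (h₃.trans h₄)) ?_ ?_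
    (length_window _ _ _ _)).bind_pure fun r m₅ h₅ hr i => ?_
  · rw [mul_assoc, PowerSeries.inv_mul_cancel, mul_one]
    rw [← PowerSeries.coeff_zero_eq_constantCoeff_apply, Polynomial.coeff_coe,
      prodPoly_coeff_zero]
    exact one_ne_zero
  · intro i hi
    have := hw.1.window (hz.mono h₂₄) 0 (2 ^ s) i hi
    rw [length_window] at hi
    beta_reduce at this ⊢
    rw [zero_add, coeff_mul_inv_eq (prodPoly_coeff_zero s y) hdvd hi] at this
    rwa [Nat.sub_self, zero_add]
  · have := hr i (i.2.trans_le hk)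
    have hy : y i = x i := by simp [y]
    have hdeg : p.natDegree < 2 ^ s := by
      by_cases h0 : p = 0
      · simp [h0]
      · refine (natDegree_lt_iff_degree_lt h0).2 (hf.degree_lt.trans_le ?_)
        exact_mod_cast hlen
    rw [hy] at this
    rw [eval_eq_sum_range' hdeg, ← Finset.sum_range_reflect]
    convert this using 1
    refine Finset.sum_congr rfl fun j hj => ?_
    rw [Finset.mem_range] at hj
    rw [hF, polyOfSeq_coeff, if_pos hj]

end Multipoint

/-! ### Choice of the evaluation method, by a search for a geometric progression -/

section Evaluation

variable {K : Type*} [Field K]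

/-- The points form a geometric progression. -/
def IsGeometric {k : ℕ} (x : Fin k → K) : Prop := ∃ a q : K, ∀ i : Fin k, x i = a * q ^ (i : ℕ)

open Classical in
/-- Evaluation of a polynomial at a list of points, which is first searched for a geometric
progression. -/
noncomputable def evalPoly (pm : List Reg → List Reg → Prog K (List Reg)) {k : ℕ} (f : List Reg)
    (a : Fin k → Reg) : Prog K (Fin k → Reg) :=
  if hk : k ≤ 2 then Prog.tabulate k fun i => hornerProg f (a i)
  else
    let general := multipoint pm (Nat.clog 2 (max f.length k)) k f a
    Prog.test (a ⟨0, by omega⟩) fun z₀ => if z₀ then general else do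
      let q ← Prog.instr (.div (a ⟨1, by omega⟩) (a ⟨0, by omega⟩))
      Prog.test q fun z₁ => if z₁ then general else do
        let b ← Prog.tabulate (k - 1) fun i => do
          let u ← Prog.instr (.mul (a ⟨i, by omega⟩) q)
          let v ← Prog.instr (.sub (a ⟨i + 1, by omega⟩) u)
          Prog.test v pure
        if ∀ i, b i = true then bluestein pm k f (a ⟨0, by omega⟩) q else general

/-- The program is not told whether the points form a geometric progression and checks it with at
most `3 k` operations and tests. Three distinct points of a progression force a nonzero ratio, which
`bluestein` must invert; shorter lists are left to Horner's rule. -/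
theorem evalPoly_triple {pm : List Reg → List Reg → Prog K (List Reg)} {κ L c k : ℕ}
    {f : List Reg} {a : Fin k → Reg} {p : K[X]} {x : Fin k → K} {mem : List K}
    (hf : HasP mem f p) (ha : ∀ i, Has mem (a i) (x i))
    (hsmall : k ≤ 2 → 4 * f.length ≤ c) (hpm : 3 ≤ k → IsLinearMul pm κ L)
    (hL : 3 ≤ k → 2 * max f.length k ≤ L)
    (hgeom : 3 ≤ k → 3 * k + (κ + 8) * (f.length + k) ≤ c)
    (hgen : 3 ≤ k → (IsGeometric x ∧ Function.Injective x) ∨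
      3 * k + (9 * κ + 5) * ((Nat.clog 2 (max f.length k) + 1) *
        2 ^ Nat.clog 2 (max f.length k)) ≤ c) :
    Triple (evalPoly pm f a) mem c fun r mem' => ∀ i, Has mem' (r i) (p.eval (x i)) := by
  classical
  unfold evalPoly
  split_ifs with hk
  · refine (Triple.tabulate (Q := fun i r mem' => Has mem' r (p.eval (x i)))
      (fun i => stable_has _) fun i m₁ h₁ =>
        hornerProg_triple (hf.mono h₁) ((ha i).mono h₁)).le ((Nat.mul_le_mul_right _ hk).trans ?_)
    have := hsmall hk
    omega
  · have hk3 : 3 ≤ k := by omega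
    replace hpm := hpm hk3
    replace hL := hL hk3
    replace hgeom := hgeom hk3
    replace hgen := hgen hk3
    set s := Nat.clog 2 (max f.length k) with hs
    have hle : max f.length k ≤ 2 ^ s := Nat.le_pow_clog one_lt_two _
    have hsL : 2 ^ s ≤ L := by
      refine le_trans ?_ hL
      have hs0 : 0 < s := Nat.clog_pos one_lt_two (by omega)
      have := Nat.pow_pred_clog_lt_self one_lt_two (x := max f.length k) (by omega)
      rw [← hs] at this
      change 2 ^ (s - 1) < _ at this
      have hpow : 2 ^ s = 2 ^ (s - 1) * 2 := by
        rw [← pow_succ, Nat.sub_add_cancel (show 1 ≤ s by omega)]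
      omega
    have hgen' : ∀ mem', mem <+: mem' → Triple (multipoint pm s k f a) mem'
        ((9 * κ + 5) * ((s + 1) * 2 ^ s))
        fun r mem' => ∀ i, Has mem' (r i) (p.eval (x i)) := fun mem' h =>
      multipoint_triple hpm hsL (hf.mono h) (fun i => (ha i).mono h) (by omega) (by omega)
    set x₀ := x ⟨0, by omega⟩ with hx₀
    set x₁ := x ⟨1, by omega⟩ with hx₁
    -- The general method is reached only when the search fails, after `d` operations; this excludes
    -- the first alternative of `hgen`, and the second one pays for the method.
    have hcase : ∀ mem', mem <+: mem' → ∀ d ≤ 3 * k,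
        (IsGeometric x ∧ Function.Injective x → False) →
        Triple (multipoint pm s k f a) mem' (c - d)
          fun r mem' => ∀ i, Has mem' (r i) (p.eval (x i)) := by
      intro mem' h d hd hno
      exact (hgen' mem' h).le (by have := hgen.resolve_left hno; omega)
    -- Points 0 and 1 being distinct excludes `u = 0`, and points 1 and 2 being distinct excludes `v
    -- = 0`: here three points are needed.
    have hgx : IsGeometric x ∧ Function.Injective x → x₀ ≠ 0 ∧ x₁ ≠ 0 ∧
        ∀ i (hi : i + 1 < k), x ⟨i + 1, hi⟩ - x ⟨i, by omega⟩ * (x₁ / x₀) = 0 := by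
      rintro ⟨⟨u, v, huv⟩, hinj⟩
      have h0 : x₀ = u := by simp [hx₀, huv]
      have h1 : x₁ = u * v := by simp [hx₁, huv]
      have hu : u ≠ 0 := by
        rintro rfl
        have := @hinj ⟨0, by omega⟩ ⟨1, by omega⟩ (by simp [huv])
        simp at this
      have hv : v ≠ 0 := by
        rintro rfl
        have := @hinj ⟨1, by omega⟩ ⟨2, by omega⟩ (by simp [huv])
        simp at this
      refine ⟨h0 ▸ hu, h1 ▸ mul_ne_zero hu hv, fun i hi => ?_⟩
      rw [huv, huv, h0, h1]
      field_simp
      simp [pow_succ]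
    refine (Triple.test (c := c - 1) (ha _) fun z₀ hz₀ => ?_).le (by omega)
    change z₀ = true ↔ x₀ = 0 at hz₀
    by_cases h₀ : x₀ = 0
    · rw [if_pos (hz₀.2 h₀)]
      exact hcase mem List.prefix_rfl 1 (by omega) fun h => (hgx h).1 h₀
    rw [if_neg fun h => h₀ (hz₀.1 h)]
    refine (Triple.bind (c₁ := 1) (c₂ := c - 2) (Triple.div (ha _) (ha _))
      fun q m₁ hm₁ hq => ?_).le (by omega)
    refine (Triple.test (c := c - 3) hq fun z₁ hz₁ => ?_).le (by omega)
    change z₁ = true ↔ x₁ / x₀ = 0 at hz₁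
    by_cases h₁ : x₁ / x₀ = 0
    · rw [if_pos (hz₁.2 h₁)]
      exact hcase m₁ hm₁ 3 (by omega) fun h => div_ne_zero (hgx h).2.1 h₀ h₁
    rw [if_neg fun h => h₁ (hz₁.1 h)]
    refine (Triple.bind (c₁ := (k - 1) * 3) (c₂ := c - 3 * k) (Triple.tabulate
      (Q := fun (i : Fin (k - 1)) b _ => b = true ↔
        x ⟨i + 1, by omega⟩ - x ⟨i, by omega⟩ * (x₁ / x₀) = 0)
      (fun _ _ _ _ _ h => h) fun i m₂ hm₂ => ?_) fun b m₂ hm₂ hb => ?_).le (by omega)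
    · refine ((Triple.mul ((ha _).mono (hm₁.trans hm₂)) (hq.mono hm₂)).bind (c₂ := 2)
        fun u m₃ hm₃ hu => ?_).le (by omega)
      refine ((Triple.sub ((ha _).mono (hm₁.trans (hm₂.trans hm₃))) hu).bind (c₂ := 1)
        fun v m₄ hm₄ hv => ?_).le (by omega)
      exact Triple.test (c := 0) hv fun z hz => Triple.pure hz
    · split_ifs with hall
      · have hx : ∀ i (hi : i < k), x ⟨i, hi⟩ = x₀ * (x₁ / x₀) ^ i := by
          intro i
          induction i with
          | zero => intro hi; simp [hx₀]
          | succ i ih =>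
            intro hi
            have := (hb ⟨i, by omega⟩).1 (hall _)
            rw [sub_eq_zero.1 this, ih, pow_succ]
            ring
        refine (bluestein_triple hpm (by omega) (by omega) (hf.mono (hm₁.trans hm₂))
          ((ha ⟨0, by omega⟩).mono (hm₁.trans hm₂)) (hq.mono hm₂) h₁).mono (by omega)
          fun r m₃ _ hr i => ?_
        have := hr i
        rw [← hx₀, ← hx i i.2] at this
        exact this
      · refine hcase m₂ (hm₁.trans hm₂) _ le_rfl fun h => hall fun i => (hb i).2 ?_
        exact (hgx h).2.2 i (by omega)

/-- Evaluation of a polynomial matrix at a list of points. -/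
noncomputable def evalMat (pm : List Reg → List Reg → Prog K (List Reg)) {m k : ℕ} (P : PMat m)
    (a : Fin k → Reg) : Prog K (Fin k → CMat m m) := do
  let V ← Prog.tabulate m fun i => Prog.tabulate m fun j => evalPoly pm (P i j) a
  pure fun l => Matrix.of fun i j => V i j l

theorem evalMat_triple {pm : List Reg → List Reg → Prog K (List Reg)} {m c k : ℕ}
    {A : PMat m} {a : Fin k → Reg} {P : Matrix (Fin m) (Fin m) K[X]} {x : Fin k → K} {mem : List K}
    (h : ∀ i j mem', mem <+: mem' → Triple (evalPoly pm (A i j) a) mem' c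
      fun r mem' => ∀ l, Has mem' (r l) ((P i j).eval (x l))) :
    Triple (evalMat pm A a) mem (m * (m * c)) fun V mem' =>
      ∀ l, HasM mem' (V l) (P.map (eval (x l))) :=
  (Triple.tabulate₂ (A := Fin k → Reg) (Q := fun i j r mem' =>
    ∀ l, Has mem' (r l) ((P i j).eval (x l)))
    (fun _ _ _ _ _ hm h l => (h l).mono hm) h).bind_pure fun _ _ _ hV l i j => hV i j l

end Evaluation

/-! ## Cost functions -/

section CostAnalysis

/-- The sum over `0 ≤ i ≤ log₂ d` of `2 ^ i * G (d / 2 ^ i)`. -/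
def dyadicSum (G : ℕ → ℕ) (d : ℕ) : ℕ := ∑ i ∈ Finset.range (Nat.log 2 d + 1), 2 ^ i * G (d / 2 ^ i)

theorem dyadicSum_of_two_le (G : ℕ → ℕ) {d : ℕ} (hd : 2 ≤ d) :
    dyadicSum G d = 2 * dyadicSum G (d / 2) + G d := by
  rw [dyadicSum, Finset.sum_range_succ', dyadicSum, Finset.mul_sum,
    Nat.log_of_one_lt_of_le one_lt_two hd]
  congr 1
  · refine Finset.sum_congr rfl fun i _ => ?_
    rw [pow_succ', Nat.div_div_eq_div_mul]
    ring
  · simp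

/-- Cost of a divide and conquer algorithm with threshold `T`. -/
def divideCost (T : ℕ) (hT : 1 ≤ T) (leaf node : ℕ → ℕ) (d : ℕ) : ℕ :=
  if d ≤ T then leaf d
  else divideCost T hT leaf node ((d + 1) / 2) + divideCost T hT leaf node (d / 2) + node d
termination_by d
decreasing_by all_goals omega

/-- The recursion has ceilings, the dyadic sum has floors. Treating `d` and `d + 1` together closes
the induction, since the halves of both lie in `{⌊d/2⌋, ⌊d/2⌋ + 1}`; this is why costs at `e + 1`
are compared with `G e`. The factor `3` comes from size `2`: when it is split, two leaves and a
node, each at most `G 1`. -/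
theorem divideCost_le {T : ℕ} (hT : 1 ≤ T) {leaf node G : ℕ → ℕ} (hG : ∀ e, 1 ≤ e → G e ≤ G (e + 1))
    (hleaf₁ : leaf 1 ≤ G 1) (hleaf : ∀ e, 1 ≤ e → leaf (e + 1) ≤ G e)
    (hnode : ∀ e, 1 ≤ e → node (e + 1) ≤ G e) (d : ℕ) (hd : 1 ≤ d) :
    divideCost T hT leaf node d ≤ 3 * dyadicSum G d ∧
      divideCost T hT leaf node (d + 1) ≤ 3 * dyadicSum G d := by
  induction d using Nat.strong_induction_on with
  | _ d ih =>
  have hone : dyadicSum G 1 = G 1 := by simp [dyadicSum]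
  have h1 : divideCost T hT leaf node 1 ≤ G 1 := by
    rw [divideCost, if_pos hT]
    exact hleaf₁
  rcases Nat.lt_or_ge d 2 with h | h
  · obtain rfl : d = 1 := by omega
    rw [hone]
    refine ⟨by omega, ?_⟩
    rw [divideCost]
    split_ifs
    · have := hleaf 1 le_rfl
      omega
    · have := hnode 1 le_rfl
      simp only [Nat.reduceAdd, Nat.reduceDiv] at *
      omega
  · rw [dyadicSum_of_two_le G h]
    obtain ⟨e, rfl⟩ : ∃ e, d = e + 1 := ⟨d - 1, by omega⟩
    have hGe := hG e (by omega)
    obtain ⟨i₁, i₂⟩ := ih ((e + 1) / 2) (by omega) (by omega)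
    have hchild : ∀ c, c = (e + 1) / 2 ∨ c = (e + 1) / 2 + 1 →
        divideCost T hT leaf node c ≤ 3 * dyadicSum G ((e + 1) / 2) := by
      rintro c (rfl | rfl)
      exacts [i₁, i₂]
    constructor
    · rw [divideCost]
      split_ifs
      · have := hleaf e (by omega)
        omega
      · have := hnode e (by omega)
        have := hchild ((e + 1 + 1) / 2) (by omega)
        have := hchild ((e + 1) / 2) (by omega)
        omega
    · rw [divideCost]
      split_ifs
      · have := hleaf (e + 1) (by omega)
        omega
      · have := hnode (e + 1) (by omega)
        have := hchild ((e + 1 + 1 + 1) / 2) (by omega)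
        have := hchild ((e + 1 + 1) / 2) (by omega)
        omega

/-- The function `F d / d` is nondecreasing. -/
def IsSuperlinear (F : ℕ → ℕ) : Prop := ∀ k d, 1 ≤ k → k ≤ d → d * F k ≤ k * F d

theorem isSuperlinear_of_monotoneOn {F : ℕ → ℕ}
    (h : MonotoneOn (fun d : ℕ => (F d : ℝ) / d) (Set.Ici 1)) : IsSuperlinear F := by
  intro k d hk hkd
  have := h (Set.mem_Ici.2 hk) (Set.mem_Ici.2 (hk.trans hkd)) hkd
  beta_reduce at this
  have hk' : (0 : ℝ) < k := by exact_mod_cast hk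
  have hd' : (0 : ℝ) < d := by exact_mod_cast hk.trans hkd
  rw [div_le_div_iff₀ hk' hd'] at this
  have h' : F k * d ≤ F d * k := by exact_mod_cast this
  linarith

namespace IsSuperlinear

variable {F : ℕ → ℕ} (h : IsSuperlinear F)

include h

theorem mono {k d : ℕ} (hk : 1 ≤ k) (hkd : k ≤ d) : F k ≤ F d := by
  have h1 := h k d hk hkd
  have h2 : k * F d ≤ d * F d := Nat.mul_le_mul_right _ hkd
  exact Nat.le_of_mul_le_mul_left (h1.trans h2) (hk.trans hkd)

theorem mul_one_le {d : ℕ} (hd : 1 ≤ d) : d * F 1 ≤ F d := by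
  simpa using h 1 d le_rfl hd

theorem pow_mul_le {d i : ℕ} (hi : i ≤ Nat.log 2 d) (hd : 1 ≤ d) : 2 ^ i * F (d / 2 ^ i) ≤ F d := by
  have hle : 2 ^ i ≤ d := (Nat.pow_le_pow_right two_pos hi).trans (Nat.pow_log_le_self 2 (by omega))
  have hk : 1 ≤ d / 2 ^ i := (Nat.one_le_div_iff (by positivity)).2 hle
  have h1 := h (d / 2 ^ i) d hk (Nat.div_le_self _ _)
  have h2 : 2 ^ i * (d / 2 ^ i) ≤ d := Nat.mul_div_le _ _
  refine Nat.le_of_mul_le_mul_left (c := d) ?_ hd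
  calc d * (2 ^ i * F (d / 2 ^ i)) = 2 ^ i * (d * F (d / 2 ^ i)) := by ring
    _ ≤ 2 ^ i * (d / 2 ^ i * F d) := Nat.mul_le_mul_left _ h1
    _ = 2 ^ i * (d / 2 ^ i) * F d := by ring
    _ ≤ d * F d := Nat.mul_le_mul_right _ h2

theorem le_mul_rate {k d : ℕ} (hk : 1 ≤ k) (hkd : k ≤ d) : F k ≤ k * (F d / d + 1) := by
  have h1 := h k d hk hkd
  have h2 : F d ≤ d * (F d / d + 1) := (Nat.lt_mul_div_succ (F d) (hk.trans hkd)).le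
  refine Nat.le_of_mul_le_mul_left (c := d) ?_ (hk.trans hkd)
  calc d * F k ≤ k * F d := h1
    _ ≤ k * (d * (F d / d + 1)) := Nat.mul_le_mul_left _ h2
    _ = d * (k * (F d / d + 1)) := by ring

end IsSuperlinear

/-- Level `i` contributes at most `d w` and, by superlinearity, at most `M d (log d + 1)` up to the
factor `v`; summing over the levels brings one more logarithm. The terms in `MM` are kept as they
are. -/
theorem dyadicSum_le {MM M : ℕ → ℕ} (hM : IsSuperlinear M) (C w v d : ℕ) (hd : 1 ≤ d) :
    dyadicSum (fun e => C * (MM e + e * w + v * (M e * (Nat.log 2 e + 1)))) d ≤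
      C * (dyadicSum MM d + (Nat.log 2 d + 1) * (d * w) +
        v * (M d * (Nat.log 2 d + 1) ^ 2)) := by
  have hterm : ∀ i ∈ Finset.range (Nat.log 2 d + 1),
      2 ^ i * (C * (MM (d / 2 ^ i) + d / 2 ^ i * w +
        v * (M (d / 2 ^ i) * (Nat.log 2 (d / 2 ^ i) + 1)))) ≤
      C * (2 ^ i * MM (d / 2 ^ i) + d * w + v * (M d * (Nat.log 2 d + 1))) := by
    intro i hi
    rw [Finset.mem_range] at hi
    have h1 := hM.pow_mul_le (show i ≤ Nat.log 2 d by omega) hd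
    have h2 : 2 ^ i * (d / 2 ^ i) ≤ d := Nat.mul_div_le _ _
    have h3 : Nat.log 2 (d / 2 ^ i) ≤ Nat.log 2 d := Nat.log_mono_right (Nat.div_le_self _ _)
    calc _ = C * (2 ^ i * MM (d / 2 ^ i) + 2 ^ i * (d / 2 ^ i) * w +
          v * (2 ^ i * M (d / 2 ^ i) * (Nat.log 2 (d / 2 ^ i) + 1))) := by ring
      _ ≤ _ := by gcongr
  refine (Finset.sum_le_sum hterm).trans (le_of_eq ?_)
  rw [← Finset.mul_sum, Finset.sum_add_distrib, Finset.sum_add_distrib, Finset.sum_const,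
    Finset.sum_const, Finset.card_range, dyadicSum]
  simp only [smul_eq_mul]
  ring

theorem log_add_one_le_lg (d : ℕ) : ((Nat.log 2 d + 1 : ℕ) : ℝ) ≤ 2 * lg d := by
  have h1 : (Nat.log 2 d : ℝ) ≤ Real.logb 2 d := by
    have := Real.natLog_le_logb d 2
    simpa using this
  have h2 : Real.logb 2 d ≤ lg d := le_max_right _ _
  have h3 : (1 : ℝ) ≤ lg d := le_max_left _ _
  push_cast
  linarith

variable {ω : ℝ} {Ω : ℕ → ℕ} {c : ℝ}

/-- The cost doubles at each level, plus `O(m ρ ^ k)` with `ρ = 2 ^ (ω - 1)`. As `ω > 2` gives `ρ >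
2`, the widest level dominates and no logarithm appears. The condition on `k` keeps the inner
dimension of the products at most `m`, so that rounding up the number of blocks is harmless. -/
theorem elimCost_le (hω : 2 < ω) (hc : 0 ≤ c) (hΩ : ∀ a, (Ω a : ℝ) ≤ c * (a : ℝ) ^ ω) :
    ∃ A : ℝ, 0 ≤ A ∧ ∀ m k : ℕ, 2 ^ k ≤ 2 * m →
      (elimCost Ω m k : ℝ) ≤ A * m * ((2 : ℝ) ^ (ω - 1)) ^ k := by
  set ρ : ℝ := (2 : ℝ) ^ (ω - 1) with hρ
  have hρ2 : 2 < ρ := by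
    have := Real.rpow_lt_rpow_of_exponent_lt (x := 2) one_lt_two (show (1 : ℝ) < ω - 1 by linarith)
    simpa using this
  have hτ : (2 : ℝ) ^ ω = 2 * ρ := by
    rw [hρ, Real.rpow_sub two_pos, Real.rpow_one]
    ring
  have hpow : ∀ k : ℕ, (((2 ^ k : ℕ) : ℝ)) ^ ω = 2 ^ k * ρ ^ k := by
    intro k
    push_cast
    rw [← Real.rpow_pow_comm two_pos.le, hτ, mul_pow]
  -- Chosen so that `2 A + (8 c + 2) ≤ A ρ`, for the induction step, and `2 ≤ A`, for a single
  -- column.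
  set A : ℝ := 2 + (8 * c + 2) / (ρ - 2) with hA
  have hA2 : A * (ρ - 2) ≥ 8 * c + 2 := by
    rw [hA, add_mul, div_mul_cancel₀ _ (by linarith)]
    nlinarith
  have hA0 : 2 ≤ A := by
    have : 0 ≤ (8 * c + 2) / (ρ - 2) := div_nonneg (by linarith) (by linarith)
    linarith
  refine ⟨A, by linarith, fun m k hk => ?_⟩
  induction k with
  | zero =>
    simp only [elimCost, pow_zero, mul_one]
    push_cast
    exact mul_le_mul_of_nonneg_right hA0 (Nat.cast_nonneg m)
  | succ k ih =>
    have hk' : 2 ^ k ≤ m := by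
      rw [pow_succ] at hk
      omega
    have h1 := ih (by omega)
    have hm0 : (0 : ℝ) ≤ m := Nat.cast_nonneg m
    have hρk : 0 < ρ ^ k := by positivity
    have h2k : (2 : ℝ) ^ k ≤ ρ ^ k := pow_le_pow_left₀ two_pos.le hρ2.le k
    have h2 : (mulRectCost Ω m (2 ^ k) (2 ^ k) : ℝ) ≤ 4 * c * m * ρ ^ k := by
      have hdiv : (m / 2 ^ k + 1) * 2 ^ k ≤ 2 * m := by
        have := Nat.div_mul_le_self m (2 ^ k)
        rw [add_mul, one_mul]
        omega
      have hself : 2 ^ k / 2 ^ k = 1 := Nat.div_self (by positivity)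
      have hdiv' : ((m / 2 ^ k + 1 : ℕ) : ℝ) * 2 ^ k ≤ 2 * m := by exact_mod_cast hdiv
      rw [mulRectCost, hself]
      have hΩk := hΩ (2 ^ k)
      rw [hpow] at hΩk
      calc (((m / 2 ^ k + 1) * ((1 + 1) * Ω (2 ^ k)) : ℕ) : ℝ)
          = ((m / 2 ^ k + 1 : ℕ) : ℝ) * (2 * Ω (2 ^ k)) := by
            push_cast
            ring
        _ ≤ ((m / 2 ^ k + 1 : ℕ) : ℝ) * (2 * (c * (2 ^ k * ρ ^ k))) := by gcongr
        _ = ((m / 2 ^ k + 1 : ℕ) : ℝ) * 2 ^ k * (2 * c * ρ ^ k) := by ring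
        _ ≤ 2 * m * (2 * c * ρ ^ k) := by gcongr
        _ = 4 * c * m * ρ ^ k := by ring
    rw [elimCost]
    push_cast
    calc (2 : ℝ) * elimCost Ω m k + 2 * mulRectCost Ω m (2 ^ k) (2 ^ k) + 2 * (m * 2 ^ k)
        ≤ 2 * (A * m * ρ ^ k) + 2 * (4 * c * m * ρ ^ k) + 2 * (m * ρ ^ k) := by gcongr
      _ = m * ρ ^ k * (2 * A + (8 * c + 2)) := by ring
      _ ≤ m * ρ ^ k * (2 * A + A * (ρ - 2)) := by gcongr
      _ = A * m * ρ ^ (k + 1) := by ring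

/-- The cost of computing Popov approximant bases at order one. -/
def mBasis1Cost (Ω : ℕ → ℕ) (m n : ℕ) : ℕ :=
  (n / 2 ^ Nat.clog 2 m + 1) * kernelStepCost Ω m (Nat.clog 2 m)

theorem two_pow_clog_le {m : ℕ} (hm : 1 ≤ m) : 2 ^ Nat.clog 2 m ≤ 2 * m := by
  rcases Nat.lt_or_ge m 2 with h | h
  · obtain rfl : m = 1 := by omega
    simp
  · have h0 := Nat.clog_pos one_lt_two h
    have h1 := Nat.pow_pred_clog_lt_self one_lt_two (x := m) (by omega)
    change 2 ^ (Nat.clog 2 m - 1) < m at h1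
    have h2 : 2 ^ Nat.clog 2 m = 2 ^ (Nat.clog 2 m - 1) * 2 := by
      rw [← pow_succ, Nat.sub_add_cancel (show 1 ≤ Nat.clog 2 m by omega)]
    omega

/-- The block width lies between `m` and `2 m`, so each block costs `O(m ^ ω)`, and there are at
most `n / m + 1` blocks. -/
theorem mBasis1Cost_le (hω : 2 < ω) (hc : 0 ≤ c) (hΩ : ∀ a, (Ω a : ℝ) ≤ c * (a : ℝ) ^ ω) :
    ∃ C : ℝ, 0 ≤ C ∧ ∀ m n : ℕ, 1 ≤ m →
      (mBasis1Cost Ω m n : ℝ) ≤ C * (((n / m + 1 : ℕ) : ℝ) * (m : ℝ) ^ ω) := by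
  obtain ⟨A, hA, helim⟩ := elimCost_le hω hc hΩ
  set ρ : ℝ := (2 : ℝ) ^ (ω - 1) with hρ
  have hρ0 : 0 < ρ := Real.rpow_pos_of_pos two_pos _
  have h2ω : 0 < (2 : ℝ) ^ ω := Real.rpow_pos_of_pos two_pos _
  refine ⟨6 * c + A * ρ + 4 * c * 2 ^ ω + 1, by positivity, fun m n hm => ?_⟩
  set k := Nat.clog 2 m with hk
  have hmk : m ≤ 2 ^ k := Nat.le_pow_clog one_lt_two m
  have hkm : 2 ^ k ≤ 2 * m := two_pow_clog_le hm
  have hm0 : (0 : ℝ) < m := by exact_mod_cast hm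
  have hmω : 0 < (m : ℝ) ^ ω := Real.rpow_pos_of_pos hm0 _
  have hkm' : ((2 ^ k : ℕ) : ℝ) ≤ 2 * m := by exact_mod_cast hkm
  have h1 : (mulRectCost Ω m m (2 ^ k) : ℝ) ≤ 6 * c * (m : ℝ) ^ ω := by
    have hdiv : 2 ^ k / m ≤ 2 := by
      rw [Nat.div_le_iff_le_mul_add_pred (by omega)]
      omega
    have : mulRectCost Ω m m (2 ^ k) ≤ 6 * Ω m := by
      rw [mulRectCost, Nat.div_self (by omega)]
      calc (1 + 1) * ((2 ^ k / m + 1) * Ω m) ≤ (1 + 1) * ((2 + 1) * Ω m) := by gcongr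
        _ = 6 * Ω m := by ring
    calc (mulRectCost Ω m m (2 ^ k) : ℝ) ≤ 6 * Ω m := by exact_mod_cast this
      _ ≤ 6 * (c * (m : ℝ) ^ ω) := by gcongr; exact hΩ m
      _ = _ := by ring
  have h2 : (elimCost Ω m k : ℝ) ≤ A * ρ * (m : ℝ) ^ ω := by
    have e1 : ρ ^ k ≤ ρ * (m : ℝ) ^ (ω - 1) := by
      rw [hρ, Real.rpow_pow_comm two_pos.le, ← Real.mul_rpow two_pos.le hm0.le]
      refine Real.rpow_le_rpow (by positivity) ?_ (by linarith)
      exact_mod_cast hkm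
    have e2 : (m : ℝ) * (m : ℝ) ^ (ω - 1) = (m : ℝ) ^ ω := by
      rw [Real.rpow_sub hm0, Real.rpow_one]
      field_simp
    calc (elimCost Ω m k : ℝ) ≤ A * m * ρ ^ k := helim m k hkm
      _ ≤ A * m * (ρ * (m : ℝ) ^ (ω - 1)) := by gcongr
      _ = A * ρ * (m * (m : ℝ) ^ (ω - 1)) := by ring
      _ = _ := by rw [e2]
  have h3 : (mulRectCost Ω m (2 ^ k) m : ℝ) ≤ 4 * c * 2 ^ ω * (m : ℝ) ^ ω := by
    have hdiv : m / 2 ^ k ≤ 1 := by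
      rw [Nat.div_le_iff_le_mul_add_pred (by positivity)]
      omega
    have : mulRectCost Ω m (2 ^ k) m ≤ 4 * Ω (2 ^ k) := by
      rw [mulRectCost]
      calc (m / 2 ^ k + 1) * ((m / 2 ^ k + 1) * Ω (2 ^ k)) ≤ (1 + 1) * ((1 + 1) * Ω (2 ^ k)) := by
            gcongr
        _ = 4 * Ω (2 ^ k) := by ring
    calc (mulRectCost Ω m (2 ^ k) m : ℝ) ≤ 4 * Ω (2 ^ k) := by exact_mod_cast this
      _ ≤ 4 * (c * ((2 ^ k : ℕ) : ℝ) ^ ω) := by gcongr; exact hΩ _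
      _ ≤ 4 * (c * (2 * m : ℝ) ^ ω) := by gcongr
      _ = _ := by rw [Real.mul_rpow two_pos.le hm0.le]; ring
  have h4 : (m : ℝ) * m ≤ (m : ℝ) ^ ω := by
    rw [← sq, ← Real.rpow_natCast]
    exact Real.rpow_le_rpow_of_exponent_le (by exact_mod_cast hm) (by exact_mod_cast hω.le)
  have h5 : ((n / 2 ^ k + 1 : ℕ) : ℝ) ≤ ((n / m + 1 : ℕ) : ℝ) := by
    exact_mod_cast Nat.succ_le_succ (Nat.div_le_div_left hmk hm)
  have h6 : (kernelStepCost Ω m k : ℝ) ≤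
      (6 * c + A * ρ + 4 * c * 2 ^ ω + 1) * (m : ℝ) ^ ω := by
    rw [kernelStepCost]
    push_cast
    linarith
  calc (mBasis1Cost Ω m n : ℝ) = ((n / 2 ^ k + 1 : ℕ) : ℝ) * kernelStepCost Ω m k := by
        rw [mBasis1Cost]
        push_cast
        rfl
    _ ≤ ((n / m + 1 : ℕ) : ℝ) * ((6 * c + A * ρ + 4 * c * 2 ^ ω + 1) * (m : ℝ) ^ ω) := by gcongr
    _ = _ := by ring

end CostAnalysis

/-! ## Fast building blocks -/

section Fast

variable {K : Type*} [Field K]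

theorem blockDegree_mono (b : ℕ) {ℓ ℓ' : ℕ} (h : ℓ ≤ ℓ') : blockDegree b ℓ ≤ blockDegree b ℓ' :=
  max_le_max le_rfl (Nat.div_le_div_right h)

theorem mulBlocksCost_mono (n b : ℕ) {F : ℕ → ℕ} (hF : IsSuperlinear F) {ℓ ℓ' : ℕ} (h : ℓ ≤ ℓ') :
    mulBlocksCost n b F ℓ ≤ mulBlocksCost n b F ℓ' := by
  have hk := blockDegree_mono b h
  have hFk := hF.mono (le_max_left 1 (ℓ / b)) hk
  change F (blockDegree b ℓ) ≤ _ at hFk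
  unfold mulBlocksCost
  dsimp only
  gcongr

/-- Blocks cut from lists of length at most `b e` have degree at most `e`: a fixed `b` buys a bound
at `e` instead of `ℓ`, for a constant factor and the cost of the additions. -/
theorem mulBlocksCost_le (n b : ℕ) {F : ℕ → ℕ} (hF : IsSuperlinear F) {ℓ e : ℕ}
    (h : ℓ ≤ b * e) (he : 1 ≤ e) :
    mulBlocksCost n b F ℓ ≤ b ^ 2 * F e + n ^ 2 * ((6 * b ^ 2 + 4 * b) * e) := by
  have hk : blockDegree b ℓ ≤ e := max_le he (Nat.div_le_of_le_mul h)
  have hFk := hF.mono (le_max_left 1 (ℓ / b)) hk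
  change F (blockDegree b ℓ) ≤ _ at hFk
  unfold mulBlocksCost
  dsimp only
  have hk2 : blockDegree b ℓ + 1 ≤ 2 * e := by omega
  calc _ ≤ b * (b * (F e + n * (n * (2 * (2 * e)))) + n * (n * (b * (2 * e) + 2 * (2 * e)))) := by
        gcongr
    _ = _ := by ring

/-- Since `M k / k` is nondecreasing, `M k ≤ k (M e / e + 1)` for `k ≤ e`. All products up to size
`b e` are thus charged at one uniform rate per coefficient, which makes the sums over the subproduct
tree immediate. -/
theorem isLinearMul_mulLists {mul : ℕ → List Reg → List Reg → Prog K (List Reg)} {M : ℕ → ℕ}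
    (hmul : IsListMul mul M) (hM : IsSuperlinear M) {b : ℕ} (hb : 1 ≤ b) {e : ℕ} (he : 1 ≤ e) :
    IsLinearMul (mulLists mul b) (11 * b ^ 2 * (M e / e + 1)) (b * e) := by
  intro N f g p q mem hN hNL hf hg hfN hgN
  refine (mulLists_triple hmul hb hf hg).le
    ((mulBlocksCost_mono 1 b hM (max_le hfN hgN)).trans ?_)
  have hk : blockDegree b N ≤ min N e := by
    refine max_le (le_min hN he) (le_min (Nat.div_le_self _ _) (Nat.div_le_of_le_mul hNL))
  have hk1 : 1 ≤ blockDegree b N := le_max_left _ _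
  have hMk := hM.le_mul_rate hk1 (hk.trans (min_le_right _ _))
  have hkN : blockDegree b N ≤ N := hk.trans (min_le_left _ _)
  unfold mulBlocksCost
  dsimp only
  generalize blockDegree b N = k at *
  generalize M e / e = r at *
  have h1 : k + 1 ≤ 2 * N := by omega
  calc _ ≤ b * (b * (N * (r + 1) + 1 * (1 * (2 * (2 * N)))) +
          1 * (1 * (b * (2 * N) + 2 * (2 * N)))) := by
        have : M k ≤ N * (r + 1) := hMk.trans (Nat.mul_le_mul_right _ hkN)
        gcongr
    _ = b ^ 2 * N * (r + 1) + 6 * b ^ 2 * N + 4 * (b * 1) * N := by ring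
    _ ≤ b ^ 2 * N * (r + 1) + 6 * b ^ 2 * N * (r + 1) + 4 * (b * b) * N * (r + 1) := by
        have : 1 ≤ r + 1 := by omega
        have h4 : 4 * (b * 1) * N ≤ 4 * (b * b) * N := by gcongr
        exact Nat.add_le_add (Nat.add_le_add le_rfl (Nat.le_mul_of_pos_right _ this))
          (h4.trans (Nat.le_mul_of_pos_right _ this))
    _ = 11 * b ^ 2 * (r + 1) * N := by ring

/-- For correctness some rate is enough, and this requires no growth condition on `M`. -/
theorem exists_isLinearMul {mul : ℕ → List Reg → List Reg → Prog K (List Reg)} {M : ℕ → ℕ}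
    (hmul : IsListMul mul M) {b : ℕ} (hb : 1 ≤ b) (L : ℕ) :
    ∃ κ, IsLinearMul (mulLists mul b) κ L := by
  refine ⟨∑ ℓ ∈ Finset.range (L + 1), mulBlocksCost 1 b M ℓ,
    fun N f g p q mem hN hNL hf hg hfN hgN => ?_⟩
  refine (mulLists_triple hmul hb hf hg).le (le_trans ?_ (Nat.le_mul_of_pos_right _ hN))
  refine Finset.single_le_sum (f := fun ℓ => mulBlocksCost 1 b M ℓ) (fun _ _ => Nat.zero_le _) ?_
  rw [Finset.mem_range]
  have := max_le hfN hgN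
  omega

/-- A program which runs free of charge only loads constants. -/
theorem Prog.run_of_cost_eq_zero {A : Type} (p : Prog K A) (mem : List K)
    (h : (p.run mem).cost = 0) :
    ∃ (a : A) (l : List K), ∀ mem' : List K, mem'.length = mem.length →
      p.run mem' = ⟨a, mem' ++ l, 0⟩ := by
  induction p generalizing mem with
  | ret a => exact ⟨a, [], fun mem' _ => by simp [Prog.run]⟩
  | exec i next ih =>
    cases i with
    | const c =>
      obtain ⟨a, l, hl⟩ := ih mem.length (mem ++ [c]) (by simpa [Prog.run, Instr.cost, Instr.result] using h)
      refine ⟨a, c :: l, fun mem' hm => ?_⟩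
      simp [Prog.run, Instr.result, Instr.cost, hm, hl (mem' ++ [c]) (by simp [hm])]
    | _ => simp [Prog.run, Instr.cost] at h
  | test a next ih => simp [Prog.run] at h

/-- A program of cost zero returns fixed addresses holding inputs or constants, and neither gives
the product of two inputs. The bound lets linear terms be absorbed in `M`. -/
theorem one_le_polyMulCost {M : ℕ → ℕ} (hM : PolyMulCost K M) : 1 ≤ M 1 := by
  by_contra h0
  obtain ⟨mul, hmul⟩ := hM 1
  -- The factors are the constant polynomials `a` and `b`, stored with a zero coefficient of degree
  -- one.
  have key : ∀ a b : K, let r := (mul [0, 1] [2, 3]).run [a, 0, b, 0]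
      (polyValue r.mem r.out).coeff 0 = a * b ∧ r.cost = 0 := by
    intro a b
    obtain ⟨-, h2, h3⟩ := hmul [0, 1] [2, 3] [a, 0, b, 0] rfl rfl (by simp) (by simp)
    refine ⟨?_, by omega⟩
    rw [h2]
    simp [polyValue, valueAt]
  obtain ⟨r, l, hl⟩ := Prog.run_of_cost_eq_zero _ _ (key 1 1).2
  have key' : ∀ a b : K, (polyValue ([a, 0, b, 0] ++ l) r).coeff 0 = a * b := by
    intro a b
    have := (key a b).1
    rwa [hl [a, 0, b, 0] rfl] at this
  simp only [polyValue_coeff] at key'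
  cases hr : r[0]? with
  | none => simpa [hr] using key' 1 1
  | some i =>
    simp only [hr, Option.map_some, Option.getD_some, valueAt] at key'
    match i with
    | 0 => simpa using key' 1 0
    | 1 => simpa using key' 1 1
    | 2 => simpa using key' 0 1
    | 3 => simpa using key' 1 1
    -- The value read after the inputs does not depend on `a` and `b`, so `1 * 1` and `0 * 0` would
    -- agree.
    | i + 4 =>
      have h1 := key' 1 1
      have h2 := key' 0 0
      simp only [List.cons_append, List.nil_append, List.getD_cons_succ] at h1 h2
      rw [h2] at h1
      simp at h1

/-- The building blocks made from multiplication algorithms. -/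
noncomputable def fastSubroutines (mulC : ∀ a, CMat a a → CMat a a → Prog K (CMat a a))
    (mulP : ∀ n, ℕ → PMat n → PMat n → Prog K (PMat n))
    (mulL : ℕ → List Reg → List Reg → Prog K (List Reg)) (b : ℕ) : Subroutines K where
  mBasis1 F t := mBasis1Prog mulC F t
  mulPoly {m} A B := mulBlocks (mulP m) b A B
  eval P a := evalMat (mulLists mulL b) P a
  mulConst A B := mulRect mulC A B

variable {mulC : ∀ a, CMat a a → CMat a a → Prog K (CMat a a)} {Ω : ℕ → ℕ}
  {mulP : ∀ n, ℕ → PMat n → PMat n → Prog K (PMat n)} {MM : ℕ → ℕ → ℕ}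
  {mulL : ℕ → List Reg → List Reg → Prog K (List Reg)} {M : ℕ → ℕ}

theorem fastSubroutines_correct (hC : IsSquareMul mulC Ω) (hP : ∀ n, IsPolyMul (mulP n) (MM n))
    (hL : IsListMul mulL M) {b : ℕ} (hb : 1 ≤ b) : (fastSubroutines mulC mulP mulL b).Correct where
  mBasis1 F t mem hF := by
    obtain ⟨Q₀, Q₁, h₀, h₁, hpop, hbas⟩ := (mBasis1Prog_triple hC t hF.hasM).2
    obtain ⟨v₀, rfl⟩ := hasM_iff.1 h₀
    obtain ⟨v₁, rfl⟩ := hasM_iff.1 h₁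
    exact ⟨v₀, v₁, hpop, hbas⟩
  mulPoly {m} A B mem hA hB :=
    hasPM_iff.1 (mulBlocks_triple (hP m) hb hA.hasPM hB.hasPM).2.1
  eval {m k} P a mem hP' ha := by
    have hA := hP'.hasPM
    obtain ⟨ℓ, hℓ⟩ := P.exists_lengthLe
    obtain ⟨κ, hκ⟩ := exists_isLinearMul hL hb (2 * max ℓ k)
    have := evalMat_triple (pm := mulLists mulL b) (A := P) (a := a) (P := P.value mem)
      (x := fun i => valueAt mem (a i)) (mem := mem)
      (c := 4 * ℓ + (3 * k + (κ + 8) * (ℓ + k)) + (3 * k + (9 * κ + 5) *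
        ((Nat.clog 2 (max ℓ k) + 1) * 2 ^ Nat.clog 2 (max ℓ k)))) fun i j mem' hm => by
      have hij := hℓ i j
      have hmax : max (P i j).length k ≤ max ℓ k := max_le_max hij le_rfl
      refine evalPoly_triple ((hA i j).mono hm) (fun i => (has_valueAt (ha i)).mono hm)
        (fun _ => by omega) (fun _ => hκ) (fun _ => by omega) (fun _ => ?_) fun _ => Or.inr ?_
      · have : (κ + 8) * ((P i j).length + k) ≤ (κ + 8) * (ℓ + k) := by gcongr
        omega
      · have hclog := Nat.clog_mono_right 2 hmax
        have : (9 * κ + 5) * ((Nat.clog 2 (max (P i j).length k) + 1) *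
            2 ^ Nat.clog 2 (max (P i j).length k)) ≤
            (9 * κ + 5) * ((Nat.clog 2 (max ℓ k) + 1) * 2 ^ Nat.clog 2 (max ℓ k)) := by
          gcongr
          exact one_le_two
        omega
    exact fun i => hasM_iff.1 (this.2 i)
  mulConst A B mem hA hB := by
    have := mulRect_triple hC hA.hasM hB.hasM
    exact hasM_iff.1 this.2

/-- Cost of one step of the iterative algorithm. -/
def stepCost (Ω : ℕ → ℕ) (MM : ℕ → ℕ → ℕ) (T b m n : ℕ) : ℕ :=
  m * (m * (4 * (T + 1))) + mulRectCost Ω m m n + mBasis1Cost Ω m n + m * (m * 2) +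
    mulBlocksCost m b (MM m) (T + 2) + m * (m * (T + 2))

/-- Each step adds at most one coefficient to the entries, so lengths stay at most `T + 1` and sizes
are bounded in terms of the threshold; the single point is handled by Horner's rule. -/
theorem mIntLoop_triple (hC : IsSquareMul mulC Ω) (hP : ∀ n, IsPolyMul (mulP n) (MM n))
    (hMM : ∀ n, IsSuperlinear (MM n)) {b : ℕ} (hb : 1 ≤ b) {T m n : ℕ} {s t : Fin m → ℤ} {d : ℕ}
    {E : Fin d → CMat m n} {Ev : Fin d → Matrix (Fin m) (Fin n) K} {α : Fin d → Reg}
    {x : Fin d → K} {A : PMat m} {P : Matrix (Fin m) (Fin m) K[X]} {ℓ : ℕ} {mem : List K}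
    (hE : ∀ i, HasM mem (E i) (Ev i)) (hα : ∀ i, Has mem (α i) (x i)) (hA : HasPM mem A P)
    (hℓ : A.LengthLe ℓ) (hT : ℓ + d ≤ T + 1) :
    Triple (mIntLoop (fastSubroutines mulC mulP mulL b) s d E α A t) mem
      (d * stepCost Ω MM T b m n) fun R mem' =>
        (∃ P', HasPM mem' R P') ∧ R.LengthLe (ℓ + d) := by
  induction d generalizing mem A P t ℓ with
  | zero => exact (Triple.pure ⟨⟨P, hA⟩, hℓ⟩).le (Nat.zero_le _)
  | succ d ih =>
    have hcost : m * (m * (4 * (T + 1))) + (mulRectCost Ω m m n + (mBasis1Cost Ω m n +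
        (m * (m * 2) + (mulBlocksCost m b (MM m) (T + 2) + (m * (m * (T + 2)) +
        d * stepCost Ω MM T b m n))))) ≤ (d + 1) * stepCost Ω MM T b m n := by
      rw [Nat.succ_mul d]
      have : stepCost Ω MM T b m n = m * (m * (4 * (T + 1))) + mulRectCost Ω m m n +
        mBasis1Cost Ω m n + m * (m * 2) + mulBlocksCost m b (MM m) (T + 2) +
        m * (m * (T + 2)) := rfl
      omega
    unfold mIntLoop
    refine ((evalMat_triple (pm := mulLists mulL b) (A := A) (a := fun _ : Fin 1 => α 0) (P := P)
      (x := fun _ => x 0) (c := 4 * (T + 1)) fun i j mem' hm => ?_).bind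
      fun V m₁ h₁ hV => ?_).le hcost
    · have := hℓ i j
      exact evalPoly_triple (κ := 0) (L := 0) ((hA i j).mono hm) (fun _ => (hα 0).mono hm)
        (fun _ => by omega) (by omega) (by omega) (by omega) (by omega)
    have hm₁ := mulRect_triple hC (hV 0) ((hE 0).mono h₁)
    simp only [Fintype.card_fin] at hm₁
    refine hm₁.bind fun R m₂ h₂ hR => ?_
    refine (mBasis1Prog_triple hC t hR).bind fun Q₀ m₃ h₃ hQ₀ => ?_
    obtain ⟨B₀, B₁, hB₀, hB₁, -⟩ := hQ₀
    have h₁₃ := h₁.trans (h₂.trans h₃)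
    refine (translateProg_triple hB₀ hB₁ ((hα 0).mono h₁₃)).bind fun Q m₄ h₄ hQ => ?_
    have h₁₄ := h₁₃.trans h₄
    have hQl := PMat.maxLength_le hQ.2
    have hAl := PMat.maxLength_le hℓ
    refine ((mulBlocks_triple (hP m) hb hQ.1 (hA.mono h₁₄)).le
      (mulBlocksCost_mono m b (hMM m) (ℓ' := T + 2) (by omega))).bind fun A' m₅ h₅ hA' => ?_
    have h₁₅ := h₁₄.trans h₅
    have hA'l : A'.LengthLe (ℓ + 1) := fun i j => (hA'.2 i j).trans (by omega)
    refine (rowDegreesProg_triple s hA'.1 (n := T + 2) fun i j => (hA'l i j).trans (by omega)).bind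
      fun t' m₆ h₆ _ => ?_
    have h₁₆ := h₁₅.trans h₆
    refine (ih (fun i => (hE i.succ).mono h₁₆) (fun i => (hα i.succ).mono h₁₆) (hA'.1.mono h₆)
      hA'l (by omega)).mono le_rfl fun R m₇ _ hR => ⟨hR.1, fun i j => (hR.2 i j).trans (by omega)⟩

/-- Cost of one node of the recursion tree, when each polynomial is evaluated in `ev d`
operations. -/
def nodeCost (Ω : ℕ → ℕ) (MM : ℕ → ℕ → ℕ) (ev : ℕ → ℕ) (b m n d : ℕ) : ℕ :=
  m * (m * ev d) + d / 2 * mulRectCost Ω m m n + m * (m * ((d + 1) / 2 + 1)) +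
    mulBlocksCost m b (MM m) ((d + 1) / 2 + 1)

/-- The proposition `geom` lets one induction serve both claims: with `True`, the halves inherit the
property of being a progression of distinct points; with `False`, nothing is required. The length `d
+ 1` is preserved because `(d/2 + 1) + ((d + 1)/2 + 1) - 1 = d + 1`. -/
theorem pmIntBasis_triple (hC : IsSquareMul mulC Ω) (hP : ∀ n, IsPolyMul (mulP n) (MM n))
    (hMM : ∀ n, IsSuperlinear (MM n)) {b : ℕ} (hb : 1 ≤ b) {T : ℕ} (hT : 1 ≤ T) {m n : ℕ}
    {geom : Prop} {ev : ℕ → ℕ}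
    (hev : ∀ {d : ℕ} {f : List Reg} {a : Fin (d / 2) → Reg} {p : K[X]} {x : Fin (d / 2) → K}
      {mem : List K}, 2 ≤ d → (geom → IsGeometric x ∧ Function.Injective x) → HasP mem f p →
      (∀ i, Has mem (a i) (x i)) → f.length ≤ (d + 1) / 2 + 1 →
      Triple (evalPoly (mulLists mulL b) f a) mem (ev d) fun r mem' =>
        ∀ i, Has mem' (r i) (p.eval (x i)))
    {d : ℕ} {s : Fin m → ℤ} {E : Fin d → CMat m n} {Ev : Fin d → Matrix (Fin m) (Fin n) K}
    {α : Fin d → Reg} {x : Fin d → K} {mem : List K}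
    (hE : ∀ i, HasM mem (E i) (Ev i)) (hα : ∀ i, Has mem (α i) (x i))
    (hx : geom → IsGeometric x ∧ Function.Injective x) :
    Triple (pmIntBasis (fastSubroutines mulC mulP mulL b) T hT d E α s) mem
      (divideCost T hT (fun d => d * stepCost Ω MM T b m n) (nodeCost Ω MM ev b m n) d)
      fun R mem' => (∃ P, HasPM mem' R P) ∧ R.LengthLe (d + 1) := by
  induction d using Nat.strong_induction_on generalizing s mem with
  | _ d ih =>
  rw [pmIntBasis, divideCost]
  split_ifs with hd
  · refine ((identityProg_triple m mem).bind fun A m₁ h₁ hA =>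
      (mIntLoop_triple hC hP hMM hb (fun i => (hE i).mono h₁) (fun i => (hα i).mono h₁) hA.1 hA.2
        (by omega)).mono le_rfl fun R m₂ _ hR => ⟨hR.1, fun i j => ?_⟩).le (Nat.zero_add _).le
    exact (hR.2 i j).trans (by omega)
  · set D := divideCost T hT (fun d => d * stepCost Ω MM T b m n) (nodeCost Ω MM ev b m n) with hD
    have hcost : D ((d + 1) / 2) + (m * (m * ev d) + (d / 2 * mulRectCost Ω m m n +
        (m * (m * ((d + 1) / 2 + 1)) + (D (d / 2) +
          mulBlocksCost m b (MM m) ((d + 1) / 2 + 1))))) ≤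
        D ((d + 1) / 2) + D (d / 2) + nodeCost Ω MM ev b m n d := by
      rw [nodeCost]
      omega
    refine ((ih ((d + 1) / 2) (by omega) (fun i => hE ⟨i, by omega⟩) (fun i => hα ⟨i, by omega⟩)
      fun hg => ?_).bind fun A₁ m₁ h₁ hA₁ => ?_).le hcost
    · obtain ⟨⟨u, v, huv⟩, hinj⟩ := hx hg
      exact ⟨⟨u, v, fun i => huv _⟩, fun i j hij => Fin.ext (by simpa using hinj hij)⟩
    obtain ⟨⟨P₁, hP₁⟩, hl₁⟩ := hA₁
    have hx₂ : geom → IsGeometric (fun i : Fin (d / 2) => x ⟨(d + 1) / 2 + i, by omega⟩) ∧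
        Function.Injective (fun i : Fin (d / 2) => x ⟨(d + 1) / 2 + i, by omega⟩) := by
      intro hg
      obtain ⟨⟨u, v, huv⟩, hinj⟩ := hx hg
      refine ⟨⟨u * v ^ ((d + 1) / 2), v, fun i => ?_⟩, fun i j hij =>
        Fin.ext (by simpa using hinj hij)⟩
      change x _ = _
      rw [huv, pow_add, mul_assoc]
    refine (evalMat_triple (P := P₁)
      (x := fun i : Fin (d / 2) => x ⟨(d + 1) / 2 + i, by omega⟩) fun i j m' hm' =>
      hev (by omega) hx₂ ((hP₁ i j).mono hm')
        (fun i => (hα ⟨(d + 1) / 2 + i, by omega⟩).mono (h₁.trans hm')) (hl₁ i j)).bind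
      fun V m₂ h₂ hV => ?_
    have h₁₂ := h₁.trans h₂
    refine (Triple.tabulate (c := mulRectCost Ω m m n) (Q := fun (i : Fin (d / 2)) R mem' =>
        HasM mem' R (P₁.map (eval (x ⟨(d + 1) / 2 + i, by omega⟩)) *
          Ev ⟨(d + 1) / 2 + i, by omega⟩))
      (fun i _ _ _ hm h => h.mono hm) fun i mem' hm => ?_).bind fun R m₃ h₃ hR => ?_
    · have := mulRect_triple hC ((hV i).mono hm)
        ((hE ⟨(d + 1) / 2 + i, by omega⟩).mono (h₁₂.trans hm))
      simp only [Fintype.card_fin] at this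
      exact this
    refine (rowDegreesProg_triple s (hP₁.mono (h₂.trans h₃)) hl₁).bind fun t m₄ h₄ _ => ?_
    have h₁₄ := h₁₂.trans (h₃.trans h₄)
    refine (ih (d / 2) (by omega) (fun i => (hR i).mono h₄) (fun i => (hα _).mono h₁₄) hx₂).bind
      fun A₂ m₅ h₅ hA₂ => ?_
    obtain ⟨⟨P₂, hP₂⟩, hl₂⟩ := hA₂
    have hm₁ := PMat.maxLength_le hl₁
    have hm₂ := PMat.maxLength_le hl₂
    exact (mulBlocks_triple (hP m) hb hP₂ (hP₁.mono (h₂.trans (h₃.trans (h₄.trans h₅))))).mono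
      (mulBlocksCost_mono m b (hMM m) (by omega)) fun W m₆ _ hW =>
      ⟨⟨_, hW.1⟩, fun i j => (hW.2 i j).trans (by omega)⟩

end Fast

/-! ## Cost of the divide and conquer algorithm -/

section Existence

variable {K : Type*} [Field K]

theorem exists_isSquareMul {ω : ℝ} (h : MatMulExponent K ω) :
    ∃ (mul : ∀ a, CMat a a → CMat a a → Prog K (CMat a a)) (Ω : ℕ → ℕ) (c : ℝ), 0 ≤ c ∧
      IsSquareMul mul Ω ∧ ∀ a, (Ω a : ℝ) ≤ c * (a : ℝ) ^ ω := by
  obtain ⟨c, hc⟩ := h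
  choose mul hmul using hc
  have hnonneg : ∀ a : ℕ, 0 ≤ |c| * (a : ℝ) ^ ω := fun a => by positivity
  refine ⟨mul, fun a => ⌊|c| * (a : ℝ) ^ ω⌋₊, |c|, abs_nonneg c, ?_,
    fun a => Nat.floor_le (hnonneg a)⟩
  intro a A B P Q mem hA hB
  obtain ⟨vA, rfl⟩ := hasM_iff.1 hA
  obtain ⟨vB, rfl⟩ := hasM_iff.1 hB
  obtain ⟨h1, h2, h3⟩ := hmul a A B mem vA vB
  refine ⟨Nat.le_floor (h3.trans ?_), hasM_iff.2 ⟨h1, h2⟩⟩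
  exact mul_le_mul_of_nonneg_right (le_abs_self c) (by positivity)

theorem exists_isPolyMul {MM : ℕ → ℕ → ℕ} (h : PolyMatMulCost K MM) :
    ∃ mul : ∀ n, ℕ → PMat n → PMat n → Prog K (PMat n), ∀ n, IsPolyMul (mul n) (MM n) := by
  choose mul hmul using h
  refine ⟨mul, fun n k A B P Q mem hA hB hlA hlB => ?_⟩
  obtain ⟨vA, rfl⟩ := hasPM_iff.1 hA
  obtain ⟨vB, rfl⟩ := hasPM_iff.1 hB
  obtain ⟨h1, h2, h3⟩ := hmul n k A B mem hlA hlB vA vB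
  exact ⟨h3, hasPM_iff.2 ⟨h1, h2⟩⟩

theorem exists_isListMul {M : ℕ → ℕ} (h : PolyMulCost K M) :
    ∃ mul : ℕ → List Reg → List Reg → Prog K (List Reg), IsListMul mul M := by
  choose mul hmul using h
  refine ⟨mul, fun k f g p q mem hf hg hlf hlg => ?_⟩
  obtain ⟨vf, rfl⟩ := hf
  obtain ⟨vg, rfl⟩ := hg
  obtain ⟨h1, h2, h3⟩ := hmul k f g mem hlf hlg vf vg
  exact ⟨h3, h1, h2⟩

/-- Meant for a node of size `e + 1`. The products have operands of at most `2 (e + 1) ≤ b e`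
coefficients, within the range of the uniform rate, and linear terms are absorbed through `e ≤ M e`.
-/
theorem evalPoly_mulLists_triple {mul : ℕ → List Reg → List Reg → Prog K (List Reg)} {M : ℕ → ℕ}
    (hmul : IsListMul mul M) (hM : IsSuperlinear M) (hM1 : 1 ≤ M 1) {b : ℕ} (hb : 4 ≤ b)
    {e c k : ℕ} (he : 1 ≤ e) {f : List Reg} {a : Fin k → Reg} {p : K[X]} {x : Fin k → K}
    {mem : List K} (hf : HasP mem f p) (ha : ∀ i, Has mem (a i) (x i)) (hfe : f.length ≤ e + 1)
    (hke : k ≤ e) (hc : (66 * b ^ 2 + 27) * M e ≤ c)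
    (hg : (IsGeometric x ∧ Function.Injective x) ∨
      (792 * b ^ 2 + 23) * (M e * (Nat.log 2 e + 1)) ≤ c) :
    Triple (evalPoly (mulLists mul b) f a) mem c fun r mem' => ∀ i, Has mem' (r i) (p.eval (x i)) := by
  have hMe : e ≤ M e := by
    have := hM.mul_one_le he
    nlinarith
  have hbe : 4 * e ≤ b * e := Nat.mul_le_mul_right _ hb
  set κ := 11 * b ^ 2 * (M e / e + 1) with hκ
  have hκe : κ * e ≤ 22 * b ^ 2 * M e := by
    have h1 := Nat.div_mul_le_self (M e) e
    calc κ * e = 11 * b ^ 2 * (M e / e * e + e) := by rw [hκ]; ring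
      _ ≤ 11 * b ^ 2 * (M e + M e) := by gcongr
      _ = 22 * b ^ 2 * M e := by ring
  refine evalPoly_triple hf ha (fun _ => le_trans ?_ hc)
    (fun _ => isLinearMul_mulLists hmul hM (by omega) he) (fun _ => by omega)
    (fun _ => le_trans ?_ hc) (fun _ => hg.imp_right fun hc => le_trans ?_ hc)
  · calc 4 * f.length ≤ 27 * M e := by omega
      _ ≤ _ := Nat.mul_le_mul_right _ (by omega)
  · calc 3 * k + (κ + 8) * (f.length + k) ≤ 3 * e + (κ + 8) * (3 * e) := by
          gcongr
          omega
      _ = 3 * (κ * e) + 27 * e := by ring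
      _ ≤ 3 * (22 * b ^ 2 * M e) + 27 * M e := by gcongr
      _ = _ := by ring
  · have hclog : Nat.clog 2 (max f.length k) ≤ Nat.log 2 e + 1 := by
      refine Nat.clog_le_of_le_pow ((max_le hfe (by omega)).trans ?_)
      exact Nat.lt_pow_succ_log_self one_lt_two e
    have hlog := Nat.pow_log_le_self 2 (x := e) (by omega)
    set l := Nat.log 2 e
    calc 3 * k + (9 * κ + 5) * ((Nat.clog 2 (max f.length k) + 1) *
          2 ^ Nat.clog 2 (max f.length k))
        ≤ 3 * e + (9 * κ + 5) * ((l + 1 + 1) * 2 ^ (l + 1)) := by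
          gcongr
          exact one_le_two
      _ = 3 * e + (9 * κ + 5) * ((l + 2) * (2 ^ l * 2)) := by rw [pow_succ]
      _ ≤ 3 * e * (l + 1) + (9 * κ + 5) * ((2 * (l + 1)) * (e * 2)) := by
          exact Nat.add_le_add (Nat.le_mul_of_pos_right _ (Nat.succ_pos l))
            (Nat.mul_le_mul_left _ (Nat.mul_le_mul (by omega) (by omega)))
      _ = (36 * (κ * e) + 23 * e) * (l + 1) := by ring
      _ ≤ (36 * (22 * b ^ 2 * M e) + 23 * M e) * (l + 1) := by gcongr
      _ = _ := by ring

end Existence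

/-! ### Solving the recurrence for the cost -/

section Recursion

variable {Ω M F : ℕ → ℕ} {MM : ℕ → ℕ → ℕ} {T b m n C w : ℕ}

theorem stepCost_le (hF : ∀ n, IsSuperlinear (MM n)) (hb : T + 6 ≤ b)
    (hrect : mulRectCost Ω m m n ≤ C * w) (hbasis : mBasis1Cost Ω m n ≤ C * w) (hw : m ^ 2 ≤ w) :
    stepCost Ω MM T b m n ≤ (2 * C + 6 * b ^ 2 + 9 * b) * (MM m 1 + w) := by
  have h1 := mulBlocksCost_le m b (hF m) (ℓ := T + 2) (e := 1) (by omega) le_rfl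
  rw [stepCost]
  calc _ ≤ m * (m * (4 * (T + 1))) + C * w + C * w + m * (m * 2) +
        (b ^ 2 * MM m 1 + m ^ 2 * ((6 * b ^ 2 + 4 * b) * 1)) + m * (m * (T + 2)) := by gcongr
    _ = b ^ 2 * MM m 1 + 2 * C * w + (5 * T + 8 + 6 * b ^ 2 + 4 * b) * m ^ 2 := by ring
    _ ≤ (2 * C + 6 * b ^ 2 + 9 * b) * MM m 1 + 2 * C * w + (6 * b ^ 2 + 9 * b) * w := by
        have h2 : b ^ 2 ≤ 2 * C + 6 * b ^ 2 + 9 * b := by omega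
        have h3 : 5 * T + 8 + 6 * b ^ 2 + 4 * b ≤ 6 * b ^ 2 + 9 * b := by omega
        exact Nat.add_le_add (Nat.add_le_add_right (Nat.mul_le_mul_right _ h2) _)
          (Nat.mul_le_mul h3 hw)
    _ = _ := by ring

/-- A node of size `e + 1` is bounded at size `e`, as `divideCost_le` requires: the stored
polynomials have at most `2 e ≤ b e` coefficients. -/
theorem nodeCost_le (hF : ∀ n, IsSuperlinear (MM n)) (hb : T + 6 ≤ b)
    (hrect : mulRectCost Ω m m n ≤ C * w) (hw : m ^ 2 ≤ w) {ev : ℕ → ℕ} {e : ℕ} (he : 1 ≤ e) :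
    nodeCost Ω MM ev b m n (e + 1) ≤
      m ^ 2 * ev (e + 1) + (2 * C + 6 * b ^ 2 + 9 * b) * (MM m e + e * w) := by
  have hbe : 2 * e ≤ b * e := Nat.mul_le_mul_right _ (by omega)
  have h1 := mulBlocksCost_le m b (hF m) (ℓ := (e + 1 + 1) / 2 + 1) (by omega) he
  have h2 : (e + 1) / 2 ≤ 2 * e := by omega
  have h3 : (e + 1 + 1) / 2 + 1 ≤ 2 * e := by omega
  have h4 : 1 ≤ b := by omega
  rw [nodeCost]
  calc _ ≤ m * (m * ev (e + 1)) + 2 * e * (C * w) + m * (m * (2 * e)) +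
        (b ^ 2 * MM m e + m ^ 2 * ((6 * b ^ 2 + 4 * b) * e)) := by gcongr
    _ = m ^ 2 * ev (e + 1) + (b ^ 2 * MM m e + 2 * C * (e * w) +
        (2 + 6 * b ^ 2 + 4 * b) * e * m ^ 2) := by ring
    _ ≤ m ^ 2 * ev (e + 1) + ((2 * C + 6 * b ^ 2 + 9 * b) * MM m e + 2 * C * (e * w) +
        (6 * b ^ 2 + 9 * b) * e * w) := by
        have h5 : b ^ 2 ≤ 2 * C + 6 * b ^ 2 + 9 * b := by omega
        have h6 : 2 + 6 * b ^ 2 + 4 * b ≤ 6 * b ^ 2 + 9 * b := by omega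
        exact Nat.add_le_add_left (Nat.add_le_add (Nat.add_le_add_right
          (Nat.mul_le_mul_right _ h5) _) (Nat.mul_le_mul (Nat.mul_le_mul_right _ h6) hw)) _
    _ = _ := by ring

/-- Here `divideCost_le` is applied with `G e` proportional to `MM m e + e w + v M(e) (log e + 1)`,
where `w` stands for the work on constant matrices at one point; `v` will be `0` for geometric
points and `m ^ 2` in general. -/
theorem divideCost_pmIntBasis_le (hF : ∀ n, IsSuperlinear (MM n)) (hM : IsSuperlinear M)
    (hT : 1 ≤ T) (hb : T + 6 ≤ b) (hrect : mulRectCost Ω m m n ≤ C * w)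
    (hbasis : mBasis1Cost Ω m n ≤ C * w) (hw : m ^ 2 ≤ w) {ev : ℕ → ℕ} {A v : ℕ}
    (hev : ∀ e, 1 ≤ e → m ^ 2 * ev (e + 1) ≤ A * (MM m e + v * (M e * (Nat.log 2 e + 1))))
    {d : ℕ} (hd : 1 ≤ d) :
    divideCost T hT (fun d => d * stepCost Ω MM T b m n) (nodeCost Ω MM ev b m n) d ≤
      3 * (A + 2 * (2 * C + 6 * b ^ 2 + 9 * b)) * (dyadicSum (MM m) d +
        (Nat.log 2 d + 1) * (d * w) + v * (M d * (Nat.log 2 d + 1) ^ 2)) := by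
  have hstep := stepCost_le hF hb hrect hbasis hw
  have hnode := fun e he => nodeCost_le (ev := ev) (e := e) hF hb hrect hw he
  set B := 2 * C + 6 * b ^ 2 + 9 * b
  have hsum := dyadicSum_le (MM := MM m) hM (A + 2 * B) w v d hd
  refine (divideCost_le hT ?_ ?_ ?_ ?_ d hd).1.trans
    ((Nat.mul_le_mul_left 3 hsum).trans_eq (mul_assoc _ _ _).symm)
  · intro e he
    have h1 := (hF m).mono he (Nat.le_succ e)
    have h2 := hM.mono he (Nat.le_succ e)
    have h3 := Nat.log_mono_right (b := 2) (Nat.le_succ e)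
    gcongr
    exact Nat.le_succ e
  · calc 1 * stepCost Ω MM T b m n ≤ B * (MM m 1 + w) := by rwa [one_mul]
      _ ≤ (A + 2 * B) * (MM m 1 + 1 * w + v * (M 1 * (Nat.log 2 1 + 1))) :=
        Nat.mul_le_mul (by omega) (by omega)
  · intro e he
    have h1 := (hF m).mul_one_le he
    calc (e + 1) * stepCost Ω MM T b m n ≤ (2 * e) * (B * (MM m 1 + w)) :=
          Nat.mul_le_mul (by omega) hstep
      _ = 2 * B * (e * MM m 1 + e * w) := by ring
      _ ≤ (A + 2 * B) * (MM m e + e * w + v * (M e * (Nat.log 2 e + 1))) :=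
        Nat.mul_le_mul (by omega) (by omega)
  · intro e he
    calc nodeCost Ω MM ev b m n (e + 1)
        ≤ A * (MM m e + v * (M e * (Nat.log 2 e + 1))) + B * (MM m e + e * w) :=
          (hnode e he).trans (Nat.add_le_add_right (hev e he) _)
      _ ≤ A * (MM m e + e * w + v * (M e * (Nat.log 2 e + 1))) +
          2 * B * (MM m e + e * w + v * (M e * (Nat.log 2 e + 1))) :=
        Nat.add_le_add (Nat.mul_le_mul_left _ (by omega)) (Nat.mul_le_mul (by omega) (by omega))
      _ = _ := by ring

/-- Since `2 ^ i ⌊d / 2 ^ i⌋ ≥ d / 2`, every level is at least `d F(1) / 2`. With `MM(m, 1)` at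
least of order `m ^ ω`, this hides the work on constant matrices in `MM'` when `n ≤ m`. -/
theorem log_mul_one_le_dyadicSum (hF : IsSuperlinear F) {d : ℕ} (hd : 1 ≤ d) :
    (Nat.log 2 d + 1) * (d * F 1) ≤ 2 * dyadicSum F d := by
  have h : ∀ i ∈ Finset.range (Nat.log 2 d + 1), d * F 1 ≤ 2 * (2 ^ i * F (d / 2 ^ i)) := by
    intro i hi
    rw [Finset.mem_range] at hi
    have hle : 2 ^ i ≤ d :=
      (Nat.pow_le_pow_right two_pos (show i ≤ Nat.log 2 d by omega)).trans
        (Nat.pow_log_le_self 2 (by omega))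
    have hk : 1 ≤ d / 2 ^ i := (Nat.one_le_div_iff (by positivity)).2 hle
    have h1 := hF.mul_one_le hk
    have h2 : d ≤ 2 * (2 ^ i * (d / 2 ^ i)) := by
      have := Nat.div_add_mod d (2 ^ i)
      have := Nat.mod_lt d (y := 2 ^ i) (by positivity)
      have : 2 ^ i * 1 ≤ 2 ^ i * (d / 2 ^ i) := Nat.mul_le_mul_left _ hk
      omega
    calc d * F 1 ≤ 2 * (2 ^ i * (d / 2 ^ i)) * F 1 := Nat.mul_le_mul_right _ h2
      _ = 2 * (2 ^ i * (d / 2 ^ i * F 1)) := by ring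
      _ ≤ _ := by gcongr
  have := Finset.card_nsmul_le_sum _ _ _ (fun i hi => h i hi)
  rwa [Finset.card_range, smul_eq_mul, ← Finset.mul_sum] at this

end Recursion

/-! ### Cost bounds with the fast building blocks -/

section MainCost

variable {K : Type*} [Field K]

/-- With fast building blocks, the cost is bounded in terms of the number
`w = (n / m + 1) * ⌈m ^ ω⌉`. -/
theorem exists_pmIntBasis_cost_le {M : ℕ → ℕ} {MM : ℕ → ℕ → ℕ} {ω : ℝ} (hMcost : PolyMulCost K M)
    (hM : IsSuperlinear M) (hMMcost : PolyMatMulCost K MM) (hMM : ∀ n, IsSuperlinear (MM n))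
    (hMMM : ∃ c : ℝ, ∀ n d : ℕ, 1 ≤ d → (n : ℝ) ^ 2 * M d ≤ c * MM n d) (hω : 2 < ω)
    (hΩ : MatMulExponent K ω) {T : ℕ} (hT : 1 ≤ T) :
    ∃ S : Subroutines K, S.Correct ∧ ∃ C : ℕ, ∀ (m n d : ℕ) (s : Fin m → ℤ) (mem : List K)
      (E : Fin d → CMat m n) (α : Fin d → Reg), 1 ≤ m → 1 ≤ d → (∀ i, (E i).Valid mem) →
      (∀ i, α i < mem.length) → Function.Injective (fun i => valueAt mem (α i)) →
      (IsGeometric (fun i => valueAt mem (α i)) →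
        ((pmIntBasis S T hT d E α s).run mem).cost ≤ C * (dyadicSum (MM m) d +
          (Nat.log 2 d + 1) * (d * ((n / m + 1) * ⌈(m : ℝ) ^ ω⌉₊)))) ∧
      ((pmIntBasis S T hT d E α s).run mem).cost ≤ C * (dyadicSum (MM m) d +
        (Nat.log 2 d + 1) * (d * ((n / m + 1) * ⌈(m : ℝ) ^ ω⌉₊)) +
        m ^ 2 * (M d * (Nat.log 2 d + 1) ^ 2)) := by
  obtain ⟨mulC, Ω, c₀, hc₀, hC, hΩ⟩ := exists_isSquareMul hΩ
  obtain ⟨mulP, hP⟩ := exists_isPolyMul hMMcost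
  obtain ⟨mulL, hL⟩ := exists_isListMul hMcost
  obtain ⟨c₁, hc₁, hbasis⟩ := mBasis1Cost_le hω hc₀ hΩ
  obtain ⟨c₂, hc₂⟩ := hMMM
  have hM1 := one_le_polyMulCost hMcost
  -- Enough blocks to cut the entries of length at most `T + 2` met in the leaves into pieces of
  -- degree one, with room for the other constants.
  set b := T + 6 with hb
  set C₀ := ⌈c₁⌉₊ + 2 * ⌈c₀⌉₊ with hC₀
  set A₁ := 66 * b ^ 2 + 27 with hA₁
  set A₂ := 792 * b ^ 2 + 23 with hA₂
  set C := 3 * (A₁ * ⌈c₂⌉₊ + A₂ + 2 * (2 * C₀ + 6 * b ^ 2 + 9 * b)) with hCdef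
  refine ⟨fastSubroutines mulC mulP mulL b, fastSubroutines_correct hC hP hL (by omega), C,
    fun m n d s mem E α hm hd hE hα hinj => ?_⟩
  set w := (n / m + 1) * ⌈(m : ℝ) ^ ω⌉₊ with hw
  have hceil : (m : ℝ) ^ ω ≤ ⌈(m : ℝ) ^ ω⌉₊ := Nat.le_ceil _
  have hmw : m ^ 2 ≤ w := by
    have h1 : (m : ℝ) ^ 2 ≤ (m : ℝ) ^ ω := by
      rw [← Real.rpow_natCast]
      exact Real.rpow_le_rpow_of_exponent_le (by exact_mod_cast hm) (by exact_mod_cast hω.le)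
    have h2 : m ^ 2 ≤ ⌈(m : ℝ) ^ ω⌉₊ := by exact_mod_cast h1.trans hceil
    exact h2.trans (Nat.le_mul_of_pos_left _ (Nat.succ_pos _))
  have hrect : mulRectCost Ω m m n ≤ C₀ * w := by
    have h1 : Ω m ≤ ⌈c₀⌉₊ * ⌈(m : ℝ) ^ ω⌉₊ := by
      have : (Ω m : ℝ) ≤ ⌈c₀⌉₊ * ⌈(m : ℝ) ^ ω⌉₊ :=
        (hΩ m).trans (mul_le_mul (Nat.le_ceil _) hceil (by positivity) (by positivity))
      exact_mod_cast this
    rw [mulRectCost, Nat.div_self hm]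
    calc (1 + 1) * ((n / m + 1) * Ω m)
        ≤ (1 + 1) * ((n / m + 1) * (⌈c₀⌉₊ * ⌈(m : ℝ) ^ ω⌉₊)) := by gcongr
      _ = 2 * ⌈c₀⌉₊ * w := by rw [hw]; ring
      _ ≤ C₀ * w := Nat.mul_le_mul_right _ (Nat.le_add_left _ _)
  have hbas : mBasis1Cost Ω m n ≤ C₀ * w := by
    have h1 : (mBasis1Cost Ω m n : ℝ) ≤ ⌈c₁⌉₊ * (((n / m + 1 : ℕ) : ℝ) * ⌈(m : ℝ) ^ ω⌉₊) :=
      (hbasis m n hm).trans (mul_le_mul (Nat.le_ceil _)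
        (mul_le_mul_of_nonneg_left hceil (by positivity)) (by positivity) (by positivity))
    have h2 : mBasis1Cost Ω m n ≤ ⌈c₁⌉₊ * w := by exact_mod_cast h1
    exact h2.trans (Nat.mul_le_mul_right _ (Nat.le_add_right _ _))
  -- The domination of `m ^ 2 M` by `MM` absorbs the evaluation at geometric points.
  have hgeo : ∀ e, 1 ≤ e → m ^ 2 * (A₁ * M e) ≤ A₁ * ⌈c₂⌉₊ * MM m e := by
    intro e he
    have h1 : (m : ℝ) ^ 2 * M e ≤ ⌈c₂⌉₊ * MM m e :=
      (hc₂ m e he).trans (mul_le_mul_of_nonneg_right (Nat.le_ceil _) (Nat.cast_nonneg _))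
    have h2 : m ^ 2 * M e ≤ ⌈c₂⌉₊ * MM m e := by exact_mod_cast h1
    calc m ^ 2 * (A₁ * M e) = A₁ * (m ^ 2 * M e) := by ring
      _ ≤ A₁ * (⌈c₂⌉₊ * MM m e) := Nat.mul_le_mul_left _ h2
      _ = _ := by ring
  have hEv := fun i => (hE i).hasM
  have hαv := fun i => has_valueAt (hα i)
  refine ⟨fun hg => ?_, ?_⟩
  · refine (pmIntBasis_triple (geom := True) (ev := fun d => A₁ * M (d - 1)) hC hP hMM
      (by omega) hT (fun hd hx hf ha hl => evalPoly_mulLists_triple hL hM hM1 (by omega) (by omega)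
        hf ha (by omega) (by omega) le_rfl (Or.inl (hx trivial))) hEv hαv
        fun _ => ⟨hg, hinj⟩).1.trans ?_
    refine (divideCost_pmIntBasis_le (A := A₁ * ⌈c₂⌉₊) (v := 0) hMM hM hT hb.ge hrect hbas hmw
      (fun e he => ?_) hd).trans ?_
    · rw [Nat.add_sub_cancel, zero_mul, add_zero]
      exact hgeo e he
    · rw [zero_mul, add_zero]
      exact Nat.mul_le_mul_right _ (by omega)
  · refine (pmIntBasis_triple (geom := False)
      (ev := fun d => A₁ * M (d - 1) + A₂ * (M (d - 1) * (Nat.log 2 (d - 1) + 1))) hC hP hMM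
      (by omega) hT (fun hd hx hf ha hl => evalPoly_mulLists_triple hL hM hM1 (by omega) (by omega)
        hf ha (by omega) (by omega) (Nat.le_add_right _ _) (Or.inr (Nat.le_add_left _ _))) hEv hαv
        False.elim).1.trans ?_
    refine divideCost_pmIntBasis_le (A := A₁ * ⌈c₂⌉₊ + A₂) (v := m ^ 2) hMM hM hT hb.ge hrect
      hbas hmw (fun e he => ?_) hd
    rw [Nat.add_sub_cancel]
    calc m ^ 2 * (A₁ * M e + A₂ * (M e * (Nat.log 2 e + 1)))
        = m ^ 2 * (A₁ * M e) + A₂ * (m ^ 2 * (M e * (Nat.log 2 e + 1))) := by ring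
      _ ≤ A₁ * ⌈c₂⌉₊ * MM m e + A₂ * (m ^ 2 * (M e * (Nat.log 2 e + 1))) :=
        Nat.add_le_add_right (hgeo e he) _
      _ ≤ (A₁ * ⌈c₂⌉₊ + A₂) * MM m e +
          (A₁ * ⌈c₂⌉₊ + A₂) * (m ^ 2 * (M e * (Nat.log 2 e + 1))) := by
        gcongr
        · exact Nat.le_add_right _ _
        · exact Nat.le_add_left _ _
      _ = _ := by ring

theorem ceil_rpow_le {m : ℕ} (hm : 1 ≤ m) {ω : ℝ} (hω : 0 ≤ ω) :
    (⌈(m : ℝ) ^ ω⌉₊ : ℝ) ≤ 2 * (m : ℝ) ^ ω := by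
  have h1 : (1 : ℝ) ≤ (m : ℝ) ^ ω := Real.one_le_rpow (by exact_mod_cast hm) hω
  have h2 := (Nat.ceil_lt_add_one (zero_le_one.trans h1)).le
  linarith

theorem div_add_one_mul_ceil_rpow_le {m n : ℕ} (hm : 1 ≤ m) (hn : m ≤ n) {ω : ℝ} (hω : 0 ≤ ω) :
    (((n / m + 1) * ⌈(m : ℝ) ^ ω⌉₊ : ℕ) : ℝ) ≤ 4 * ((m : ℝ) ^ (ω - 1) * n) := by
  have hm0 : (0 : ℝ) < m := by exact_mod_cast hm
  have h1 : ((n / m + 1 : ℕ) : ℝ) ≤ 2 * (n / m) := by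
    have h2 : ((n / m : ℕ) : ℝ) ≤ n / m := Nat.cast_div_le
    have h3 : (1 : ℝ) ≤ n / m := by
      rw [le_div_iff₀ hm0, one_mul]
      exact_mod_cast hn
    push_cast
    linarith
  rw [Nat.cast_mul]
  calc ((n / m + 1 : ℕ) : ℝ) * (⌈(m : ℝ) ^ ω⌉₊ : ℝ) ≤ 2 * (n / m) * (2 * (m : ℝ) ^ ω) :=
        mul_le_mul h1 (ceil_rpow_le hm hω) (by positivity) (by positivity)
    _ = 4 * ((m : ℝ) ^ (ω - 1) * n) := by
        rw [Real.rpow_sub_one hm0.ne']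
        ring

end MainCost

end PolyMat

/-! ### Final assembly -/

theorem mainTheorem1 {K : Type*} [Field K] :
    -- correctness
    (∀ (S : PolyMat.Subroutines K), S.Correct → ∀ (T : ℕ) (hT : 1 ≤ T) (m n d : ℕ)
      (s : Fin m → ℤ) (mem : List K) (E : Fin d → PolyMat.CMat m n) (α : Fin d → PolyMat.Reg),
      (∀ i, (E i).Valid mem) → (∀ i, α i < mem.length) →
      Function.Injective (fun i => PolyMat.valueAt mem (α i)) →
      let r := (PolyMat.pmIntBasis S T hT d E α s).run mem
      r.out.Valid r.mem ∧
        PolyMat.IsOrderedWeakPopov s (r.out.value r.mem) ∧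
        PolyMat.IsRowBasis (r.out.value r.mem)
          (PolyMat.interpolantModule (fun i => (E i).value mem)
            (fun i => PolyMat.valueAt mem (α i)))) ∧
    -- cost
    (∀ (M : ℕ → ℕ) (MM : ℕ → ℕ → ℕ) (ω : ℝ),
      PolyMat.PolyMulCost K M →
      MonotoneOn (fun d : ℕ => (M d : ℝ) / d) (Set.Ici 1) →
      PolyMat.PolyMatMulCost K MM →
      (∀ n, MonotoneOn (fun d : ℕ => (MM n d : ℝ) / d) (Set.Ici 1)) →
      (∃ c : ℝ, ∀ n d : ℕ, 1 ≤ d → (n : ℝ) ^ 2 * M d ≤ c * MM n d) →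
      2 < ω → PolyMat.MatMulExponent K ω →
      (∃ c : ℝ, ∀ n : ℕ, (n : ℝ) ^ ω ≤ c * MM n 1) →
      ∀ (T : ℕ) (hT : 1 ≤ T), ∃ S : PolyMat.Subroutines K, S.Correct ∧
        ∃ c : ℝ, ∀ (m n d : ℕ) (s : Fin m → ℤ) (mem : List K)
          (E : Fin d → PolyMat.CMat m n) (α : Fin d → PolyMat.Reg),
          1 ≤ m → 1 ≤ d → (∀ i, (E i).Valid mem) → (∀ i, α i < mem.length) →
          Function.Injective (fun i => PolyMat.valueAt mem (α i)) →
          let cost : ℝ := ((PolyMat.pmIntBasis S T hT d E α s).run mem).cost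
          let geometric : Prop :=
            ∃ a q : K, ∀ i : Fin d, PolyMat.valueAt mem (α i) = a * q ^ (i : ℕ)
          let extra : ℝ := (m : ℝ) ^ 2 * M d * PolyMat.lg d ^ 2
          (n ≤ m →
            (geometric → cost ≤ c * PolyMat.MMSum MM m d) ∧
            cost ≤ c * (PolyMat.MMSum MM m d + extra)) ∧
          (m < n →
            (geometric → cost ≤ c * (PolyMat.MMSum MM m d +
              (m : ℝ) ^ (ω - 1) * n * d * PolyMat.lg d)) ∧
            cost ≤ c * (PolyMat.MMSum MM m d +
              (m : ℝ) ^ (ω - 1) * n * d * PolyMat.lg d + extra))) := by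
  refine ⟨?_, ?_⟩
  · intro S hS T hT m n d s mem E α hE hα _
    obtain ⟨P, u, hP, hpb⟩ := PolyMat.pmIntBasis_correct hS hT (s := s) (fun i => (hE i).hasM)
      (fun i => PolyMat.has_valueAt (hα i))
    obtain ⟨hv, rfl⟩ := PolyMat.hasPM_iff.1 hP
    exact ⟨hv, hpb.isOrderedWeakPopov, hpb.isRowBasis⟩
  · intro M MM ω hMcost hM hMMcost hMM hMMM hω hΩ hMM1 T hT
    have hM' := PolyMat.isSuperlinear_of_monotoneOn hM
    have hMM' := fun n => PolyMat.isSuperlinear_of_monotoneOn (hMM n)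
    obtain ⟨S, hS, C, hC⟩ := PolyMat.exists_pmIntBasis_cost_le hMcost hM' hMMcost hMM' hMMM hω hΩ hT
    obtain ⟨c₁, hc₁⟩ := hMM1
    -- The constant covers all cases: `W ≤ 8 |c₁| N` if `n ≤ m`, `W ≤ 8 R` if `m < n`, and a factor
    -- `4` in front of `extra`.
    refine ⟨S, hS, C * (9 + 8 * |c₁|), fun m n d s mem E α hm hd hE hα hinj => ?_⟩
    obtain ⟨hgeo, hgen⟩ := hC m n d s mem E α hm hd hE hα hinj
    set w := (n / m + 1) * ⌈(m : ℝ) ^ ω⌉₊ with hw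
    intro cost geometric extra
    set N : ℝ := (PolyMat.MMSum MM m d : ℝ) with hN
    set W : ℝ := (((Nat.log 2 d + 1) * (d * w) : ℕ) : ℝ) with hW
    have hN0 : 0 ≤ N := Nat.cast_nonneg _
    have hC0 : (0 : ℝ) ≤ C := Nat.cast_nonneg _
    have hc0 : 0 ≤ |c₁| := abs_nonneg c₁
    have hlg := PolyMat.log_add_one_le_lg d
    have hextra : ((m ^ 2 * (M d * (Nat.log 2 d + 1) ^ 2) : ℕ) : ℝ) ≤ 4 * extra := by
      calc ((m ^ 2 * (M d * (Nat.log 2 d + 1) ^ 2) : ℕ) : ℝ)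
          = (m : ℝ) ^ 2 * M d * ((Nat.log 2 d + 1 : ℕ) : ℝ) ^ 2 := by push_cast; ring
        _ ≤ (m : ℝ) ^ 2 * M d * (2 * PolyMat.lg d) ^ 2 := by gcongr
        _ = 4 * extra := by ring
    have hextra0 : 0 ≤ extra := by positivity
    have hgeo' : geometric → cost ≤ C * (N + W) := fun hg => by
      have h := Nat.cast_le (α := ℝ).2 (hgeo hg)
      rwa [Nat.cast_mul, Nat.cast_add] at h
    have hgen' : cost ≤ C * (N + W + 4 * extra) := by
      have h1 : cost ≤ C * (N + W + ((m ^ 2 * (M d * (Nat.log 2 d + 1) ^ 2) : ℕ) : ℝ)) := by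
        have h := Nat.cast_le (α := ℝ).2 hgen
        rwa [Nat.cast_mul, Nat.cast_add, Nat.cast_add] at h
      exact h1.trans (by gcongr)
    refine ⟨fun hnm => ?_, fun hmn => ?_⟩
    -- Here `n / m + 1 ≤ 2`, so `w` is `O(m ^ ω)`, hence `O(MM m 1)`, and its logarithmically many
    -- levels fit in the dyadic sum.
    · have hWN : W ≤ 8 * |c₁| * N := by
        have hdiv : n / m ≤ 1 := Nat.div_le_of_le_mul (by omega)
        have h1 : (w : ℝ) ≤ 4 * |c₁| * MM m 1 := by
          calc (w : ℝ) = ((n / m + 1 : ℕ) : ℝ) * (⌈(m : ℝ) ^ ω⌉₊ : ℝ) := by rw [hw, Nat.cast_mul]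
            _ ≤ 2 * (2 * (|c₁| * MM m 1)) := by
              refine mul_le_mul (by exact_mod_cast Nat.succ_le_succ hdiv) ?_ (by positivity)
                (by positivity)
              refine (PolyMat.ceil_rpow_le hm (by linarith)).trans ?_
              have h2 := (hc₁ m).trans
                (mul_le_mul_of_nonneg_right (le_abs_self c₁) (Nat.cast_nonneg (MM m 1)))
              linarith
            _ = _ := by ring
        have h2 : (((Nat.log 2 d + 1) * (d * MM m 1) : ℕ) : ℝ) ≤ 2 * N := by
          have h := Nat.cast_le (α := ℝ).2 (PolyMat.log_mul_one_le_dyadicSum (hMM' m) hd)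
          rwa [Nat.cast_mul 2, Nat.cast_two] at h
        calc W = ((Nat.log 2 d + 1 : ℕ) : ℝ) * (d * (w : ℝ)) := by rw [hW]; push_cast; ring
          _ ≤ ((Nat.log 2 d + 1 : ℕ) : ℝ) * (d * (4 * |c₁| * MM m 1)) := by gcongr
          _ = 4 * |c₁| * (((Nat.log 2 d + 1) * (d * MM m 1) : ℕ) : ℝ) := by push_cast; ring
          _ ≤ 4 * |c₁| * (2 * N) := by gcongr
          _ = _ := by ring
      refine ⟨fun hg => (hgeo' hg).trans ?_, hgen'.trans ?_⟩
      · rw [mul_assoc]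
        exact mul_le_mul_of_nonneg_left (by linarith) hC0
      · rw [mul_assoc]
        have : 0 ≤ |c₁| * extra := by positivity
        exact mul_le_mul_of_nonneg_left (by linarith) hC0
    · set R : ℝ := (m : ℝ) ^ (ω - 1) * n * d * PolyMat.lg d with hR
      have hWR : W ≤ 8 * R := by
        calc W = ((Nat.log 2 d + 1 : ℕ) : ℝ) * (d * (w : ℝ)) := by rw [hW]; push_cast; ring
          _ ≤ 2 * PolyMat.lg d * (d * (4 * ((m : ℝ) ^ (ω - 1) * n))) := by
            have h1 : (w : ℝ) ≤ 4 * ((m : ℝ) ^ (ω - 1) * n) :=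
              PolyMat.div_add_one_mul_ceil_rpow_le hm hmn.le (by linarith)
            have h2 : 0 ≤ PolyMat.lg d := zero_le_one.trans (le_max_left _ _)
            gcongr
          _ = 8 * R := by ring
      have hR0 : 0 ≤ R := by
        have : 0 ≤ W := Nat.cast_nonneg _
        linarith
      have h1 : 0 ≤ |c₁| * N := by positivity
      have h2 : 0 ≤ |c₁| * R := by positivity
      have h3 : 0 ≤ |c₁| * extra := by positivity
      refine ⟨fun hg => (hgeo' hg).trans ?_, hgen'.trans ?_⟩
      · rw [mul_assoc]
        exact mul_le_mul_of_nonneg_left (by linarith) hC0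
      · rw [mul_assoc]
        exact mul_le_mul_of_nonneg_left (by linarith) hC0
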